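/- Let $R$ be a real closed field with algebraic closure $C=R[i]$, and let $n\ge 0$. Write $\mathbf y=(y_1,\dots,y_n)$, let $\mathbb A^n_R=\operatorname{Spec}R[\mathbf y]$ and $\mathbb A^{n+1}_R=\operatorname{Spec}R[\mathbf y,x]$, and let $\pi:\mathbb A^{n+1}_R\to\mathbb A^n_R$ be the projection forgetting the last coordinate. $R^n$ carries the Euclidean topology. **Definitions.** A semi-algebraic set in $R^n$ is a finite union of sets defined by finitely many polynomial conditions $f=0$ and $g>0$; a map between semi-algebraic sets is semi-algebraic if its graph is; a semi-algebraic set $S$ is semi-algebraically connected if it is not the disjoint union of two non-empty semi-algebraic subsets that are closed in $S$. A basic constructible set is a subset $T=V(I)\cap D(h)$ of $\mathbb A^{n+1}_R$, with $I$ an ideal of $R[\mathbf y,x]$ and $h\in R[\mathbf y,x]$. For $a\in R^n$ let $T_{\bar a}=\{z\in C:(a,z)\in T\}$ be its geometric fibre, and let $T(R)\subseteq R^{n+1}$ be its set of $R$-rational points. Let $S\subseteq R^n$ be a semi-algebraically connected semi-algebraic set. $T$ is *geometrically delineable* over $S$ if 1. $T_{\bar a}$ is finite, of the same cardinality, for all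 $a\in S$; 2. there are $k\ge 0$ and semi-algebraic continuous maps $\xi_1,\dots,\xi_k:S\to T(R)$ with $\pi\circ\xi_i=\mathrm{id}_S$, strictly ascending in the last coordinate; 3. each $t\in T(R)$ with $\pi(t)\in S$ equals $\xi_i(\pi(t))$ for exactly one $i$. The $\xi_i$ are the *sections* of $T$ over $S$. By convention, if there is $g\in R[\mathbf y,x]$ with $T_{\bar a}=D(g)_{\bar a}$ for all $a\in S$, and $V(g)$ satisfies 1–3 over $S$, then $T$ is also called geometrically delineable over $S$, and its sections over $S$ are those of $V(g)$. A family of basic constructible sets is *(jointly) geometrically delineable* over $S$ if each member is, and any two sections of members of the family are identical or disjoint. **Setting.** Let $Y=V(J)\subseteq\mathbb A^n_R$ and $X=V(I)\subseteq\mathbb A^{n+1}_R$ be closed subschemes, with $Y$ integral, such that $\pi$ induces a dominant, generically finite morphism $X\to Y$. Let $W=D(w)$ be a distinguished open subscheme of $Y$ such that $X_W=X\times_YW\to W$ is finite and free (i.e. the coordinate ring of $X_W$ is a free module over that of $W$). Let $X'=V(I')\subseteq\mathbb A^{n+1}_R$ be another closed subscheme, let $h,h'\in R[\mathbf y,x]$,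 and put $Z=X_W\cap X'$ (scheme-theoretic intersection) and $U=Z\cap D(h')$. Let $V$ be the scheme-theoretic image of $U$ in $W$ and assume that $V$ is integral. Let $v\in\mathcal O_V(V)$ be such that $U_v=V_v\times_VU\to V_v=D(v)\subseteq V$ is free, and let $S\subseteq V_v(R)\subseteq R^n$ be a semi-algebraically connected semi-algebraic set. **Statement.** Suppose that $X\cap D(h)$ and $X'\cap D(h')$ are each geometrically delineable over $S$. Then the family $\{X\cap D(h),\,X'\cap D(h')\}$ is geometrically delineable over $S$; that is, sections of $X\cap D(h)$ and of $X'\cap D(h')$ over $S$ are identical or disjoint. If in addition the union $(X\cap D(h))\cup(X'\cap D(h'))$ is a basic constructible set in $\mathbb A^{n+1}_R$, then this union is geometrically delineable over $S$. -/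

import Mathlib

namespace GeomCAD

/-! ### Semi-algebraic geometry over an ordered field -/

section SemiAlgebraic

/-- A basic semi-algebraic subset of `R^σ`: the solutions of finitely many polynomial equations
`f = 0` and finitely many strict inequalities `g > 0`. -/
def IsBasicSemialgebraic {R σ : Type*} [Field R] [LinearOrder R] (B : Set (σ → R)) : Prop :=
  ∃ F G : Set (MvPolynomial σ R), F.Finite ∧ G.Finite ∧
    B = {x | (∀ f ∈ F, MvPolynomial.eval x f = 0) ∧ ∀ g ∈ G, 0 < MvPolynomial.eval x g}

/-- A semi-algebraic set: a finite union of basic semi-algebraic sets. -/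
def IsSemialgebraic {R σ : Type*} [Field R] [LinearOrder R] (S : Set (σ → R)) : Prop :=
  ∃ 𝒞 : Set (Set (σ → R)), 𝒞.Finite ∧ (∀ B ∈ 𝒞, IsBasicSemialgebraic B) ∧ S = ⋃₀ 𝒞

/-- `S` is semi-algebraically connected: it is not the disjoint union of two non-empty
semi-algebraic subsets which are closed in `S`. The topology on `R^σ` is the product of the order
topologies, which is the Euclidean topology. -/
def IsSemialgebraicallyConnected {R σ : Type*} [Field R] [LinearOrder R] [TopologicalSpace R]
    (S : Set (σ → R)) : Prop :=
  ∀ A B : Set (σ → R), IsSemialgebraic A → IsSemialgebraic B →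
    IsClosed ((↑) ⁻¹' A : Set S) → IsClosed ((↑) ⁻¹' B : Set S) →
    A ∪ B = S → Disjoint A B → A = ∅ ∨ B = ∅

/-- A map `S → R^τ` with `S ⊆ R^σ` is semi-algebraic: its graph, inside `R^(σ ⊕ τ)`, is a
semi-algebraic set. -/
def IsSemialgebraicMap {R σ τ : Type*} [Field R] [LinearOrder R] {S : Set (σ → R)}
    (ξ : S → (τ → R)) : Prop :=
  IsSemialgebraic {p : σ ⊕ τ → R | ∃ a : S, p = Sum.elim (a : σ → R) (ξ a)}

end SemiAlgebraic

/-! ### Basic constructible sets and geometric delineability -/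

section Delineability

/-- The point of the affine space `Spec R[x_σ]` under a point `b` with coordinates in an
`R`-algebra `K` which is a field: the prime ideal of the polynomials vanishing at `b`. -/
noncomputable def point {R σ K : Type*} [CommRing R] [Field K] [Algebra R K] (b : σ → K) :
    PrimeSpectrum (MvPolynomial σ R) :=
  PrimeSpectrum.comap (MvPolynomial.aeval b : MvPolynomial σ R →ₐ[R] K).toRingHom ⊥

theorem point_mem_zeroLocus {R σ K : Type*} [CommRing R] [Field K] [Algebra R K] (b : σ → K)
    (E : Set (MvPolynomial σ R)) :
    (point b : PrimeSpectrum (MvPolynomial σ R)) ∈ PrimeSpectrum.zeroLocus E ↔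
      ∀ f ∈ E, MvPolynomial.aeval b f = 0 :=
  Iff.rfl

theorem point_mem_basicOpen {R σ K : Type*} [CommRing R] [Field K] [Algebra R K] (b : σ → K)
    (h : MvPolynomial σ R) :
    (point b : PrimeSpectrum (MvPolynomial σ R)) ∈ PrimeSpectrum.basicOpen h ↔
      MvPolynomial.aeval b h ≠ 0 :=
  Iff.rfl

/-- The set `V(I) ∩ D(h)` in the affine space `Spec R[x_σ]`. -/
def locus {R σ : Type*} [CommRing R] (I : Ideal (MvPolynomial σ R)) (h : MvPolynomial σ R) :
    Set (PrimeSpectrum (MvPolynomial σ R)) :=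
  PrimeSpectrum.zeroLocus (I : Set (MvPolynomial σ R)) ∩ PrimeSpectrum.basicOpen h

/-- A basic constructible set: the intersection of a closed set and a distinguished open set. -/
def IsBasicConstructible {R σ : Type*} [CommRing R]
    (T : Set (PrimeSpectrum (MvPolynomial σ R))) : Prop :=
  ∃ (I : Ideal (MvPolynomial σ R)) (h : MvPolynomial σ R), T = locus I h

variable {R : Type*} [Field R] {n : ℕ}

/-- The geometric fibre of `T ⊆ 𝔸^(n+1)` over the rational point `a ∈ R^n`: the set of all `z` in
the algebraic closure `C` of `R` such that `(a, z)` lies on `T`. -/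
def geomFiber (T : Set (PrimeSpectrum (MvPolynomial (Fin (n + 1)) R))) (a : Fin n → R) :
    Set (AlgebraicClosure R) :=
  {z | point (Fin.snoc (α := fun _ => AlgebraicClosure R)
    (fun i => algebraMap R (AlgebraicClosure R) (a i)) z) ∈ T}

variable [LinearOrder R] [TopologicalSpace R]

/-- `ξ 0 < ⋯ < ξ (k - 1)` delineate `T` over `S` (without the convention below):
the geometric fibres of `T` over `S` are finite of constant cardinality, the `ξ i` are
semi-algebraic continuous sections over `S` of the projection forgetting the last coordinate, with
values in the rational points `T(R)`, strictly ascending in the last coordinate, and each rational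
point of `T` over `S` lies on exactly one of them. -/
structure StrictlyDelineates {k : ℕ} (T : Set (PrimeSpectrum (MvPolynomial (Fin (n + 1)) R)))
    (S : Set (Fin n → R)) (ξ : Fin k → S → (Fin (n + 1) → R)) : Prop where
  card_fiber : ∃ m : ℕ, ∀ a ∈ S, (geomFiber T a).encard = m
  semialgebraic : ∀ i, IsSemialgebraicMap (ξ i)
  continuous : ∀ i, Continuous (ξ i)
  mem : ∀ i a, point (ξ i a) ∈ T
  proj : ∀ i (a : S), Fin.init (α := fun _ => R) (ξ i a) = a
  ascending : ∀ a : S, StrictMono fun i => ξ i a (Fin.last n)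
  cover : ∀ t : Fin (n + 1) → R, point t ∈ T → ∀ ht : Fin.init (α := fun _ => R) t ∈ S,
    ∃! i, t = ξ i ⟨Fin.init (α := fun _ => R) t, ht⟩

/-- `ξ` delineates `T` over `S`: either in the strict sense, or, by convention, `T` agrees over `S`
with some distinguished open set `D(g)` and `ξ` delineates the complement `V(g)` over `S`. -/
def Delineates {k : ℕ} (T : Set (PrimeSpectrum (MvPolynomial (Fin (n + 1)) R)))
    (S : Set (Fin n → R)) (ξ : Fin k → S → (Fin (n + 1) → R)) : Prop :=
  StrictlyDelineates T S ξ ∨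
    ∃ g : MvPolynomial (Fin (n + 1)) R,
      (∀ a ∈ S, geomFiber T a =
        geomFiber (PrimeSpectrum.basicOpen g : Set (PrimeSpectrum (MvPolynomial _ R))) a) ∧
      StrictlyDelineates (PrimeSpectrum.zeroLocus {g}) S ξ

/-- `T` is geometrically delineable over `S`. -/
def GeomDelineable (T : Set (PrimeSpectrum (MvPolynomial (Fin (n + 1)) R)))
    (S : Set (Fin n → R)) : Prop :=
  ∃ (k : ℕ) (ξ : Fin k → S → (Fin (n + 1) → R)), Delineates T S ξ

/-- The sections of `T` over `S`. -/
def sections (T : Set (PrimeSpectrum (MvPolynomial (Fin (n + 1)) R)))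
    (S : Set (Fin n → R)) : Set (S → (Fin (n + 1) → R)) :=
  {σ | ∃ (k : ℕ) (ξ : Fin k → S → (Fin (n + 1) → R)), Delineates T S ξ ∧ σ ∈ Set.range ξ}

/-- A family of sets is geometrically delineable over `S`: each member is, and any two
sections of members of the family are identical or disjoint. -/
def JointlyGeomDelineable {ι : Type*}
    (L : ι → Set (PrimeSpectrum (MvPolynomial (Fin (n + 1)) R))) (S : Set (Fin n → R)) : Prop :=
  (∀ i, GeomDelineable (L i) S) ∧
    ∀ i j, ∀ σ ∈ sections (L i) S, ∀ τ ∈ sections (L j) S,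
      σ = τ ∨ Disjoint (Set.range σ) (Set.range τ)

end Delineability

/-! ### The projection `X → Y` and the schemes built from it

Affine schemes are given by their coordinate rings and closed subschemes of affine space by
arbitrary ideals: `Y = Spec R[y]/J` in `𝔸^n`, and `X = Spec R[y,x]/I`, `X' = Spec R[y,x]/I'` in
`𝔸^(n+1)`, where `x` is the last variable. -/

section Projection

variable {R : Type*} [Field R] {n : ℕ}

/-- The inclusion `R[y] → R[y,x]`, i.e. the projection `𝔸^(n+1) → 𝔸^n`. -/
noncomputable def incl (R : Type*) [Field R] (n : ℕ) :
    MvPolynomial (Fin n) R →+* MvPolynomial (Fin (n + 1)) R :=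
  (MvPolynomial.rename Fin.castSucc : MvPolynomial (Fin n) R →ₐ[R] _).toRingHom

/-- The ring map `R[y]/J → R[y,x]/I` of the projection `V(I) → V(J)`. -/
noncomputable def projMap {J : Ideal (MvPolynomial (Fin n) R)}
    {I : Ideal (MvPolynomial (Fin (n + 1)) R)} (hJI : J ≤ I.comap (incl R n)) :
    MvPolynomial (Fin n) R ⧸ J →+* MvPolynomial (Fin (n + 1)) R ⧸ I :=
  Ideal.quotientMap I (incl R n) hJI

/-- The ring map makes the target a free module over the source. -/
def IsFreeRingHom {A B : Type*} [Semiring A] [Semiring B] (φ : A →+* B) : Prop :=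
  letI : Module A B := Module.compHom B φ
  Module.Free A B

/-- `V(I) → V(J)` is a projection of relative dimension 1: the morphism induced by the
projection `𝔸^(n+1) → 𝔸^n` is dominant. -/
def IsProjectionOfRelDimOne {J : Ideal (MvPolynomial (Fin n) R)}
    {I : Ideal (MvPolynomial (Fin (n + 1)) R)} (hJI : J ≤ I.comap (incl R n)) : Prop :=
  DenseRange (PrimeSpectrum.comap (projMap hJI))

/-- For `A` a domain, `Spec B → Spec A` is generically finite: the fibre over the generic point
(the zero ideal of `A`) is finite. -/
def IsGenericallyFinite {A B : Type*} [CommRing A] [CommRing B] (φ : A →+* B) : Prop :=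
  {P : PrimeSpectrum B | P.asIdeal.comap φ = ⊥}.Finite

theorem le_comap_sup {J : Ideal (MvPolynomial (Fin n) R)}
    {I : Ideal (MvPolynomial (Fin (n + 1)) R)} (hJI : J ≤ I.comap (incl R n))
    (I' : Ideal (MvPolynomial (Fin (n + 1)) R)) : J ≤ (I ⊔ I').comap (incl R n) :=
  hJI.trans (Ideal.comap_mono le_sup_left)

/-- The coordinate ring of `W = D(w) ⊆ Y`. -/
abbrev CoordW {J : Ideal (MvPolynomial (Fin n) R)} (w : MvPolynomial (Fin n) R ⧸ J) : Type _ :=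
  Localization.Away w

/-- The ring map of `X_W → W`, where `X_W = X ×_Y W` is the distinguished open set of `X` defined
by the image of `w`. -/
noncomputable def mapXW {J : Ideal (MvPolynomial (Fin n) R)}
    {I : Ideal (MvPolynomial (Fin (n + 1)) R)} (hJI : J ≤ I.comap (incl R n))
    (w : MvPolynomial (Fin n) R ⧸ J) : CoordW w →+* Localization.Away (projMap hJI w) :=
  Localization.awayMap (projMap hJI) w

/-- The coordinate ring of `Z = X_W ∩ X'`: the distinguished open set of
`X ∩ X' = Spec R[y,x]/(I + I')` defined by the image of `w`. -/
abbrev CoordZ {J : Ideal (MvPolynomial (Fin n) R)}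
    {I : Ideal (MvPolynomial (Fin (n + 1)) R)} (hJI : J ≤ I.comap (incl R n))
    (I' : Ideal (MvPolynomial (Fin (n + 1)) R)) (w : MvPolynomial (Fin n) R ⧸ J) : Type _ :=
  Localization.Away (projMap (le_comap_sup hJI I') w)

/-- The polynomial `h'` as a function on `Z`. -/
noncomputable def restrictZ {J : Ideal (MvPolynomial (Fin n) R)}
    {I : Ideal (MvPolynomial (Fin (n + 1)) R)} (hJI : J ≤ I.comap (incl R n))
    (I' : Ideal (MvPolynomial (Fin (n + 1)) R)) (w : MvPolynomial (Fin n) R ⧸ J)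
    (h' : MvPolynomial (Fin (n + 1)) R) : CoordZ hJI I' w :=
  algebraMap _ _ (Ideal.Quotient.mk (I ⊔ I') h')

/-- The coordinate ring of the distinguished open set `U = D(h')` of `Z`. -/
abbrev CoordU {J : Ideal (MvPolynomial (Fin n) R)}
    {I : Ideal (MvPolynomial (Fin (n + 1)) R)} (hJI : J ≤ I.comap (incl R n))
    (I' : Ideal (MvPolynomial (Fin (n + 1)) R)) (w : MvPolynomial (Fin n) R ⧸ J)
    (h' : MvPolynomial (Fin (n + 1)) R) : Type _ :=
  Localization.Away (restrictZ hJI I' w h')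

/-- The ring map of `U → W`. -/
noncomputable def mapUW {J : Ideal (MvPolynomial (Fin n) R)}
    {I : Ideal (MvPolynomial (Fin (n + 1)) R)} (hJI : J ≤ I.comap (incl R n))
    (I' : Ideal (MvPolynomial (Fin (n + 1)) R)) (w : MvPolynomial (Fin n) R ⧸ J)
    (h' : MvPolynomial (Fin (n + 1)) R) : CoordW w →+* CoordU hJI I' w h' :=
  (algebraMap (CoordZ hJI I' w) (CoordU hJI I' w h')).comp
    (Localization.awayMap (projMap (le_comap_sup hJI I')) w)

/-- The coordinate ring of `V`, the scheme-theoretic image of `U` in `W`. -/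
abbrev CoordV {J : Ideal (MvPolynomial (Fin n) R)}
    {I : Ideal (MvPolynomial (Fin (n + 1)) R)} (hJI : J ≤ I.comap (incl R n))
    (I' : Ideal (MvPolynomial (Fin (n + 1)) R)) (w : MvPolynomial (Fin n) R ⧸ J)
    (h' : MvPolynomial (Fin (n + 1)) R) : Type _ :=
  CoordW w ⧸ RingHom.ker (mapUW hJI I' w h')

/-- The ring map of `U → V`. -/
noncomputable def mapUV {J : Ideal (MvPolynomial (Fin n) R)}
    {I : Ideal (MvPolynomial (Fin (n + 1)) R)} (hJI : J ≤ I.comap (incl R n))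
    (I' : Ideal (MvPolynomial (Fin (n + 1)) R)) (w : MvPolynomial (Fin n) R ⧸ J)
    (h' : MvPolynomial (Fin (n + 1)) R) : CoordV hJI I' w h' →+* CoordU hJI I' w h' :=
  RingHom.kerLift (mapUW hJI I' w h')

/-- The ring map of `U_v = V_v ×_V U → V_v`, where `V_v = D(v) ⊆ V`. -/
noncomputable def mapUv {J : Ideal (MvPolynomial (Fin n) R)}
    {I : Ideal (MvPolynomial (Fin (n + 1)) R)} (hJI : J ≤ I.comap (incl R n))
    (I' : Ideal (MvPolynomial (Fin (n + 1)) R)) (w : MvPolynomial (Fin n) R ⧸ J)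
    (h' : MvPolynomial (Fin (n + 1)) R) (v : CoordV hJI I' w h') :
    Localization.Away v →+* Localization.Away (mapUV hJI I' w h' v) :=
  Localization.awayMap (mapUV hJI I' w h') v

/-- The set `V_v(R) ⊆ R^n` of rational points of `V_v`: all `a ∈ R^n` for which the evaluation at
`a` factors through the coordinate ring of `V_v`. -/
def rationalPointsVv {J : Ideal (MvPolynomial (Fin n) R)}
    {I : Ideal (MvPolynomial (Fin (n + 1)) R)} (hJI : J ≤ I.comap (incl R n))
    (I' : Ideal (MvPolynomial (Fin (n + 1)) R)) (w : MvPolynomial (Fin n) R ⧸ J)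
    (h' : MvPolynomial (Fin (n + 1)) R) (v : CoordV hJI I' w h') : Set (Fin n → R) :=
  {a | ∃ ψ : Localization.Away v →+* R, ∀ f : MvPolynomial (Fin n) R,
    ψ (algebraMap (CoordV hJI I' w h') _ (Ideal.Quotient.mk _
      (algebraMap (MvPolynomial (Fin n) R ⧸ J) (CoordW w) (Ideal.Quotient.mk J f)))) =
    MvPolynomial.eval a f}

end Projection

end GeomCAD

/-!
Write `T = V(I) ∩ D(h)` and `T' = V(I') ∩ D(h')`. The statement rests on one fact: a section of
`T` which meets `T'` somewhere over `S` stays on `T'` everywhere over `S`. The points of `S` over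
which a given section lies on `T'` form a semi-algebraic set, so by connectedness it suffices that
this set is open and closed in `S`.

*Fibre polynomials.* Over `S` the fibres of `X_W` and of `U` are the root sets of monic
polynomials of constant degree whose coefficients are regular functions: the specializations of
the characteristic polynomial of the last coordinate, acting on a finite free coordinate ring
(`isRoot_charpoly_iff`, `exists_isFiberPolynomial_XW`, `exists_isFiberPolynomial_Uv`). For `U_v`
only freeness is assumed; finiteness follows, since its coordinate ring arises from a monogenic
integral algebra by inverting one element, and after base change to a field the monogenic algebra
is Artinian, hence contains that inverse already (`finite_of_free_of_integral`).

*Continuity of roots.* A monic polynomial which is small at `z` has a root near `z`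
(`pow_natDegree_le_nsq`). Hence points of the fibres of `X_W` and of `U` persist under small
perturbations of the base point, and so does non-membership. The fibres of `T` have constant
cardinality, so nearby fibres are in bijection through small displacements, and since `T ∩ T'` is
`T ∩ U` over `S`, this bijection respects membership in `T'` (`exists_local_bijection`). In
particular the condition that a section of `T` lies on `T'` is locally constant, and so is the
cardinality of the fibres of `T \ T'`.

*Semi-algebraicity.* That these conditions are semi-algebraic is the Tarski-Seidenberg theorem
(`IsSemialgebraic.exists_sum`), together with the description of geometric fibres in real
coordinates (`isSemialgebraic_geomFiber_locus`), which uses that the algebraic closure is `R[i]`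
(`exists_re_im`). One variable is eliminated by comparing sign diagrams (`diagramDetermined`): the
signs of finitely many polynomials in the coefficients determine a family of polynomials in one
variable up to an order automorphism of the line preserving all signs. New polynomials enter this
comparison through their derivatives and pseudo-remainders (`exists_orderIso_cons`).

*Conclusion.* If a section of `T` meets a section of `T'`, it lies on the set delineated by the
sections of `T'` everywhere, hence coincides with one of these finitely many disjoint sections, by
connectedness again (`eq_or_disjoint_of_delineates`). For the union, the sections of both sets are
merged into one ascending sequence (`exists_ascending_enumeration`); the cardinality of the fibres
of the union is that of `T'` plus that of `T \ T'`. If `T'` is delineable by convention only, its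
fibres are cofinite. The union, being basic constructible, then agrees over `S` with some `D(g)`
(`geomFiber_locus_of_finite_compl`), and `V(g)` is delineated by those sections of `T'` which are
not sections of `T`.
-/

namespace GeomCAD

/-! ### Polynomials over a real closed field -/

section RealClosed

open Polynomial

variable {R : Type*} [Field R] [LinearOrder R] [IsStrictOrderedRing R] [IsRealClosed R]

theorem finrank_eq_one_of_odd (E : Type*) [Field E] [Algebra R E] [FiniteDimensional R E]
    (h : Odd (Module.finrank R E)) : Module.finrank R E = 1 := by
  have : CharZero R := inferInstance
  obtain ⟨α, hα⟩ := Field.exists_primitive_element R E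
  have hint : IsIntegral R α := Algebra.IsIntegral.isIntegral α
  have hdeg : (minpoly R α).natDegree = Module.finrank R E := by
    rw [← IntermediateField.adjoin.finrank hint, hα, IntermediateField.finrank_top']
  rw [← hdeg] at h ⊢
  obtain ⟨x, hx⟩ := IsRealClosed.exists_isRoot_of_odd_natDegree h
  exact natDegree_eq_of_degree_eq_some
    (degree_eq_one_of_irreducible_of_root (minpoly.irreducible hint) hx)

theorem finrank_ne_two_of_isSquare {F : Type*} [Field F] [CharZero F] (hF : ∀ x : F, IsSquare x)
    (E : Type*) [Field E] [Algebra F E] : Module.finrank F E ≠ 2 := by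
  intro h
  have : FiniteDimensional F E := Module.finite_of_finrank_pos (by omega)
  obtain ⟨α, hα⟩ := Field.exists_primitive_element F E
  have hint : IsIntegral F α := Algebra.IsIntegral.isIntegral α
  have hdeg : (minpoly F α).natDegree = 2 := by
    rw [← IntermediateField.adjoin.finrank hint, hα, IntermediateField.finrank_top', h]
  set p := minpoly F α with hp
  have hmon : p.Monic := minpoly.monic hint
  obtain ⟨s, hs⟩ := hF (p.coeff 1 ^ 2 - 4 * p.coeff 0)
  have hroot : p.IsRoot ((-p.coeff 1 + s) / 2) := by
    have h2 : p.coeff 2 = 1 := by rw [← hdeg]; exact hmon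
    rw [IsRoot.def, eval_eq_sum_range, hdeg, Finset.sum_range_succ, Finset.sum_range_succ,
      Finset.sum_range_one, h2]
    field_simp
    linear_combination -hs
  have : p.natDegree = 1 := natDegree_eq_of_degree_eq_some
    (degree_eq_one_of_irreducible_of_root (minpoly.irreducible hint) hroot)
  omega

/-- Every element of `R[i]` has a square root, in real coordinates: `(u + iv)² = x + iy`. -/
theorem exists_sq_sub_sq (x y : R) : ∃ u v : R, u ^ 2 - v ^ 2 = x ∧ 2 * u * v = y := by
  have sqrt : ∀ t : R, 0 ≤ t → ∃ s, 0 ≤ s ∧ s ^ 2 = t := by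
    intro t ht
    obtain ⟨s, hs⟩ := IsRealClosed.nonneg_iff_isSquare.1 ht
    exact ⟨|s|, abs_nonneg s, by rw [sq_abs, hs, sq]⟩
  obtain ⟨r, hr0, hr⟩ := sqrt (x ^ 2 + y ^ 2) (by positivity)
  have hrx : |x| ≤ r := abs_le_of_sq_le_sq (by nlinarith [sq_nonneg y]) hr0
  obtain ⟨hx1, hx2⟩ := abs_le.1 hrx
  obtain ⟨u, hu0, hu⟩ := sqrt ((r + x) / 2) (by linarith)
  obtain ⟨v, hv0, hv⟩ := sqrt ((r - x) / 2) (by linarith)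
  have huv : (2 * u * v) ^ 2 = y ^ 2 := by
    calc (2 * u * v) ^ 2 = 4 * (u ^ 2 * v ^ 2) := by ring
      _ = y ^ 2 := by rw [hu, hv]; linear_combination hr
  rcases sq_eq_sq_iff_eq_or_eq_neg.1 huv with h | h
  · exact ⟨u, v, by rw [hu, hv]; ring, h⟩
  · exact ⟨u, -v, by rw [neg_sq, hu, hv]; ring, by linear_combination -h⟩

theorem mem_adjoin_of_sq_eq_neg_one {R L : Type*} [Field R] [Field L] [Algebra R L] {i : L}
    (hi : i ^ 2 = -1) {z : L} (hz : z ∈ IntermediateField.adjoin R {i}) :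
    ∃ x y : R, z = algebraMap R L x + algebraMap R L y * i := by
  have hint : IsIntegral R i := ⟨X ^ 2 + 1, by monicity!, by simp [hi]⟩
  rw [← IntermediateField.mem_toSubalgebra,
    IntermediateField.adjoin_simple_toSubalgebra_of_isAlgebraic hint.isAlgebraic] at hz
  induction hz using Algebra.adjoin_induction with
  | mem z hz => exact ⟨0, 1, by simpa using hz⟩
  | algebraMap r => exact ⟨r, 0, by simp⟩
  | add a b _ _ ha hb =>
    obtain ⟨x, y, rfl⟩ := ha
    obtain ⟨x', y', rfl⟩ := hb
    exact ⟨x + x', y + y', by simp only [map_add]; ring⟩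
  | mul a b _ _ ha hb =>
    obtain ⟨x, y, rfl⟩ := ha
    obtain ⟨x', y', rfl⟩ := hb
    refine ⟨x * x' - y * y', x * y' + y * x', ?_⟩
    simp only [map_add, map_mul, map_sub]
    linear_combination (algebraMap R L y * algebraMap R L y') * hi

/-- The Galois-theoretic core of the fundamental theorem of algebra. -/
theorem exists_re_im_of_isGalois {L : Type*} [Field L] [Algebra R L] [FiniteDimensional R L]
    [IsGalois R L] {i : L} (hi : i ^ 2 = -1) (z : L) :
    ∃ x y : R, z = algebraMap R L x + algebraMap R L y * i := by
  have : CharZero L := charZero_of_injective_algebraMap (algebraMap R L).injective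
  let F := IntermediateField.adjoin R {i}
  have hsq : ∀ x : F, IsSquare x := by
    rintro ⟨x, hx⟩
    obtain ⟨a, b, hab⟩ := mem_adjoin_of_sq_eq_neg_one hi hx
    obtain ⟨u, v, huv, huv'⟩ := exists_sq_sub_sq a b
    have hiF : i ∈ F := IntermediateField.mem_adjoin_simple_self R i
    refine ⟨⟨algebraMap R L u + algebraMap R L v * i,
      F.add_mem (F.algebraMap_mem u) (F.mul_mem (F.algebraMap_mem v) hiF)⟩, ?_⟩
    apply Subtype.ext
    change x = (algebraMap R L u + algebraMap R L v * i) * (algebraMap R L u + algebraMap R L v * i)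
    rw [hab, ← huv, ← huv']
    simp only [map_sub, map_mul, map_pow, map_ofNat]
    linear_combination (-(algebraMap R L v) ^ 2) * hi
  -- the Galois group is a 2-group: the fixed field of a Sylow 2-subgroup has odd degree
  have hcard : Nat.card (L ≃ₐ[R] L) = Module.finrank R L := IsGalois.card_aut_eq_finrank R L
  have h2 : ∃ k, Module.finrank R L = 2 ^ k := by
    have : Fact (Nat.Prime 2) := ⟨Nat.prime_two⟩
    let P : Sylow 2 (L ≃ₐ[R] L) := default
    have hfix : Module.finrank (IntermediateField.fixedField (P : Subgroup (L ≃ₐ[R] L))) L =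
      Nat.card P := IntermediateField.finrank_fixedField_eq_card _
    have hmul := Module.finrank_mul_finrank R
      (IntermediateField.fixedField (P : Subgroup (L ≃ₐ[R] L))) L
    have hidx := (P : Subgroup (L ≃ₐ[R] L)).card_mul_index
    have hodd : ¬ 2 ∣ (P : Subgroup (L ≃ₐ[R] L)).index := P.not_dvd_index
    have hpos : 0 < Nat.card P := Nat.card_pos
    have heq : Module.finrank R (IntermediateField.fixedField (P : Subgroup (L ≃ₐ[R] L))) =
        (P : Subgroup (L ≃ₐ[R] L)).index := by
      rw [hfix, ← hcard, ← hidx, mul_comm] at hmul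
      exact Nat.eq_of_mul_eq_mul_left hpos hmul
    have h1 := finrank_eq_one_of_odd (R := R)
      (IntermediateField.fixedField (P : Subgroup (L ≃ₐ[R] L)))
      (by rw [heq]; exact Nat.not_even_iff_odd.1 (fun h => hodd h.two_dvd))
    obtain ⟨k, hk⟩ := IsPGroup.iff_card.1 P.2
    exact ⟨k, by rw [← hmul, h1, one_mul, hfix, ← hk]⟩
  obtain ⟨k, hk⟩ := h2
  have hdvd : Module.finrank F L ∣ 2 ^ k :=
    hk ▸ Dvd.intro_left _ (Module.finrank_mul_finrank R F L)
  obtain ⟨j, -, hj⟩ := (Nat.dvd_prime_pow Nat.prime_two).1 hdvd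
  have hj0 : j = 0 := by
    by_contra hne
    obtain ⟨j, rfl⟩ := Nat.exists_eq_succ_of_ne_zero hne
    have : Fact (Nat.Prime 2) := ⟨Nat.prime_two⟩
    have hcardF : Nat.card (L ≃ₐ[F] L) = Module.finrank F L := IsGalois.card_aut_eq_finrank F L
    obtain ⟨H, hH⟩ := Sylow.exists_subgroup_card_pow_prime (G := L ≃ₐ[F] L) 2 (n := j)
      (by rw [hcardF, hj]; exact pow_dvd_pow 2 (Nat.le_succ j))
    have hfix : Module.finrank (IntermediateField.fixedField H) L = Nat.card H :=
      IntermediateField.finrank_fixedField_eq_card _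
    have hmul := Module.finrank_mul_finrank F (IntermediateField.fixedField H) L
    rw [hfix, hH, hj, Nat.pow_succ', Nat.mul_left_inj (by positivity)] at hmul
    exact finrank_ne_two_of_isSquare hsq _ hmul
  rw [hj0, pow_zero] at hj
  have hmem : z ∈ F := by
    have hbot : (⊥ : Subalgebra F L) = ⊤ := Subalgebra.bot_eq_top_of_finrank_eq_one hj
    have : z ∈ (⊥ : Subalgebra F L) := hbot ▸ Algebra.mem_top
    obtain ⟨y, hy⟩ := Algebra.mem_bot.1 this
    exact hy ▸ y.2
  exact mem_adjoin_of_sq_eq_neg_one hi hmem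

/-- The fundamental theorem of algebra over a real closed field: the algebraic closure is `R[i]`. -/
theorem exists_re_im {K : Type*} [Field K] [Algebra R K] [IsAlgClosed K] [Algebra.IsAlgebraic R K]
    {i : K} (hi : i ^ 2 = -1) (z : K) :
    ∃ x y : R, z = algebraMap R K x + algebraMap R K y * i := by
  let E : IntermediateField R K := IntermediateField.adjoin R {i, z}
  have : FiniteDimensional R E :=
    IntermediateField.finiteDimensional_adjoin fun x _ => Algebra.IsIntegral.isIntegral x
  have : IsAlgClosure R K := ⟨inferInstance, inferInstance⟩
  have : Normal R K := IsAlgClosure.normal R K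
  let L : IntermediateField R K := IntermediateField.normalClosure R E K
  have hEL : E ≤ L := IntermediateField.le_normalClosure E
  have hiL : i ∈ L := hEL (IntermediateField.subset_adjoin _ _ (by simp))
  have hzL : z ∈ L := hEL (IntermediateField.subset_adjoin _ _ (by simp))
  have : IsGalois R L := ⟨⟩
  obtain ⟨x, y, hxy⟩ := exists_re_im_of_isGalois (R := R) (L := L) (i := ⟨i, hiL⟩)
    (Subtype.ext hi) ⟨z, hzL⟩
  exact ⟨x, y, congrArg Subtype.val hxy⟩

/-- An irreducible polynomial divides `(X - x)² + y²`, where `x + iy` is one of its roots. Sign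
arguments are thereby reduced to linear factors and to quadratic ones without sign change. -/
theorem exists_dvd_sq_add_sq {q : R[X]} (hq : Irreducible q) :
    ∃ x y : R, q ∣ (X - C x) ^ 2 + C (y ^ 2) := by
  obtain ⟨z, hz⟩ := IsAlgClosed.exists_aeval_eq_zero (AlgebraicClosure R) q
    (degree_pos_of_irreducible hq).ne'
  obtain ⟨i, hi⟩ := IsAlgClosed.exists_pow_nat_eq (-1 : AlgebraicClosure R) (n := 2) (by norm_num)
  obtain ⟨x, y, rfl⟩ := exists_re_im (R := R) hi z
  refine ⟨x, y, (Dvd.intro _ (minpoly.eq_of_irreducible hq hz)).trans (minpoly.dvd R _ ?_)⟩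
  simp only [map_add, map_pow, map_sub, aeval_X, aeval_C, add_sub_cancel_left]
  linear_combination (algebraMap R (AlgebraicClosure R) y) ^ 2 * hi

theorem eval_mul_eval_pos_of_irreducible {q : R[X]} (hq : Irreducible q) {a b : R} (hab : a ≤ b)
    (h : ∀ x, a ≤ x → x ≤ b → q.eval x ≠ 0) : 0 < q.eval a * q.eval b := by
  obtain ⟨x, y, c, hc⟩ := exists_dvd_sq_add_sq hq
  have hm : ((X - C x) ^ 2 + C (y ^ 2)).natDegree = 2 := by
    compute_degree!
  have hc0 : c ≠ 0 := by
    rintro rfl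
    rw [hc] at hm
    simp at hm
  have hdeg : q.natDegree + c.natDegree = 2 := by
    rw [← natDegree_mul hq.ne_zero hc0, ← hc, hm]
  have hpos := natDegree_pos_iff_degree_pos.2 (degree_pos_of_irreducible hq)
  have ha := h a le_rfl hab
  have hb := h b hab le_rfl
  rcases (by omega : q.natDegree = 1 ∨ c.natDegree = 0) with h1 | h1
  · obtain ⟨u, hu, v, rfl⟩ := natDegree_eq_one.1 h1
    simp only [eval_add, eval_mul, eval_C, eval_X] at h ha hb ⊢
    by_contra hneg
    rw [not_lt] at hneg
    have hroot : u * (-v / u) + v = 0 := by field_simp; ring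
    set r := -v / u
    have hv : v = -(u * r) := by linear_combination hroot
    rw [hv] at hneg
    have hneg' : u ^ 2 * ((a - r) * (b - r)) ≤ 0 := by linarith
    have hneg'' : (a - r) * (b - r) ≤ 0 := by
      by_contra hcon
      rw [not_le] at hcon
      exact absurd hneg' (not_le.2 (mul_pos (by positivity) hcon))
    refine h r ?_ ?_ hroot
    · by_contra hlt
      nlinarith
    · by_contra hlt
      nlinarith
  · obtain ⟨k, rfl⟩ := natDegree_eq_zero.1 h1
    have key : ∀ t, 0 ≤ q.eval t * k := fun t => by
      have := congrArg (eval t) hc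
      simp only [eval_add, eval_mul, eval_C, eval_X, eval_pow, eval_sub] at this
      rw [← this]
      positivity
    have hk : k ≠ 0 := fun h0 => hc0 (by rw [h0, C_0])
    have h0 : 0 ≤ (q.eval a * q.eval b) * k ^ 2 := by
      calc 0 ≤ (q.eval a * k) * (q.eval b * k) := mul_nonneg (key a) (key b)
        _ = _ := by ring
    have h1 : 0 ≤ q.eval a * q.eval b := nonneg_of_mul_nonneg_left h0 (by positivity)
    exact lt_of_le_of_ne h1 (mul_ne_zero ha hb).symm

theorem eval_mul_leadingCoeff_pos_of_irreducible {q : R[X]} (hq : Irreducible q) {a : R}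
    (h : ∀ x, a ≤ x → q.eval x ≠ 0) : 0 < q.eval a * q.leadingCoeff := by
  obtain ⟨x, y, c, hc⟩ := exists_dvd_sq_add_sq hq
  have hm : ((X - C x) ^ 2 + C (y ^ 2)).natDegree = 2 := by
    compute_degree!
  have hm' : ((X - C x) ^ 2 + C (y ^ 2)).Monic := by
    monicity!
  have hc0 : c ≠ 0 := by
    rintro rfl
    rw [hc] at hm
    simp at hm
  have hdeg : q.natDegree + c.natDegree = 2 := by
    rw [← natDegree_mul hq.ne_zero hc0, ← hc, hm]
  have hpos := natDegree_pos_iff_degree_pos.2 (degree_pos_of_irreducible hq)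
  have ha := h a le_rfl
  rcases (by omega : q.natDegree = 1 ∨ c.natDegree = 0) with h1 | h1
  · obtain ⟨u, hu, v, rfl⟩ := natDegree_eq_one.1 h1
    rw [leadingCoeff_linear hu]
    simp only [eval_add, eval_mul, eval_C, eval_X] at h ha ⊢
    have hroot : u * (-v / u) + v = 0 := by field_simp; ring
    set r := -v / u
    have hr : r < a := by
      by_contra hlt
      exact h r (not_lt.1 hlt) hroot
    have hv : v = -(u * r) := by linear_combination hroot
    have : 0 < u ^ 2 * (a - r) := mul_pos (by positivity) (by linarith)
    rw [hv]
    linarith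
  · obtain ⟨k, rfl⟩ := natDegree_eq_zero.1 h1
    have key : 0 ≤ q.eval a * k := by
      have := congrArg (eval a) hc
      simp only [eval_add, eval_mul, eval_C, eval_X, eval_pow, eval_sub] at this
      rw [← this]
      positivity
    have hk : q.leadingCoeff * k = 1 := by
      rw [← leadingCoeff_C k, ← leadingCoeff_mul, ← hc, hm']
    have hlc : q.eval a * q.leadingCoeff = q.eval a * k * q.leadingCoeff ^ 2 := by
      linear_combination (-q.eval a * q.leadingCoeff) * hk
    have h1 : 0 ≤ q.eval a * q.leadingCoeff := by rw [hlc]; positivity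
    exact lt_of_le_of_ne h1 (mul_ne_zero ha (leadingCoeff_ne_zero.2 hq.ne_zero)).symm

/-- A polynomial without roots in `[a, b]` has the same strict sign at both ends. -/
theorem eval_mul_eval_pos {p : R[X]} {a b : R} (hab : a ≤ b)
    (h : ∀ x, a ≤ x → x ≤ b → p.eval x ≠ 0) : 0 < p.eval a * p.eval b := by
  induction p using WfDvdMonoid.induction_on_irreducible with
  | zero => exact absurd (by simp) (h a le_rfl hab)
  | unit u hu =>
    obtain ⟨r, hr, rfl⟩ := Polynomial.isUnit_iff.1 hu
    simpa using hr.ne_zero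
  | mul p q hp hq ih =>
    simp only [eval_mul] at h ⊢
    have h1 := ih fun x hx hx' => right_ne_zero_of_mul (h x hx hx')
    have h2 := eval_mul_eval_pos_of_irreducible hq hab
      fun x hx hx' => left_ne_zero_of_mul (h x hx hx')
    nlinarith [mul_pos h1 h2]

/-- A polynomial without roots in `[a, ∞)` has the sign of its leading coefficient at `a`. -/
theorem eval_mul_leadingCoeff_pos {p : R[X]} {a : R}
    (h : ∀ x, a ≤ x → p.eval x ≠ 0) : 0 < p.eval a * p.leadingCoeff := by
  induction p using WfDvdMonoid.induction_on_irreducible with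
  | zero => exact absurd (by simp) (h a le_rfl)
  | unit u hu =>
    obtain ⟨r, hr, rfl⟩ := Polynomial.isUnit_iff.1 hu
    simpa using hr.ne_zero
  | mul p q hp hq ih =>
    simp only [eval_mul, leadingCoeff_mul] at h ⊢
    have h1 := ih fun x hx => right_ne_zero_of_mul (h x hx)
    have h2 := eval_mul_leadingCoeff_pos_of_irreducible hq
      fun x hx => left_ne_zero_of_mul (h x hx)
    nlinarith [mul_pos h1 h2]

/-- The behaviour at `-∞`, by reflection. -/
theorem eval_mul_neg_one_pow_pos {p : R[X]} {a : R}
    (h : ∀ x, x ≤ a → p.eval x ≠ 0) :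
    0 < p.eval a * ((-1) ^ p.natDegree * p.leadingCoeff) := by
  have h1 := eval_mul_leadingCoeff_pos (p := p.comp (-X)) (a := -a) fun x hx => by
    simpa using h (-x) (by linarith)
  rw [leadingCoeff_comp (by simp)] at h1
  simpa [mul_comm] using h1

/-- The intermediate value theorem for polynomials. -/
theorem exists_root_of_eval_mul_eval_neg {p : R[X]} {a b : R} (hab : a ≤ b)
    (h : p.eval a * p.eval b < 0) : ∃ c, a < c ∧ c < b ∧ p.eval c = 0 := by
  by_contra hcon
  push Not at hcon
  have hne := mul_ne_zero_iff.1 h.ne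
  refine absurd (eval_mul_eval_pos hab fun x hx hx' => ?_) h.not_gt
  rcases hx.eq_or_lt with rfl | hx
  · exact hne.1
  rcases hx'.eq_or_lt with rfl | hx'
  · exact hne.2
  exact hcon x hx hx'

/-- Rolle's theorem between consecutive roots. -/
theorem exists_root_derivative_aux {p : R[X]} (hp : p ≠ 0) {a b : R} (hab : a < b)
    (ha : p.eval a = 0) (hb : p.eval b = 0) (h : ∀ x, a < x → x < b → p.eval x ≠ 0) :
    ∃ c, a < c ∧ c < b ∧ p.derivative.eval c = 0 := by
  obtain ⟨q, hq, hqa⟩ := exists_eq_pow_rootMultiplicity_mul_and_not_dvd p hp a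
  obtain ⟨m, hm⟩ := Nat.exists_eq_succ_of_ne_zero
    (Nat.pos_iff_ne_zero.1 ((rootMultiplicity_pos hp).2 ha))
  rw [hm] at hq
  have hqb : q.eval b = 0 := by
    have := hb
    rw [hq] at this
    simpa [sub_ne_zero.2 hab.ne'] using this
  have hq0 : q ≠ 0 := by rintro rfl; simp at hqa
  obtain ⟨r, hr, hrb⟩ := exists_eq_pow_rootMultiplicity_mul_and_not_dvd q hq0 b
  obtain ⟨n, hn⟩ := Nat.exists_eq_succ_of_ne_zero
    (Nat.pos_iff_ne_zero.1 ((rootMultiplicity_pos hq0).2 hqb))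
  rw [hn] at hr
  have hra : ∀ x, a ≤ x → x ≤ b → r.eval x ≠ 0 := by
    intro x hx hx' h0
    rcases hx'.eq_or_lt with rfl | hx'
    · exact hrb (dvd_iff_isRoot.2 h0)
    rcases hx.eq_or_lt with rfl | hx
    · exact hqa (dvd_iff_isRoot.2 (by rw [IsRoot, hr, eval_mul, h0, mul_zero]))
    · exact h x hx hx' (by rw [hq, hr, eval_mul, eval_mul, h0, mul_zero, mul_zero])
  have hpos := eval_mul_eval_pos hab.le hra
  let s : R[X] := C (m + 1 : R) * (X - C b) * r + C (n + 1 : R) * (X - C a) * r +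
    (X - C a) * (X - C b) * derivative r
  have hs : p.derivative = (X - C a) ^ m * (X - C b) ^ n * s := by
    rw [hq, hr]
    simp only [derivative_mul, derivative_X_sub_C_pow, s, Nat.succ_eq_add_one, Nat.add_sub_cancel,
      C_add, C_1, map_natCast, Nat.cast_add, Nat.cast_one]
    ring
  have hneg : s.eval a * s.eval b < 0 := by
    simp only [s, eval_add, eval_mul, eval_sub, eval_X, eval_C, sub_self, mul_zero, zero_mul,
      add_zero, zero_add]
    have : 0 < ((m : R) + 1) * (n + 1) * (b - a) ^ 2 * (r.eval a * r.eval b) := by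
      have := sub_pos.2 hab
      positivity
    linarith
  obtain ⟨c, hac, hcb, hc⟩ := exists_root_of_eval_mul_eval_neg hab.le hneg
  exact ⟨c, hac, hcb, by rw [hs, eval_mul, hc, mul_zero]⟩

/-- Rolle's theorem for polynomials. -/
theorem exists_root_derivative {p : R[X]} {a b : R} (hab : a < b)
    (ha : p.eval a = p.eval b) : ∃ c, a < c ∧ c < b ∧ p.derivative.eval c = 0 := by
  wlog hb : p.eval b = 0 generalizing p
  · have := this (p := p - C (p.eval b)) (by simp [ha]) (by simp)
    simpa using this
  rw [hb] at ha
  rcases eq_or_ne p 0 with rfl | hp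
  · obtain ⟨c, hc⟩ := exists_between hab
    exact ⟨c, hc.1, hc.2, by simp⟩
  let Z := p.roots.toFinset.filter (a < ·)
  have hbZ : b ∈ Z := by simp [Z, hp, hb, hab]
  have hne : Z.Nonempty := ⟨b, hbZ⟩
  have hmem := Z.min'_mem hne
  set b' := Z.min' hne
  simp only [Z, Finset.mem_filter, Multiset.mem_toFinset, mem_roots hp] at hmem
  obtain ⟨c, hac, hcb, hc⟩ := exists_root_derivative_aux hp hmem.2 ha hmem.1 fun x hx hx' h0 =>
    hx'.not_ge (Z.min'_le x (by simp [Z, hp, h0, hx]))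
  exact ⟨c, hac, hcb.trans_le (Z.min'_le b hbZ), hc⟩

/-- A polynomial whose derivative has no root in `(a, b)` and which has a root strictly between `a`
and `b` has strictly opposite signs at `a` and `b`. -/
theorem eval_mul_eval_neg {p : R[X]} {a b c : R} (hac : a < c) (hcb : c < b)
    (hc : p.eval c = 0) (h : ∀ x, a < x → x < b → p.derivative.eval x ≠ 0) :
    p.eval a * p.eval b < 0 := by
  have ha : p.eval a ≠ 0 := fun h0 => by
    obtain ⟨d, h1, h2, h3⟩ := exists_root_derivative hac (h0.trans hc.symm)
    exact h d h1 (h2.trans hcb) h3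
  have hb : p.eval b ≠ 0 := fun h0 => by
    obtain ⟨d, h1, h2, h3⟩ := exists_root_derivative hcb (hc.trans h0.symm)
    exact h d (hac.trans h1) h2 h3
  by_contra hneg
  have hpos : 0 < p.eval a * p.eval b := lt_of_le_of_ne (not_lt.1 hneg) (mul_ne_zero ha hb).symm
  -- the value of smaller modulus is attained a second time beyond `c`
  rcases le_total (p.eval a ^ 2) (p.eval a * p.eval b) with hle | hle
  · obtain ⟨e, hce, heb, he⟩ : ∃ e, c < e ∧ e ≤ b ∧ p.eval e = p.eval a := by
      rcases hle.eq_or_lt with heq | hlt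
      · exact ⟨b, hcb, le_rfl, (mul_left_cancel₀ ha (by rw [← sq, heq])).symm⟩
      · obtain ⟨e, h1, h2, h3⟩ := exists_root_of_eval_mul_eval_neg (p := p - C (p.eval a)) hcb.le
          (by simp only [eval_sub, eval_C, hc]; linarith)
        exact ⟨e, h1, h2.le, by simpa [sub_eq_zero] using h3⟩
    obtain ⟨d, h1, h2, h3⟩ := exists_root_derivative (hac.trans hce) he.symm
    exact h d h1 (h2.trans_le heb) h3
  · have hle' : p.eval b ^ 2 ≤ p.eval a * p.eval b := by
      by_contra hlt
      rw [not_le] at hlt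
      nlinarith [mul_pos (sub_pos.2 hlt) hpos, mul_nonneg (sub_nonneg.2 hle) (sq_nonneg (p.eval b))]
    obtain ⟨e, hae, hec, he⟩ : ∃ e, a ≤ e ∧ e < c ∧ p.eval e = p.eval b := by
      rcases hle'.eq_or_lt with heq | hlt
      · exact ⟨a, le_rfl, hac, (mul_right_cancel₀ hb (by rw [← heq, sq]))⟩
      · obtain ⟨e, h1, h2, h3⟩ := exists_root_of_eval_mul_eval_neg (p := p - C (p.eval b)) hac.le
          (by simp only [eval_sub, eval_C, hc]; linarith)
        exact ⟨e, h1.le, h2, by simpa [sub_eq_zero] using h3⟩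
    obtain ⟨d, h1, h2, h3⟩ := exists_root_derivative (hec.trans hcb) he
    exact h d (hae.trans_lt h1) h2 h3

end RealClosed

/-! ### Comparison of the sign patterns of two polynomials on the line -/

section SignDiagram

open Polynomial

variable {R : Type*} [Field R] [LinearOrder R] [IsStrictOrderedRing R]

/-- An order automorphism can be changed above `u` so as to map `m > u` to a given value. -/
theorem exists_orderIso_extend_last (θ : R ≃o R) {u m c : R} (hum : u < m) (huc : θ u < c) :
    ∃ η : R ≃o R, (∀ x ≤ u, η x = θ x) ∧ η m = c := by
  set k := (c - θ u) / (m - u) with hk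
  have hk0 : 0 < k := div_pos (sub_pos.2 huc) (sub_pos.2 hum)
  have hmono : StrictMono fun x => if x ≤ u then θ x else θ u + k * (x - u) := by
    intro x y hxy
    by_cases hx : x ≤ u <;> by_cases hy : y ≤ u <;> simp only [hx, hy, if_true, if_false]
    · exact θ.strictMono hxy
    · have h1 : θ x ≤ θ u := θ.monotone hx
      have h2 := mul_pos hk0 (sub_pos.2 (not_le.1 hy))
      linarith
    · exact absurd (hxy.le.trans hy) hx
    · have := mul_lt_mul_of_pos_left hxy hk0
      linarith
  have hsurj : Function.Surjective fun x => if x ≤ u then θ x else θ u + k * (x - u) := by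
    intro y
    by_cases hy : y ≤ θ u
    · exact ⟨θ.symm y, by simp [(θ.symm_apply_le).2 hy]⟩
    · have h1 : 0 < (y - θ u) / k := div_pos (sub_pos.2 (not_le.1 hy)) hk0
      refine ⟨u + (y - θ u) / k, ?_⟩
      have h2 : ¬ (u + (y - θ u) / k ≤ u) := by linarith
      simp only [h2, if_false]
      field_simp
      ring
  refine ⟨hmono.orderIsoOfSurjective _ hsurj, fun x hx => ?_, ?_⟩
  · simp [hx]
  · have h1 : m - u ≠ 0 := (sub_pos.2 hum).ne'
    simp only [StrictMono.coe_orderIsoOfSurjective, not_le.2 hum, if_false, hk]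
    field_simp
    ring

/-- A strictly increasing function on a finite set extends to an order automorphism of the line,
by piecewise linear interpolation. -/
theorem exists_orderIso_extend (Z : Finset R) (e : R → R) (he : StrictMonoOn e (Z : Set R)) :
    ∃ θ : R ≃o R, ∀ z ∈ Z, θ z = e z := by
  induction Z using Finset.induction_on_max with
  | empty => exact ⟨OrderIso.refl R, by simp⟩
  | insert m Z hm ih =>
    obtain ⟨θ, hθ⟩ := ih (he.mono (by simp))
    rcases Z.eq_empty_or_nonempty with rfl | hne
    · exact ⟨OrderIso.addRight (e m - m), by simp⟩
    have hu := Z.max'_mem hne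
    set u := Z.max' hne with hudef
    obtain ⟨η, h1, h2⟩ := exists_orderIso_extend_last θ (hm u hu) (c := e m)
      (by rw [hθ u hu]; exact he (by simp [hu]) (by simp) (hm u hu))
    refine ⟨η, fun z hz => ?_⟩
    rcases Finset.mem_insert.1 hz with rfl | hz
    · exact h2
    · rw [h1 z (Z.le_max' z hz), hθ z hz]

theorem sign_eq_of_mul_pos {a b : R} (h : 0 < a * b) : SignType.sign a = SignType.sign b := by
  rcases mul_pos_iff.1 h with ⟨ha, hb⟩ | ⟨ha, hb⟩
  · rw [sign_pos ha, sign_pos hb]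
  · rw [sign_neg ha, sign_neg hb]

theorem mul_neg_of_sign_eq {a b a' b' : R} (ha : SignType.sign a = SignType.sign a')
    (hb : SignType.sign b = SignType.sign b') (h : a * b < 0) : a' * b' < 0 := by
  rw [← sign_eq_neg_one_iff] at h ⊢
  rw [← h, sign_mul, sign_mul, ha, hb]

/-- `x` and `y` lie in the same cell of the decomposition of the line defined by `Z`. -/
def SameCell {α : Type*} [LinearOrder α] (Z : Finset α) (x y : α) : Prop :=
  ∀ z ∈ Z, (z < x ↔ z < y) ∧ (x < z ↔ y < z)

theorem SameCell.symm {α : Type*} [LinearOrder α] {Z : Finset α} {x y : α} (h : SameCell Z x y) :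
    SameCell Z y x := fun z hz => ⟨(h z hz).1.symm, (h z hz).2.symm⟩

theorem SameCell.not_mem_right {α : Type*} [LinearOrder α] {Z : Finset α} {x y : α}
    (h : SameCell Z x y) (hx : x ∉ Z) : y ∉ Z := fun hy => by
  have := h y hy
  rcases lt_trichotomy y x with h1 | h1 | h1
  · exact lt_irrefl _ (this.1.1 h1)
  · exact hx (h1 ▸ hy)
  · exact lt_irrefl _ (this.2.1 h1)

variable [IsRealClosed R]

theorem sign_eval_eq {p : R[X]} {a b : R} (h : ∀ x ∈ Set.uIcc a b, p.eval x ≠ 0) :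
    SignType.sign (p.eval a) = SignType.sign (p.eval b) := by
  rcases le_total a b with hab | hab
  · rw [Set.uIcc_of_le hab] at h
    exact sign_eq_of_mul_pos (eval_mul_eval_pos hab fun x hx hx' => h x ⟨hx, hx'⟩)
  · rw [Set.uIcc_of_ge hab] at h
    exact (sign_eq_of_mul_pos (eval_mul_eval_pos hab fun x hx hx' => h x ⟨hx, hx'⟩)).symm

theorem sign_eval_orderIso_eq {p : R[X]} (θ : R ≃o R) {a b : R}
    (h : ∀ x ∈ Set.uIcc a b, p.eval (θ x) ≠ 0) :
    SignType.sign (p.eval (θ a)) = SignType.sign (p.eval (θ b)) := by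
  refine sign_eval_eq fun x hx => ?_
  rw [← θ.apply_symm_apply x]
  refine h _ ?_
  rw [Set.mem_uIcc] at hx ⊢
  simpa only [θ.le_symm_apply, θ.symm_apply_le] using hx

/-- A polynomial `P` with all critical points in `Z` changes sign at a root outside `Z`; a
polynomial with the same signs on `Z` therefore has a root in the same cell. -/
theorem exists_root_sameCell {P Q : R[X]} {θ : R ≃o R} {Z : Finset R}
    (hZ : ∀ z ∈ Z, SignType.sign (P.eval z) = SignType.sign (Q.eval (θ z)))
    (hP' : ∀ x, P.derivative.eval x = 0 → x ∈ Z) {c : R} (hc : P.eval c = 0) (hcZ : c ∉ Z)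
    (hlo : ∃ z ∈ Z, z < c) (hhi : ∃ z ∈ Z, c < z) :
    ∃ d, Q.eval (θ d) = 0 ∧ SameCell Z c d := by
  have h1 : (Z.filter (· < c)).Nonempty := by
    obtain ⟨z, hz, hzc⟩ := hlo
    exact ⟨z, by simp [hz, hzc]⟩
  have h2 : (Z.filter (c < ·)).Nonempty := by
    obtain ⟨z, hz, hzc⟩ := hhi
    exact ⟨z, by simp [hz, hzc]⟩
  have hu := Finset.mem_filter.1 ((Z.filter (· < c)).max'_mem h1)
  have hv := Finset.mem_filter.1 ((Z.filter (c < ·)).min'_mem h2)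
  have hu' : ∀ z ∈ Z, z < c → z ≤ (Z.filter (· < c)).max' h1 := fun z hz hzc =>
    Finset.le_max' _ z (by simp [hz, hzc])
  have hv' : ∀ z ∈ Z, c < z → (Z.filter (c < ·)).min' h2 ≤ z := fun z hz hzc =>
    Finset.min'_le _ z (by simp [hz, hzc])
  set u := (Z.filter (· < c)).max' h1
  set v := (Z.filter (c < ·)).min' h2
  have hneg := eval_mul_eval_neg hu.2 hv.2 hc fun x hux hxv h0 => by
    have hxZ := hP' x h0
    rcases lt_trichotomy x c with h | h | h
    · exact (hu' x hxZ h).not_gt hux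
    · exact hcZ (h ▸ hxZ)
    · exact (hv' x hxZ h).not_gt hxv
  obtain ⟨d, hd1, hd2, hd⟩ := exists_root_of_eval_mul_eval_neg
    (θ.monotone (hu.2.trans hv.2).le) (mul_neg_of_sign_eq (hZ u hu.1) (hZ v hv.1) hneg)
  rw [← θ.lt_symm_apply] at hd1
  rw [← θ.symm_apply_lt] at hd2
  refine ⟨θ.symm d, by simpa using hd, fun z hz => ?_⟩
  rcases lt_trichotomy z c with h | h | h
  · have := (hu' z hz h).trans_lt hd1
    exact ⟨⟨fun _ => this, fun _ => h⟩,
      ⟨fun h' => absurd h h'.not_gt, fun h' => absurd this h'.not_gt⟩⟩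
  · exact absurd (h ▸ hz) hcZ
  · have := hd2.trans_le (hv' z hz h)
    exact ⟨⟨fun h' => absurd h h'.not_gt, fun h' => absurd this h'.not_gt⟩,
      ⟨fun _ => this, fun _ => h⟩⟩

/-- If `Z` contains the critical points of `P` and corresponds under `θ` to the critical points of
`Q`, and `P` and `Q` have the same signs at corresponding points of `Z`, then `θ` can be modified
outside `Z` such that `P` and `Q` have the same signs everywhere. The hypotheses `hlo` and `hhi`
say that `Z` contains points below and above all the roots. -/
theorem exists_orderIso_sign_eq {P Q : R[X]} {θ : R ≃o R} {Z : Finset R}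
    (hP0 : P ≠ 0)
    (hZ : ∀ z ∈ Z, SignType.sign (P.eval z) = SignType.sign (Q.eval (θ z)))
    (hP' : ∀ x, P.derivative.eval x = 0 → x ∈ Z)
    (hQ' : ∀ x, Q.derivative.eval (θ x) = 0 → x ∈ Z)
    (hlo : ∃ z ∈ Z, ∀ x, P.eval x = 0 ∨ Q.eval (θ x) = 0 → z < x)
    (hhi : ∃ z ∈ Z, ∀ x, P.eval x = 0 ∨ Q.eval (θ x) = 0 → x < z) :
    ∃ η : R ≃o R, (∀ z ∈ Z, η z = θ z) ∧
      ∀ x, SignType.sign (P.eval x) = SignType.sign (Q.eval (η x)) := by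
  obtain ⟨lo, hloZ, hlo⟩ := hlo
  obtain ⟨hi, hhiZ, hhi⟩ := hhi
  have hE : ∀ c, P.eval c = 0 → c ∉ Z → ∃ d, Q.eval (θ d) = 0 ∧ SameCell Z c d := fun c hc hcZ =>
    exists_root_sameCell hZ hP' hc hcZ ⟨lo, hloZ, hlo c (.inl hc)⟩ ⟨hi, hhiZ, hhi c (.inl hc)⟩
  have hE' : ∀ d, Q.eval (θ d) = 0 → d ∉ Z → ∃ c, P.eval c = 0 ∧ SameCell Z c d := by
    intro d hd hdZ
    have key := exists_root_sameCell (P := Q) (Q := P) (θ := θ.symm)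
      (Z := Z.map θ.toEquiv.toEmbedding) (c := θ d) (by
        intro z hz
        obtain ⟨w, hw, rfl⟩ := Finset.mem_map.1 hz
        simpa using (hZ w hw).symm)
      (fun x hx => by
        have := hQ' (θ.symm x) (by simpa using hx)
        exact Finset.mem_map.2 ⟨_, this, by simp⟩) hd (by simpa using hdZ)
      ⟨θ lo, by simpa using hloZ, by simpa using hlo d (.inr hd)⟩
      ⟨θ hi, by simpa using hhiZ, by simpa using hhi d (.inr hd)⟩
    obtain ⟨c, hc, hcd⟩ := key
    refine ⟨θ.symm c, hc, fun z hz => ?_⟩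
    have := hcd (θ z) (by simpa using hz)
    simp only [OrderIso.lt_iff_lt] at this
    rw [θ.lt_symm_apply, θ.symm_apply_lt]
    exact ⟨this.1.symm, this.2.symm⟩
  have hU : ∀ x y, x < y → P.eval x = 0 → P.eval y = 0 → ∃ z ∈ Z, x < z ∧ z < y := by
    intro x y hxy hx hy
    obtain ⟨z, h1, h2, h3⟩ := exists_root_derivative hxy (hx.trans hy.symm)
    exact ⟨z, hP' z h3, h1, h2⟩
  have hU' : ∀ x y, x < y → Q.eval (θ x) = 0 → Q.eval (θ y) = 0 → ∃ z ∈ Z, x < z ∧ z < y := by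
    intro x y hxy hx hy
    obtain ⟨z, h1, h2, h3⟩ := exists_root_derivative (θ.strictMono hxy) (hx.trans hy.symm)
    refine ⟨θ.symm z, hQ' _ (by simpa using h3), ?_, ?_⟩
    · rwa [θ.lt_symm_apply]
    · rwa [θ.symm_apply_lt]
  -- `d` matches each root of `P` outside `Z` with a root of `Q` and fixes `Z`
  have hd : ∀ x, ∃ y, (x ∈ Z → y = x) ∧ (x ∉ Z → P.eval x = 0 → Q.eval (θ y) = 0 ∧
      SameCell Z x y) := by
    intro x
    by_cases hx : x ∈ Z
    · exact ⟨x, fun _ => rfl, fun h => absurd hx h⟩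
    · by_cases h0 : P.eval x = 0
      · obtain ⟨y, hy⟩ := hE x h0 hx
        exact ⟨y, fun h => absurd h hx, fun _ _ => hy⟩
      · exact ⟨x, fun _ => rfl, fun _ h => absurd h h0⟩
  choose d hdZ hdP using hd
  have hcell : ∀ x, x ∈ Z ∨ P.eval x = 0 → SameCell Z x (d x) := by
    intro x hx
    by_cases hxZ : x ∈ Z
    · rw [hdZ x hxZ]
      exact fun _ _ => ⟨Iff.rfl, Iff.rfl⟩
    · exact (hdP x hxZ (hx.resolve_left hxZ)).2
  have hroots : ∀ x, x ∈ Z ∪ P.roots.toFinset ↔ x ∈ Z ∨ P.eval x = 0 := by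
    intro x
    simp [hP0]
  have hmono : StrictMonoOn d ((Z ∪ P.roots.toFinset : Finset R) : Set R) := by
    intro x hx y hy hxy
    rw [Finset.mem_coe, hroots] at hx hy
    by_cases hxZ : x ∈ Z
    · rw [hdZ x hxZ]
      exact (hcell y hy x hxZ).1.1 hxy
    by_cases hyZ : y ∈ Z
    · rw [hdZ y hyZ]
      exact (hcell x hx y hyZ).2.1 hxy
    obtain ⟨z, hz, h1, h2⟩ := hU x y hxy (hx.resolve_left hxZ) (hy.resolve_left hyZ)
    exact ((hcell x hx z hz).2.1 h1).trans ((hcell y hy z hz).1.1 h2)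
  obtain ⟨η, hη⟩ := exists_orderIso_extend _ d hmono
  have hηZ : ∀ z ∈ Z, η z = z := fun z hz => by
    rw [hη z ((hroots z).2 (.inl hz)), hdZ z hz]
  have hzero : ∀ x, P.eval x = 0 ↔ Q.eval (θ (η x)) = 0 := by
    intro x
    by_cases hx : x ∈ Z
    · rw [hηZ x hx, ← sign_eq_zero_iff, hZ x hx, sign_eq_zero_iff]
    constructor
    · intro h0
      rw [hη x ((hroots x).2 (.inr h0))]
      exact (hdP x hx h0).1
    · intro h0
      have hyZ : η x ∉ Z := fun hy => hx (by rwa [η.injective (hηZ _ hy)] at hy)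
      obtain ⟨c, hc, hcell'⟩ := hE' _ h0 hyZ
      have hcZ : c ∉ Z := hcell'.symm.not_mem_right hyZ
      obtain ⟨hc1, hc2⟩ := hdP c hcZ hc
      have heq : d c = η x := by
        rcases lt_trichotomy (d c) (η x) with h | h | h
        · obtain ⟨z, hz, h1, h2⟩ := hU' _ _ h hc1 h0
          exact absurd ((hcell' z hz).1.2 h2) ((hc2 z hz).2.2 h1).not_gt
        · exact h
        · obtain ⟨z, hz, h1, h2⟩ := hU' _ _ h h0 hc1
          exact absurd ((hcell' z hz).2.2 h1) ((hc2 z hz).1.2 h2).not_gt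
      rw [← hη c ((hroots c).2 (.inr hc))] at heq
      rwa [← η.injective heq]
  refine ⟨η.trans θ, fun z hz => by simp [hηZ z hz], fun x => ?_⟩
  change _ = SignType.sign (Q.eval (θ (η x)))
  -- the sign at `x` is that at a point of `Z` which no root separates from `x`
  have hsep : ∀ w ∈ Z, (∀ t ∈ Set.uIcc x w, P.eval t ≠ 0) →
      SignType.sign (P.eval x) = SignType.sign (Q.eval (θ (η x))) := by
    intro w hw h
    rw [sign_eval_eq h, hZ w hw]
    have := sign_eval_orderIso_eq (p := Q) (η.trans θ) (a := x) (b := w)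
      fun t ht => fun h0 => h t ht ((hzero t).2 h0)
    simp only [OrderIso.trans_apply] at this
    rw [this, hηZ w hw]
  by_cases hx0 : P.eval x = 0
  · rw [hx0, (hzero x).1 hx0]
  rcases lt_or_ge x lo with hxlo | hxlo
  · refine hsep lo hloZ fun t ht h0 => ?_
    rw [Set.uIcc_of_le hxlo.le] at ht
    exact (hlo t (.inl h0)).not_ge ht.2
  rcases lt_or_ge hi x with hxhi | hxhi
  · refine hsep hi hhiZ fun t ht h0 => ?_
    rw [Set.uIcc_of_ge hxhi.le] at ht
    exact (hhi t (.inl h0)).not_ge ht.1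
  by_cases hxZ : x ∈ Z
  · exact hsep x hxZ (by simpa using hx0)
  set Z' := Z ∪ P.roots.toFinset with hZ'
  have h1 : (Z'.filter (· < x)).Nonempty :=
    ⟨lo, by simp [hZ', hloZ, hxlo.lt_of_ne (fun h => hxZ (h ▸ hloZ))]⟩
  have h2 : (Z'.filter (x < ·)).Nonempty :=
    ⟨hi, by simp [hZ', hhiZ, hxhi.lt_of_ne (fun h => hxZ (h ▸ hhiZ))]⟩
  have hu := Finset.mem_filter.1 ((Z'.filter (· < x)).max'_mem h1)
  have hv := Finset.mem_filter.1 ((Z'.filter (x < ·)).min'_mem h2)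
  have hu' : ∀ z ∈ Z', z < x → z ≤ (Z'.filter (· < x)).max' h1 := fun z hz hzc =>
    Finset.le_max' _ z (by simp [hz, hzc])
  have hv' : ∀ z ∈ Z', x < z → (Z'.filter (x < ·)).min' h2 ≤ z := fun z hz hzc =>
    Finset.min'_le _ z (by simp [hz, hzc])
  set u := (Z'.filter (· < x)).max' h1
  set v := (Z'.filter (x < ·)).min' h2
  have hne : ∀ t, u < t → t < v → P.eval t ≠ 0 := by
    intro t hut htv h0
    have htZ := (hroots t).2 (.inr h0)
    rcases lt_trichotomy t x with h | h | h
    · exact (hu' t htZ h).not_gt hut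
    · exact hx0 (h ▸ h0)
    · exact (hv' t htZ h).not_gt htv
  by_cases hu0 : P.eval u = 0
  · by_cases hv0 : P.eval v = 0
    · obtain ⟨z, hz, huz, hzv⟩ := hU u v (hu.2.trans hv.2) hu0 hv0
      rcases lt_trichotomy z x with h | h | h
      · exact absurd (hu' z (Finset.mem_union_left _ hz) h) huz.not_ge
      · exact absurd (h ▸ hz) hxZ
      · exact absurd (hv' z (Finset.mem_union_left _ hz) h) hzv.not_ge
    · refine hsep v (((hroots v).1 hv.1).resolve_right hv0) fun t ht => ?_
      rw [Set.uIcc_of_le hv.2.le] at ht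
      rcases ht.2.eq_or_lt with rfl | h
      · exact hv0
      · exact hne t (hu.2.trans_le ht.1) h
  · refine hsep u (((hroots u).1 hu.1).resolve_right hu0) fun t ht => ?_
    rw [Set.uIcc_of_ge hu.2.le] at ht
    rcases ht.1.eq_or_lt with h | h
    · exact h ▸ hu0
    · exact hne t h (ht.2.trans_lt hv.2)

/-- The inductive step in the comparison of sign diagrams: an order automorphism matching the signs
of a list of pairs of polynomials can be modified to match also the signs of a pair `(P, Q)`, once
the list contains the pair of derivatives and the signs of `P` and `Q` agree at the roots of the
polynomials in the list. -/
theorem exists_orderIso_cons {M : List (R[X] × R[X])} {P Q : R[X]} {θ : R ≃o R}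
    (hθ : ∀ m ∈ M, ∀ x, SignType.sign (m.1.eval x) = SignType.sign (m.2.eval (θ x)))
    (hder : (derivative P, derivative Q) ∈ M) (hP' : derivative P ≠ 0)
    (hdeg : P.natDegree = Q.natDegree)
    (hlc : SignType.sign P.leadingCoeff = SignType.sign Q.leadingCoeff)
    (hroot : ∀ m ∈ M, m.1 ≠ 0 → ∀ x, m.1.eval x = 0 →
      SignType.sign (P.eval x) = SignType.sign (Q.eval (θ x))) :
    ∃ η : R ≃o R, ∀ m ∈ (P, Q) :: M, ∀ x,
      SignType.sign (m.1.eval x) = SignType.sign (m.2.eval (η x)) := by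
  have hP0 : P ≠ 0 := by rintro rfl; simp at hP'
  have hQ0 : Q ≠ 0 := by
    rintro rfl
    rw [leadingCoeff_zero, sign_zero, sign_eq_zero_iff, leadingCoeff_eq_zero] at hlc
    exact hP0 hlc
  let Z₀ : Finset R := M.toFinset.biUnion fun m => m.1.roots.toFinset
  have hZ₀ : ∀ z, z ∈ Z₀ ↔ ∃ m ∈ M, m.1 ≠ 0 ∧ m.1.eval z = 0 := by
    intro z
    simp [Z₀]
  let B : Finset R := Z₀ ∪ P.roots.toFinset ∪ Q.roots.toFinset.map θ.symm.toEquiv.toEmbedding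
  have hB : ∀ x, P.eval x = 0 ∨ Q.eval (θ x) = 0 → x ∈ B := by
    intro x hx
    rcases hx with hx | hx
    · simp [B, hP0, hx]
    · refine Finset.mem_union_right _ (Finset.mem_map.2 ⟨θ x, ?_, by simp⟩)
      simp [hQ0, hx]
  obtain ⟨lo', hlo'⟩ := B.bddBelow
  obtain ⟨lo, hlo⟩ := exists_lt lo'
  obtain ⟨hi', hhi'⟩ := B.bddAbove
  obtain ⟨hi, hhi⟩ := exists_gt hi'
  have hloB : ∀ x ∈ B, lo < x := fun x hx => hlo.trans_le (hlo' hx)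
  have hhiB : ∀ x ∈ B, x < hi := fun x hx => (hhi' hx).trans_lt hhi
  have hder0 : ∀ x, (derivative P).eval x = 0 → x ∈ Z₀ := fun x hx =>
    (hZ₀ x).2 ⟨_, hder, hP', hx⟩
  obtain ⟨η, hη, hPQ⟩ := exists_orderIso_sign_eq (P := P) (Q := Q) (θ := θ)
    (Z := insert lo (insert hi Z₀)) hP0
    (by
      intro z hz
      simp only [Finset.mem_insert] at hz
      rcases hz with rfl | rfl | hz
      · have h1 := eval_mul_neg_one_pow_pos (p := P) (a := z)
          fun x hx h0 => (hloB x (hB x (.inl h0))).not_ge hx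
        have h2 := eval_mul_neg_one_pow_pos (p := Q) (a := θ z) fun x hx h0 => by
          have := hloB (θ.symm x) (hB _ (.inr (by simpa using h0)))
          rw [θ.lt_symm_apply] at this
          exact this.not_ge hx
        rw [sign_eq_of_mul_pos h1, sign_eq_of_mul_pos h2, sign_mul, sign_mul, hdeg, hlc]
      · have h1 := eval_mul_leadingCoeff_pos (p := P) (a := z)
          fun x hx h0 => (hhiB x (hB x (.inl h0))).not_ge hx
        have h2 := eval_mul_leadingCoeff_pos (p := Q) (a := θ z) fun x hx h0 => by
          have := hhiB (θ.symm x) (hB _ (.inr (by simpa using h0)))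
          rw [θ.symm_apply_lt] at this
          exact this.not_ge hx
        rw [sign_eq_of_mul_pos h1, sign_eq_of_mul_pos h2, hlc]
      · obtain ⟨m, hm, hm0, hmz⟩ := (hZ₀ z).1 hz
        exact hroot m hm hm0 z hmz)
    (fun x hx => by simp [hder0 x hx])
    (fun x hx => by
      have := hθ _ hder x
      rw [hx, sign_zero, sign_eq_zero_iff] at this
      simp [hder0 x this])
    ⟨lo, by simp, fun x hx => hloB x (hB x hx)⟩
    ⟨hi, by simp, fun x hx => hhiB x (hB x hx)⟩
  refine ⟨η, fun m hm x => ?_⟩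
  rcases List.mem_cons.1 hm with rfl | hm
  · exact hPQ x
  rw [hθ m hm x]
  by_cases hm0 : m.1 = 0
  · have h2 : ∀ y, m.2.eval y = 0 := fun y => by
      have := hθ m hm (θ.symm y)
      rw [hm0, eval_zero, sign_zero, θ.apply_symm_apply] at this
      exact sign_eq_zero_iff.1 this.symm
    rw [h2, h2]
  have hηZ : ∀ z ∈ Z₀, η z = θ z := fun z hz => hη z (by simp [hz])
  have hmθ : ∀ y, m.2.eval y = 0 → θ.symm y ∈ Z₀ := fun y hy => by
    refine (hZ₀ _).2 ⟨m, hm, hm0, ?_⟩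
    rw [← sign_eq_zero_iff, hθ m hm, θ.apply_symm_apply, hy, sign_zero]
  by_cases hx : x ∈ Z₀
  · rw [hηZ x hx]
  -- `θ x` and `η x` are not separated by a root, since `θ` and `η` agree on `Z₀`
  refine sign_eval_eq fun y hy h0 => ?_
  have hz := hmθ y h0
  have h1 : η (θ.symm y) = y := by rw [hηZ _ hz, θ.apply_symm_apply]
  rcases lt_trichotomy (θ.symm y) x with h | h | h
  · have h2 : y < θ x := by rwa [← θ.symm_apply_lt]
    have h3 : y < η x := by rw [← h1]; exact η.strictMono h
    rcases Set.mem_uIcc.1 hy with h' | h'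
    · exact h'.1.not_gt h2
    · exact h'.1.not_gt h3
  · exact hx (h ▸ hz)
  · have h2 : θ x < y := by rwa [← θ.lt_symm_apply]
    have h3 : η x < y := by rw [← h1]; exact η.strictMono h
    rcases Set.mem_uIcc.1 hy with h' | h'
    · exact h'.2.not_gt h3
    · exact h'.2.not_gt h2

end SignDiagram

/-! ### Sign diagrams depend on finitely many coefficient signs -/

section SignDetermined

open Polynomial

/-- Pseudo-division by a polynomial `q` of degree at most `j`. -/
theorem exists_pseudo_div {A : Type*} [CommRing A] (q : A[X]) (j : ℕ) (hj : 0 < j)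
    (hq : q.natDegree ≤ j) (m : ℕ) (p : A[X]) (hp : p.natDegree < j + m) :
    ∃ s r : A[X], r.natDegree < j ∧ C (q.coeff j ^ m) * p = s * q + r := by
  induction m generalizing p with
  | zero => exact ⟨0, p, by simpa using hp, by simp⟩
  | succ m ih =>
    obtain ⟨s, r, hr, hsr⟩ := ih (C (q.coeff j) * p - C (p.coeff (j + m)) * X ^ m * q) (by
      rw [Nat.lt_iff_le_pred (by omega), natDegree_le_iff_coeff_eq_zero]
      intro N hN
      rw [coeff_sub, coeff_C_mul, mul_assoc, coeff_C_mul, coeff_X_pow_mul', if_pos (by omega)]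
      rcases (by omega : N = j + m ∨ j + m < N) with rfl | hN
      · rw [Nat.add_sub_cancel, mul_comm, sub_self]
      · rw [coeff_eq_zero_of_natDegree_lt (p := p) (n := N) (by omega),
          coeff_eq_zero_of_natDegree_lt (p := q) (n := N - m) (by omega), mul_zero, mul_zero,
          sub_zero])
    refine ⟨s + C (q.coeff j ^ m) * (C (p.coeff (j + m)) * X ^ m), r, hr, ?_⟩
    rw [pow_succ, C_mul]
    linear_combination hsr

variable {R : Type*} [Field R] [LinearOrder R] [IsStrictOrderedRing R]

/-- The truncation of a polynomial to degrees at most `j`. -/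
noncomputable def truncDeg {A : Type*} [CommRing A] (q : A[X]) (j : ℕ) : A[X] :=
  ∑ i ∈ Finset.range (j + 1), C (q.coeff i) * X ^ i

theorem natDegree_truncDeg_le {A : Type*} [CommRing A] (q : A[X]) (j : ℕ) :
    (truncDeg q j).natDegree ≤ j :=
  natDegree_sum_le_of_forall_le _ _ fun _ hi =>
    (natDegree_C_mul_X_pow_le _ _).trans (Nat.lt_succ_iff.1 (Finset.mem_range.1 hi))

theorem coeff_truncDeg_self {A : Type*} [CommRing A] (q : A[X]) (j : ℕ) :
    (truncDeg q j).coeff j = q.coeff j := by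
  simp [truncDeg, coeff_C_mul, coeff_X_pow]

theorem map_truncDeg {A B : Type*} [CommRing A] [CommRing B] (φ : A →+* B) (q : A[X]) (j : ℕ)
    (h : (q.map φ).natDegree ≤ j) : (truncDeg q j).map φ = q.map φ := by
  conv_rhs => rw [as_sum_range_C_mul_X_pow' (q.map φ) (Nat.lt_succ_of_le h)]
  simp [truncDeg, Polynomial.map_sum]

/-- Two evaluations have the same signs on a set. -/
def SameSigns {A : Type*} [CommRing A] (D : Set A) (φ ψ : A →+* R) : Prop :=
  ∀ d ∈ D, SignType.sign (φ d) = SignType.sign (ψ d)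

/-- A family of polynomials over `A` has its sign diagram determined by the signs of finitely many
elements of `A`, when specialized along ring homomorphisms `A → R`. -/
def DiagramDetermined (R : Type*) [Field R] [LinearOrder R] {A : Type*} [CommRing A]
    (L : List A[X]) : Prop :=
  ∃ D : Set A, D.Finite ∧ ∀ φ ψ : A →+* R, SameSigns D φ ψ →
    ∃ θ : R ≃o R, ∀ f ∈ L, ∀ x,
      SignType.sign ((f.map φ).eval x) = SignType.sign ((f.map ψ).eval (θ x))

variable [IsRealClosed R]

/-- A polynomial `p` of maximal degree `d` is added to a family with the help of polynomials of
degree below `d`: the derivative of `p`, whose roots separate those of `p`, and the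
pseudo-remainders of `p` by the other members, which give the sign of `p` at their roots. -/
theorem DiagramDetermined.cons {A : Type*} [CommRing A] {d : ℕ} {p : A[X]} {M : List A[X]}
    (hp : p.natDegree ≤ d) (hM : ∀ q ∈ M, q.natDegree ≤ d)
    (ih : ∀ L : List A[X], (∀ q ∈ L, q.degree < d) → DiagramDetermined R (M ++ L)) :
    DiagramDetermined R (p :: M) := by
  classical
  -- the case of vanishing leading coefficient
  obtain ⟨D₁, hD₁, h₁⟩ := ih [p - C (p.coeff d) * X ^ d] (by
    simp only [List.mem_singleton, forall_eq]
    rw [degree_lt_iff_coeff_zero]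
    intro m hm
    rw [coeff_sub, coeff_C_mul_X_pow]
    split_ifs with h
    · rw [h, sub_self]
    · rw [coeff_eq_zero_of_natDegree_lt (by omega), sub_zero])
  -- the pseudo-remainders of `p`
  have hrem : ∀ (q : A[X]) (j : ℕ), ∃ r : A[X], 0 < j → r.natDegree < j ∧
      ∃ (m : ℕ) (s : A[X]), C ((q.coeff j ^ m) ^ 2) * p = s * truncDeg q j + r := by
    intro q j
    by_cases hj : 0 < j
    · obtain ⟨s, r, hr, hsr⟩ := exists_pseudo_div (truncDeg q j) j hj (natDegree_truncDeg_le q j)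
        ((p.natDegree + 1) * 2) p (by omega)
      refine ⟨r, fun _ => ⟨hr, p.natDegree + 1, s, ?_⟩⟩
      rw [← hsr, coeff_truncDeg_self, ← pow_mul]
    · exact ⟨0, fun h => absurd h hj⟩
  choose rem hrem using hrem
  obtain ⟨D₂, hD₂, h₂⟩ := ih (derivative p :: (derivative p :: M).flatMap fun q =>
      (List.range d).map fun j => rem q (j + 1)) (by
    intro q hq
    rcases List.mem_cons.1 hq with rfl | hq
    · rcases eq_or_ne p 0 with rfl | hp0
      · simp
      · exact (degree_derivative_lt hp0).trans_le (degree_le_of_natDegree_le hp)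
    · obtain ⟨f, -, hf⟩ := List.mem_flatMap.1 hq
      obtain ⟨j, hj, rfl⟩ := List.mem_map.1 hf
      have h1 := (hrem f (j + 1) (Nat.succ_pos j)).1
      have h2 := List.mem_range.1 hj
      exact degree_le_natDegree.trans_lt (by exact_mod_cast h1.trans_le h2))
  refine ⟨{p.coeff d} ∪ D₁ ∪ D₂ ∪ ⋃ q ∈ (derivative p :: M).toFinset, (q.coeffs : Set A), ?_, ?_⟩
  · refine (((Set.finite_singleton _).union hD₁).union hD₂).union ?_
    exact Set.Finite.biUnion (Finset.finite_toSet _) fun q _ => Finset.finite_toSet _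
  intro φ ψ hD
  have hc : SignType.sign (φ (p.coeff d)) = SignType.sign (ψ (p.coeff d)) := hD _ (by simp)
  by_cases hc0 : φ (p.coeff d) = 0
  · have hc0' : ψ (p.coeff d) = 0 := by rwa [hc0, sign_zero, eq_comm, sign_eq_zero_iff] at hc
    obtain ⟨θ, hθ⟩ := h₁ φ ψ fun d hd => hD d (by simp [hd])
    refine ⟨θ, fun f hf => ?_⟩
    rcases List.mem_cons.1 hf with rfl | hf
    · have := hθ (f - C (f.coeff d) * X ^ d) (by simp)
      simpa [hc0, hc0'] using this
    · exact hθ f (by simp [hf])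
  have hc0' : ψ (p.coeff d) ≠ 0 := by rwa [← sign_ne_zero, ← hc, sign_ne_zero]
  obtain ⟨θ, hθ⟩ := h₂ φ ψ fun d hd => hD d (by simp [hd])
  rcases Nat.eq_zero_or_pos d with rfl | hd
  · refine ⟨θ, fun f hf => ?_⟩
    rcases List.mem_cons.1 hf with rfl | hf
    · intro x
      rw [eq_C_of_natDegree_le_zero hp]
      simpa using hc
    · exact hθ f (by simp [hf])
  have hdegφ : ∀ χ : A →+* R, χ (p.coeff d) ≠ 0 → (p.map χ).natDegree = d := fun χ hχ =>
    natDegree_eq_of_le_of_coeff_ne_zero (natDegree_map_le.trans hp) (by rwa [coeff_map])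
  obtain ⟨η, hη⟩ := exists_orderIso_cons (θ := θ) (P := p.map φ) (Q := p.map ψ)
    (M := (derivative p :: M).map fun f => (f.map φ, f.map ψ))
    (by
      intro m hm
      obtain ⟨f, hf, rfl⟩ := List.mem_map.1 hm
      refine hθ f ?_
      rcases List.mem_cons.1 hf with rfl | hf
      · simp
      · simp [hf])
    (by simp [derivative_map])
    (by
      intro h0
      have := derivative_eq_zero.1 h0
      rw [hdegφ φ hc0] at this
      omega)
    (by rw [hdegφ φ hc0, hdegφ ψ hc0'])
    (by rw [leadingCoeff, leadingCoeff, hdegφ φ hc0, hdegφ ψ hc0', coeff_map, coeff_map, hc])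
    (by
      intro m hm hm0 x hx
      obtain ⟨q, hq, rfl⟩ := List.mem_map.1 hm
      simp only at hm0 hx
      have hcoeff : ∀ i, SignType.sign (φ (q.coeff i)) = SignType.sign (ψ (q.coeff i)) := by
        intro i
        by_cases hi : q.coeff i = 0
        · simp [hi]
        · refine hD _ (Set.mem_union_right _ ?_)
          simp only [Set.mem_iUnion]
          exact ⟨q, List.mem_toFinset.2 hq, coeff_mem_coeffs hi⟩
      set j := (q.map φ).natDegree with hj
      have hcoeff0 : ∀ i, φ (q.coeff i) = 0 ↔ ψ (q.coeff i) = 0 := fun i => by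
        rw [← sign_eq_zero_iff, hcoeff, sign_eq_zero_iff]
      have hψj : (q.map ψ).natDegree ≤ j := by
        rw [natDegree_le_iff_coeff_eq_zero]
        intro N hN
        rw [coeff_map, ← hcoeff0, ← coeff_map, coeff_eq_zero_of_natDegree_lt hN]
      have hj0 : 0 < j := by
        rw [Nat.pos_iff_ne_zero]
        intro h0
        rw [eq_C_of_natDegree_eq_zero h0, eval_C] at hx
        exact hm0 (by rw [eq_C_of_natDegree_eq_zero h0, hx, C_0])
      have hjd : j ≤ d := natDegree_map_le.trans (by
        rcases List.mem_cons.1 hq with rfl | hq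
        · exact (natDegree_derivative_le p).trans (by omega)
        · exact hM q hq)
      obtain ⟨hr, m, s, hs⟩ := hrem q j hj0
      have hφj : φ (q.coeff j) ≠ 0 := by
        rw [← coeff_map, hj, coeff_natDegree]
        exact leadingCoeff_ne_zero.2 hm0
      have hψj' : ψ (q.coeff j) ≠ 0 := fun h => hφj ((hcoeff0 j).2 h)
      -- at the roots of `q` the sign of `p` is that of the pseudo-remainder
      have key : ∀ (χ : A →+* R) (y : R), (q.map χ).natDegree ≤ j → χ (q.coeff j) ≠ 0 →
          (q.map χ).eval y = 0 →
          SignType.sign ((p.map χ).eval y) = SignType.sign (((rem q j).map χ).eval y) := by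
        intro χ y hχ hχ0 hy
        have h1 := congrArg (fun f => (f.map χ).eval y) hs
        simp only [Polynomial.map_mul, Polynomial.map_add, eval_mul, eval_add, map_C, eval_C,
          map_truncDeg χ q j hχ, hy, mul_zero, zero_add] at h1
        have h2 : 0 < χ ((q.coeff j ^ m) ^ 2) := by
          rw [map_pow, map_pow]
          positivity
        rw [← h1, sign_mul, sign_pos h2, one_mul]
      have hmem : rem q j ∈ M ++ derivative p :: ((derivative p :: M).flatMap fun q =>
          (List.range d).map fun j => rem q (j + 1)) := by
        refine List.mem_append_right _ (List.mem_cons_of_mem _ (List.mem_flatMap.2 ⟨q, hq, ?_⟩))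
        exact List.mem_map.2 ⟨j - 1, List.mem_range.2 (by omega),
          by rw [Nat.sub_add_cancel hj0]⟩
      have hqy : (q.map ψ).eval (θ x) = 0 := by
        have := hθ q (by
          rcases List.mem_cons.1 hq with rfl | hq
          · simp
          · simp [hq]) x
        rwa [hx, sign_zero, eq_comm, sign_eq_zero_iff] at this
      rw [key φ x hj.ge hφj hx, key ψ (θ x) hψj hψj' hqy]
      exact hθ _ hmem x)
  refine ⟨η, fun f hf => ?_⟩
  have := hη (f.map φ, f.map ψ) (by
    rcases List.mem_cons.1 hf with rfl | hf
    · simp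
    · exact List.mem_cons_of_mem _ (List.mem_map.2 ⟨f, by simp [hf], rfl⟩))
  exact this

theorem diagramDetermined_of_degree_lt {A : Type*} [CommRing A] (d : ℕ) (L : List A[X])
    (hL : ∀ q ∈ L, q.degree < d) : DiagramDetermined R L := by
  induction d generalizing L with
  | zero =>
    refine ⟨∅, Set.finite_empty, fun φ ψ _ => ⟨OrderIso.refl R, fun f hf x => ?_⟩⟩
    have : f = 0 := by simpa using hL f hf
    simp [this]
  | succ d ihd =>
    have key : ∀ T : List A[X], (∀ q ∈ T, q.natDegree ≤ d) → ∀ L : List A[X],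
        (∀ q ∈ L, q.degree < d) → DiagramDetermined R (T ++ L) := by
      intro T
      induction T with
      | nil => exact fun _ L hL => ihd L hL
      | cons p T ihT =>
        intro hT L hL
        refine DiagramDetermined.cons (d := d) (hT p (by simp)) (M := T ++ L) ?_ ?_
        · intro q hq
          rcases List.mem_append.1 hq with hq | hq
          · exact hT q (by simp [hq])
          · exact natDegree_le_of_degree_le (hL q hq).le
        · intro L' hL'
          rw [List.append_assoc]
          refine ihT (fun q hq => hT q (by simp [hq])) _ fun q hq => ?_
          rcases List.mem_append.1 hq with hq | hq
          · exact hL q hq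
          · exact hL' q hq
    have := key L (fun q hq => natDegree_le_of_degree_le
      (Order.le_of_lt_succ (by exact_mod_cast hL q hq))) [] (by simp)
    simpa using this

/-- The sign diagram of a finite list of polynomials with coefficients in `A` is determined by the
signs of finitely many elements of `A`: this is the elimination of one variable. -/
theorem diagramDetermined {A : Type*} [CommRing A] (L : List A[X]) : DiagramDetermined R L := by
  refine diagramDetermined_of_degree_lt ((L.map natDegree).sum + 1) L fun q hq => ?_
  have h1 : q.natDegree ≤ (L.map natDegree).sum :=
    List.single_le_sum (by simp) _ (List.mem_map.2 ⟨q, hq, rfl⟩)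
  exact degree_le_natDegree.trans_lt (by exact_mod_cast Nat.lt_succ_of_le h1)

end SignDetermined

/-! ### Semi-algebraic sets and their projections -/

section SemialgebraicSets

open MvPolynomial

variable {R σ τ : Type*} [Field R] [LinearOrder R] [IsStrictOrderedRing R]

/-- A set is semi-algebraic if and only if membership of a point depends only on the signs of
finitely many polynomials at that point. -/
theorem isSemialgebraic_iff {S : Set (σ → R)} :
    IsSemialgebraic S ↔ ∃ D : Set (MvPolynomial σ R), D.Finite ∧
      ∀ a b, SameSigns D (eval a) (eval b) → a ∈ S → b ∈ S := by
  constructor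
  · rintro ⟨𝒞, h𝒞, hB, rfl⟩
    choose! F G hF hG hFG using hB
    refine ⟨⋃ B ∈ 𝒞, (F B ∪ G B), h𝒞.biUnion fun B hBC => (hF B hBC).union (hG B hBC), ?_⟩
    rintro a b hab ⟨B, hBC, haB⟩
    refine ⟨B, hBC, ?_⟩
    have hs : ∀ f ∈ F B ∪ G B, SignType.sign (eval a f) = SignType.sign (eval b f) := fun f hf =>
      hab f (Set.mem_biUnion hBC hf)
    rw [hFG B hBC] at haB ⊢
    refine ⟨fun f hf => ?_, fun g hg => ?_⟩
    · rw [← sign_eq_zero_iff, ← hs f (.inl hf), sign_eq_zero_iff]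
      exact haB.1 f hf
    · rw [← sign_eq_one_iff, ← hs g (.inr hg), sign_eq_one_iff]
      exact haB.2 g hg
  · rintro ⟨D, hD, hS⟩
    -- the cells of the sign decomposition defined by `D`
    let cell : (D → SignType) → Set (σ → R) := fun s =>
      {a | ∀ d : D, SignType.sign (eval a (d : MvPolynomial σ R)) = s d}
    have := hD.to_subtype
    refine ⟨cell '' {s | ∃ a ∈ S, a ∈ cell s}, (Set.toFinite _).image _, ?_, ?_⟩
    · rintro _ ⟨s, -, rfl⟩
      refine ⟨{f | ∃ h : f ∈ D, s ⟨f, h⟩ = 0},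
        {f | ∃ h : f ∈ D, s ⟨f, h⟩ = 1} ∪ Neg.neg '' {f | ∃ h : f ∈ D, s ⟨f, h⟩ = -1},
        hD.subset fun f hf => hf.1, (hD.subset fun f hf => hf.1).union
          ((hD.subset fun f hf => hf.1).image _), ?_⟩
      ext a
      constructor
      · intro ha
        refine ⟨fun f ⟨hf, hs⟩ => ?_, ?_⟩
        · rw [← sign_eq_zero_iff, ha ⟨f, hf⟩, hs]
        · rintro g (⟨hg, hs⟩ | ⟨g, ⟨hg, hs⟩, rfl⟩)
          · rw [← sign_eq_one_iff, ha ⟨g, hg⟩, hs]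
          · rw [map_neg, neg_pos, ← sign_eq_neg_one_iff, ha ⟨g, hg⟩, hs]
      · rintro ⟨h0, h1⟩ ⟨f, hf⟩
        rcases hs : s ⟨f, hf⟩ with _ | _ | _
        · exact sign_eq_zero_iff.2 (h0 f ⟨hf, hs⟩)
        · have := h1 (-f) (.inr ⟨f, ⟨hf, hs⟩, rfl⟩)
          rw [map_neg, neg_pos] at this
          exact sign_eq_neg_one_iff.2 this
        · exact sign_eq_one_iff.2 (h1 f (.inl ⟨hf, hs⟩))
    · ext a
      constructor
      · intro ha
        exact ⟨_, ⟨fun d => SignType.sign (eval a (d : MvPolynomial σ R)), ⟨a, ha, fun _ => rfl⟩,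
          rfl⟩, fun _ => rfl⟩
      · rintro ⟨_, ⟨s, ⟨b, hb, hbs⟩, rfl⟩, has⟩
        exact hS b a (fun d hd => (hbs ⟨d, hd⟩).trans (has ⟨d, hd⟩).symm) hb

theorem IsSemialgebraic.compl {S : Set (σ → R)} (hS : IsSemialgebraic S) :
    IsSemialgebraic Sᶜ := by
  rw [isSemialgebraic_iff] at hS ⊢
  obtain ⟨D, hD, h⟩ := hS
  exact ⟨D, hD, fun a b hab ha hb => ha (h b a (fun d hd => (hab d hd).symm) hb)⟩

theorem IsSemialgebraic.iUnion {ι : Type*} [Finite ι] {S : ι → Set (σ → R)}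
    (hS : ∀ i, IsSemialgebraic (S i)) : IsSemialgebraic (⋃ i, S i) := by
  simp only [isSemialgebraic_iff] at hS ⊢
  choose D hD h using hS
  refine ⟨⋃ i, D i, Set.finite_iUnion hD, fun a b hab ha => ?_⟩
  obtain ⟨i, hi⟩ := Set.mem_iUnion.1 ha
  exact Set.mem_iUnion.2 ⟨i, h i a b (fun d hd => hab d (Set.mem_iUnion.2 ⟨i, hd⟩)) hi⟩

theorem IsSemialgebraic.iInter {ι : Type*} [Finite ι] {S : ι → Set (σ → R)}
    (hS : ∀ i, IsSemialgebraic (S i)) : IsSemialgebraic (⋂ i, S i) := by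
  rw [← compl_compl (⋂ i, S i), Set.compl_iInter]
  exact (IsSemialgebraic.iUnion fun i => (hS i).compl).compl

theorem IsSemialgebraic.inter {S T : Set (σ → R)} (hS : IsSemialgebraic S)
    (hT : IsSemialgebraic T) : IsSemialgebraic (S ∩ T) := by
  rw [Set.inter_eq_iInter]
  exact IsSemialgebraic.iInter fun b => by cases b <;> assumption

theorem IsSemialgebraic.diff {S T : Set (σ → R)} (hS : IsSemialgebraic S)
    (hT : IsSemialgebraic T) : IsSemialgebraic (S \ T) := hS.inter hT.compl

theorem isSemialgebraic_setOf_eval_eq_zero (f : MvPolynomial σ R) :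
    IsSemialgebraic {a | eval a f = 0} := by
  refine isSemialgebraic_iff.2 ⟨{f}, Set.finite_singleton f, fun a b hab ha => ?_⟩
  have := hab f rfl
  change eval a f = 0 at ha
  rwa [ha, sign_zero, eq_comm, sign_eq_zero_iff] at this

theorem isSemialgebraic_setOf_eval_pos (f : MvPolynomial σ R) :
    IsSemialgebraic {a | 0 < eval a f} := by
  refine isSemialgebraic_iff.2 ⟨{f}, Set.finite_singleton f, fun a b hab ha => ?_⟩
  have := hab f rfl
  change 0 < eval a f at ha
  rwa [sign_pos ha, eq_comm, sign_eq_one_iff] at this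

/-- The preimage of a semi-algebraic set under a polynomial map. -/
theorem IsSemialgebraic.preimage {S : Set (τ → R)} (hS : IsSemialgebraic S)
    (F : τ → MvPolynomial σ R) : IsSemialgebraic {a : σ → R | (fun t => eval a (F t)) ∈ S} := by
  rw [isSemialgebraic_iff] at hS ⊢
  obtain ⟨D, hD, h⟩ := hS
  have key : ∀ (a : σ → R) (d : MvPolynomial τ R),
      eval a (bind₁ F d) = eval (fun t => eval a (F t)) d := fun a d => eval₂Hom_bind₁ _ _ _ _
  refine ⟨bind₁ F '' D, hD.image _, fun a b hab ha => h _ _ (fun d hd => ?_) ha⟩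
  have := hab _ ⟨d, hd, rfl⟩
  rwa [key, key] at this

theorem IsSemialgebraic.preimage_comp {S : Set (τ → R)} (hS : IsSemialgebraic S) (g : τ → σ) :
    IsSemialgebraic {a : σ → R | a ∘ g ∈ S} := by
  have := hS.preimage fun t => (X (g t) : MvPolynomial σ R)
  simpa [Function.comp_def] using this

theorem eval_option {R σ : Type*} [Field R] (f : MvPolynomial (Option σ) R) (x : R) (a : σ → R) :
    eval (fun o => o.elim x a) f =
      ((optionEquivLeft R σ f).map (eval a)).eval x := by
  induction f using MvPolynomial.induction_on with
  | C r => simp [optionEquivLeft_C]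
  | add p q hp hq => simp [hp, hq]
  | mul_X p o hp =>
    rw [map_mul, map_mul, hp, Polynomial.map_mul, Polynomial.eval_mul]
    cases o <;> simp

variable [IsRealClosed R]

/-- The Tarski–Seidenberg theorem for the projection along one coordinate. -/
theorem IsSemialgebraic.exists_option {S : Set (Option σ → R)} (hS : IsSemialgebraic S) :
    IsSemialgebraic {a : σ → R | ∃ x : R, (fun o => o.elim x a : Option σ → R) ∈ S} := by
  rw [isSemialgebraic_iff] at hS ⊢
  obtain ⟨D, hD, h⟩ := hS
  obtain ⟨E, hE, hdiag⟩ := diagramDetermined (R := R) (hD.toFinset.toList.map (optionEquivLeft R σ))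
  refine ⟨E, hE, ?_⟩
  rintro a b hab ⟨x, hx⟩
  obtain ⟨θ, hθ⟩ := hdiag _ _ hab
  refine ⟨θ x, h _ _ (fun d hd => ?_) hx⟩
  rw [eval_option, eval_option]
  exact hθ _ (List.mem_map.2 ⟨d, by simpa using hd, rfl⟩) x

/-- The Tarski–Seidenberg theorem: projections of semi-algebraic sets are semi-algebraic. -/
theorem IsSemialgebraic.exists_sum [Finite τ] {S : Set (σ ⊕ τ → R)} (hS : IsSemialgebraic S) :
    IsSemialgebraic {a : σ → R | ∃ t : τ → R, Sum.elim a t ∈ S} := by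
  induction τ using Finite.induction_empty_option generalizing σ with
  | of_equiv e ih =>
    have h1 := ih (hS.preimage_comp (Sum.map id e.symm))
    have h2 : ∀ (a : σ → R) t, Sum.elim a t ∘ Sum.map id e.symm = Sum.elim a (t ∘ e.symm) := by
      intro a t
      rw [Sum.elim_comp_map, Function.comp_id]
    convert h1 using 3 with a
    refine ⟨fun ⟨t, ht⟩ => ⟨t ∘ e, ?_⟩, fun ⟨t, ht⟩ => ⟨t ∘ e.symm, ?_⟩⟩
    · change Sum.elim a (t ∘ e) ∘ Sum.map id e.symm ∈ S
      rw [h2, Function.comp_assoc, e.self_comp_symm, Function.comp_id]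
      exact ht
    · rw [← h2]
      exact ht
  | h_empty =>
    have h1 := hS.preimage_comp (σ := σ) (Sum.elim id PEmpty.elim)
    have h2 : ∀ (a : σ → R) t, Sum.elim a t = a ∘ (Sum.elim id PEmpty.elim : σ ⊕ PEmpty → σ) := by
      intro a t
      ext (i | i)
      · rfl
      · exact i.elim
    convert h1 using 3 with a
    refine ⟨fun ⟨t, ht⟩ => ?_, fun ht => ⟨PEmpty.elim, ?_⟩⟩
    · rwa [h2] at ht
    · rwa [h2]
  | h_option ih =>
    rename_i κ _
    -- eliminate the coordinates in `κ`, then the last one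
    let g : σ ⊕ Option κ → Option σ ⊕ κ :=
      Sum.elim (fun i => Sum.inl (some i)) fun o => o.elim (Sum.inl none) Sum.inr
    have h1 := (ih (hS.preimage_comp g)).exists_option
    have h2 : ∀ (a : σ → R) (x : R) (t : κ → R),
        Sum.elim (fun o : Option σ => o.elim x a) t ∘ g = Sum.elim a (fun o => o.elim x t) := by
      intro a x t
      ext (i | i)
      · rfl
      · cases i <;> rfl
    convert h1 using 3 with a
    constructor
    · rintro ⟨t, ht⟩
      refine ⟨t none, fun k => t (some k), ?_⟩
      change Sum.elim (fun o : Option σ => o.elim (t none) a) (fun k => t (some k)) ∘ g ∈ S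
      rw [h2]
      convert ht using 2
      ext (_ | _) <;> rfl
    · rintro ⟨x, t, ht⟩
      refine ⟨fun o => o.elim x t, ?_⟩
      rw [← h2]
      exact ht

end SemialgebraicSets

/-! ### Characteristic polynomials and points of free algebras -/

section FreeAlgebras

open Polynomial TensorProduct

/-- For a finite free algebra `M` over `L` and `x : M`, the roots of the specialization of the
characteristic polynomial of `x` along `ψ : L → K` are the values at `x` of the `K`-points of `M`
above `ψ`. -/
theorem isRoot_charpoly_iff {L M K : Type*} [CommRing L] [CommRing M] [Algebra L M]
    [Module.Free L M] [Module.Finite L M] [Field K] [IsAlgClosed K] (x : M) (ψ : L →+* K) (z : K) :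
    ((Algebra.lmul L M x).charpoly.map ψ).IsRoot z ↔
      ∃ Ψ : M →+* K, Ψ.comp (algebraMap L M) = ψ ∧ Ψ x = z := by
  constructor
  · intro hz
    let _ := ψ.toAlgebra
    have hchar : (Algebra.lmul L M x).charpoly.map ψ =
        (Algebra.lmul K (K ⊗[L] M) (1 ⊗ₜ x)).charpoly := by
      rw [← Algebra.baseChange_lmul, LinearMap.charpoly_baseChange]
      rfl
    rw [hchar, ← Module.End.hasEigenvalue_iff_isRoot_charpoly] at hz
    obtain ⟨y, hy⟩ := hz.exists_hasEigenvector
    have hyz : (1 ⊗ₜ x - algebraMap K (K ⊗[L] M) z) * y = 0 := by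
      have := hy.apply_eq_smul
      rw [Algebra.smul_def] at this
      rw [sub_mul, sub_eq_zero]
      exact this
    have hnu : ¬ IsUnit ((1 ⊗ₜ x : K ⊗[L] M) - algebraMap K (K ⊗[L] M) z) := fun hu =>
      hy.2 (hu.mul_right_eq_zero.1 hyz)
    obtain ⟨m, hm, hzm⟩ := exists_max_ideal_of_mem_nonunits hnu
    let _ := Ideal.Quotient.field m
    have hbij : Function.Bijective (algebraMap K ((K ⊗[L] M) ⧸ m)) :=
      IsAlgClosed.algebraMap_bijective_of_isIntegral
    let e : K ≃+* ((K ⊗[L] M) ⧸ m) := RingEquiv.ofBijective _ hbij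
    refine ⟨(e.symm : _ →+* K).comp ((Ideal.Quotient.mk m).comp
      (Algebra.TensorProduct.includeRight : M →ₐ[L] K ⊗[L] M).toRingHom), ?_, ?_⟩
    · ext l
      change e.symm (Ideal.Quotient.mk m ((1 : K) ⊗ₜ[L] algebraMap L M l)) = ψ l
      rw [RingEquiv.symm_apply_eq]
      change _ = algebraMap K _ (ψ l)
      rw [IsScalarTower.algebraMap_apply K (K ⊗[L] M), Algebra.TensorProduct.algebraMap_apply,
        Algebra.algebraMap_eq_smul_one, ← TensorProduct.smul_tmul, Algebra.smul_def, mul_one]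
      rfl
    · change e.symm (Ideal.Quotient.mk m ((1 : K) ⊗ₜ[L] x)) = z
      rw [RingEquiv.symm_apply_eq]
      change _ = algebraMap K _ z
      rw [IsScalarTower.algebraMap_apply K (K ⊗[L] M)]
      exact Ideal.Quotient.eq.2 hzm
  · rintro ⟨Ψ, rfl, rfl⟩
    have h1 : aeval x (Algebra.lmul L M x).charpoly = 0 := by
      have h2 := LinearMap.aeval_self_charpoly (Algebra.lmul L M x)
      rw [aeval_algHom_apply] at h2
      simpa using congrArg (fun f => f 1) h2
    rw [IsRoot, eval_map, ← hom_eval₂, ← aeval_def, h1, map_zero]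

/-- A free algebra with a point in a field is finite as soon as it is obtained from a monogenic
integral subalgebra by inverting one element. -/
theorem finite_of_free_of_integral {L M K : Type*} [CommRing L] [CommRing M] [Algebra L M]
    [Module.Free L M] [Field K] (ψ : L →+* K) {x s : M} (hx : IsIntegral L x)
    (hs : s ∈ Algebra.adjoin L {x}) (hsu : IsUnit s)
    (hgen : ∀ m : M, ∃ k : ℕ, s ^ k * m ∈ Algebra.adjoin L {x}) : Module.Finite L M := by
  let _ := ψ.toAlgebra
  let inc : M →ₐ[L] K ⊗[L] M := Algebra.TensorProduct.includeRight
  let E : Subalgebra K (K ⊗[L] M) := Algebra.adjoin K {inc x}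
  have hE : Module.Finite K E := by
    have hint : IsIntegral K (inc x) := IsIntegral.tower_top (R := L) (hx.map inc)
    exact (Module.Finite.iff_fg (N := Subalgebra.toSubmodule E)).2 hint.fg_adjoin_singleton
  have hsub : ∀ m ∈ Algebra.adjoin L {x}, inc m ∈ E := by
    intro m hm
    have : Algebra.adjoin L {x} ≤ (E.restrictScalars L).comap inc :=
      Algebra.adjoin_le (Set.singleton_subset_iff.2
        (Algebra.subset_adjoin (R := K) (Set.mem_singleton (inc x))))
    exact this hm
  -- `s` is invertible already in the finite-dimensional algebra `E`
  have hunit : IsUnit (⟨inc s, hsub s hs⟩ : E) := by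
    have : IsArtinianRing E := IsArtinianRing.of_finite K E
    refine IsArtinianRing.isUnit_of_mem_nonZeroDivisors ?_
    rw [mem_nonZeroDivisors_iff_right]
    intro y hy
    have h1 : (y : K ⊗[L] M) * inc s = 0 := congrArg Subtype.val hy
    exact Subtype.ext (((hsu.map inc).mul_left_eq_zero).1 h1)
  obtain ⟨t, ht⟩ := hunit.exists_left_inv
  have ht' : (t : K ⊗[L] M) * inc s = 1 := congrArg Subtype.val ht
  have hmem : ∀ m : M, inc m ∈ E := by
    intro m
    obtain ⟨k, hk⟩ := hgen m
    have h1 : inc m = (t : K ⊗[L] M) ^ k * inc (s ^ k * m) := by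
      rw [map_mul, map_pow, ← mul_assoc, ← mul_pow, ht', one_pow, one_mul]
    rw [h1]
    exact E.mul_mem (E.pow_mem t.2 k) (hsub _ hk)
  have htop : E = ⊤ := by
    rw [eq_top_iff]
    intro y _
    induction y with
    | zero => exact E.zero_mem
    | add a b ha hb => exact E.add_mem (ha trivial) (hb trivial)
    | tmul c m =>
      have : c ⊗ₜ[L] m = c • inc m := by
        simp [inc, TensorProduct.smul_tmul']
      rw [this]
      exact E.smul_mem (hmem m) c
  have hfin : Module.Finite K (K ⊗[L] M) := by
    rw [htop] at hE
    exact Module.Finite.equiv (Subalgebra.topEquiv (R := K) (A := K ⊗[L] M)).toLinearEquiv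
  let b := Module.Free.chooseBasis L M
  have : Finite (Module.Free.ChooseBasisIndex L M) :=
    Module.Finite.finite_basis (Algebra.TensorProduct.basis K b)
  exact Module.Finite.of_basis b

/-- Clearing denominators in a polynomial. -/
theorem exists_clear_denominators {A L : Type*} [CommRing A] [CommRing L] (ι : A →+* L)
    (hι : ∀ c : L, ∃ f D : A, IsUnit (ι D) ∧ ι D * c = ι f) (P : L[X]) :
    ∃ (D : A) (G : A[X]), IsUnit (ι D) ∧ G.map ι = C (ι D) * P := by
  induction P using Polynomial.induction_on' with
  | add p q hp hq =>
    obtain ⟨D, G, hD, hG⟩ := hp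
    obtain ⟨D', G', hD', hG'⟩ := hq
    refine ⟨D * D', C D' * G + C D * G', by rw [map_mul]; exact hD.mul hD', ?_⟩
    simp only [Polynomial.map_add, Polynomial.map_mul, map_C, hG, hG', map_mul]
    ring
  | monomial k c =>
    obtain ⟨f, D, hD, hf⟩ := hι c
    exact ⟨D, monomial k f, hD, by rw [map_monomial, ← hf, C_mul_monomial]⟩

/-- The fibres of a finite free morphism to a localized closed subscheme of affine space, described
by one polynomial whose leading coefficient does not vanish on the base. -/
theorem exists_fiber_polynomial {R K : Type*} [Field R] [Field K] [Algebra R K] [IsAlgClosed K]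
    {n : ℕ} {L M : Type*} [CommRing L] [CommRing M] [Algebra L M] [Module.Free L M]
    [Module.Finite L M] (ι : MvPolynomial (Fin n) R →+* L)
    (hι : ∀ c : L, ∃ f D, IsUnit (ι D) ∧ ι D * c = ι f) (x : M) :
    ∃ (d : ℕ) (D : MvPolynomial (Fin n) R) (G : (MvPolynomial (Fin n) R)[X]),
      ∀ (a : Fin n → R) (ψ : L →+* R), ψ.comp ι = MvPolynomial.eval a →
        MvPolynomial.eval a D ≠ 0 ∧ ∃ P : R[X], P.Monic ∧ P.natDegree = d ∧
          G.map (MvPolynomial.eval a) = C (MvPolynomial.eval a D) * P ∧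
          ∀ z : K, aeval z P = 0 ↔ ∃ Ψ : M →+* K,
            Ψ.comp (algebraMap L M) = (algebraMap R K).comp ψ ∧ Ψ x = z := by
  obtain ⟨D, G, hD, hG⟩ := exists_clear_denominators ι hι (Algebra.lmul L M x).charpoly
  have hmon := (Algebra.lmul L M x).charpoly_monic
  refine ⟨(Algebra.lmul L M x).charpoly.natDegree, D, G, fun a ψ hψ => ?_⟩
  have hev : ∀ f, MvPolynomial.eval a f = ψ (ι f) := fun f => by rw [← hψ]; rfl
  refine ⟨by rw [hev]; exact (hD.map ψ).ne_zero, _, hmon.map ψ, hmon.natDegree_map ψ, ?_,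
    fun z => ?_⟩
  · rw [← hψ, ← Polynomial.map_map, hG, Polynomial.map_mul, map_C]
    rfl
  · rw [← isRoot_charpoly_iff, ← Polynomial.map_map, IsRoot, eval_map, aeval_def]

end FreeAlgebras

/-! ### Fibre polynomials of `X_W` and of `U_v` -/

section Fibres

open Polynomial

variable {R : Type*} [Field R] {n : ℕ}

/-- The point `(a, z)` of `K^(n+1)` with rational base coordinates. -/
noncomputable def pt {K : Type*} [CommRing K] [Algebra R K] (a : Fin n → R) (z : K) :
    Fin (n + 1) → K :=
  Fin.snoc (α := fun _ => K) (fun i => algebraMap R K (a i)) z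

theorem mem_geomFiber_locus {I : Ideal (MvPolynomial (Fin (n + 1)) R)}
    {h : MvPolynomial (Fin (n + 1)) R} {a : Fin n → R} {z : AlgebraicClosure R} :
    z ∈ geomFiber (locus I h) a ↔
      (∀ f ∈ I, MvPolynomial.aeval (pt a z) f = 0) ∧ MvPolynomial.aeval (pt a z) h ≠ 0 :=
  Iff.rfl

theorem aeval_pt_incl {K : Type*} [Field K] [Algebra R K] (a : Fin n → R) (z : K)
    (f : MvPolynomial (Fin n) R) :
    MvPolynomial.aeval (pt a z) (incl R n f) = algebraMap R K (MvPolynomial.eval a f) := by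
  change MvPolynomial.aeval (pt a z) (MvPolynomial.rename Fin.castSucc f) = _
  rw [MvPolynomial.aeval_rename]
  have : pt a z ∘ Fin.castSucc = algebraMap R K ∘ a := by
    ext i
    simp [pt]
  rw [this, MvPolynomial.aeval_algebraMap_apply]
  rfl

/-- A ring homomorphism on polynomials in `n + 1` variables over a rational point `a` of the base is
the evaluation at a point `(a, z)`. -/
theorem ringHom_eq_aeval_pt {K : Type*} [Field K] [Algebra R K] (a : Fin n → R)
    (ρ : MvPolynomial (Fin (n + 1)) R →+* K)
    (hρ : ∀ f, ρ (incl R n f) = algebraMap R K (MvPolynomial.eval a f)) :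
    ρ = (MvPolynomial.aeval (pt a (ρ (MvPolynomial.X (Fin.last n)))) :
      MvPolynomial (Fin (n + 1)) R →ₐ[R] K).toRingHom := by
  refine MvPolynomial.ringHom_ext (fun r => ?_) fun i => ?_
  · have := hρ (MvPolynomial.C r)
    simpa [incl] using this
  · refine Fin.lastCases ?_ (fun i => ?_) i
    · simp [pt]
    · have := hρ (MvPolynomial.X i)
      simpa [incl, pt] using this

variable {J : Ideal (MvPolynomial (Fin n) R)} {I : Ideal (MvPolynomial (Fin (n + 1)) R)}

/-- The map from polynomials to the coordinate ring of `W`. -/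
noncomputable def toW (w : MvPolynomial (Fin n) R ⧸ J) : MvPolynomial (Fin n) R →+* CoordW w :=
  (algebraMap (MvPolynomial (Fin n) R ⧸ J) (CoordW w)).comp (Ideal.Quotient.mk J)

theorem toW_surj (w : MvPolynomial (Fin n) R ⧸ J) (c : CoordW w) :
    ∃ f D, IsUnit (toW w D) ∧ toW w D * c = toW w f := by
  obtain ⟨k, f, hf⟩ := IsLocalization.Away.surj w c
  obtain ⟨f, rfl⟩ := Ideal.Quotient.mk_surjective f
  obtain ⟨D, rfl⟩ := Ideal.Quotient.mk_surjective w
  refine ⟨f, D ^ k, ?_, ?_⟩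
  · rw [map_pow]
    exact (IsLocalization.Away.algebraMap_isUnit (Ideal.Quotient.mk J D)).pow k
  · rw [mul_comm, map_pow]
    exact hf

/-- Extending a ring homomorphism to a localization, compatibly with a given one on the base. -/
theorem exists_lift_awayMap {A B K : Type*} [CommRing A] [CommRing B] [CommRing K] (f : A →+* B)
    (r : A) (ψ : Localization.Away r →+* K) (ρ : B →+* K)
    (h : ρ.comp f = ψ.comp (algebraMap A (Localization.Away r))) :
    ∃ Ψ : Localization.Away (f r) →+* K, Ψ.comp (Localization.awayMap f r) = ψ ∧
      Ψ.comp (algebraMap B (Localization.Away (f r))) = ρ := by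
  have hu : IsUnit (ρ (f r)) := by
    have : ρ (f r) = ψ (algebraMap _ _ r) := DFunLike.congr_fun h r
    rw [this]
    exact (IsLocalization.Away.algebraMap_isUnit r).map ψ
  refine ⟨IsLocalization.Away.lift (f r) hu, ?_, IsLocalization.Away.lift_comp _ _⟩
  refine IsLocalization.ringHom_ext (Submonoid.powers r) ?_
  rw [← h, RingHom.comp_assoc]
  have : (Localization.awayMap f r).comp (algebraMap A (Localization.Away r)) =
      (algebraMap B (Localization.Away (f r))).comp f := IsLocalization.map_comp _
  rw [this, ← RingHom.comp_assoc, IsLocalization.Away.lift_comp]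

theorem awayMap_comp_algebraMap {A B : Type*} [CommRing A] [CommRing B] (f : A →+* B) (r : A) :
    (Localization.awayMap f r).comp (algebraMap A (Localization.Away r)) =
      (algebraMap B (Localization.Away (f r))).comp f := IsLocalization.map_comp _

/-- The map from polynomials to the coordinate ring of `X_W`. -/
noncomputable def toXW (hJI : J ≤ I.comap (incl R n)) (w : MvPolynomial (Fin n) R ⧸ J) :
    MvPolynomial (Fin (n + 1)) R →+* Localization.Away (projMap hJI w) :=
  (algebraMap _ _).comp (Ideal.Quotient.mk I)

theorem mapXW_comp_toW (hJI : J ≤ I.comap (incl R n)) (w : MvPolynomial (Fin n) R ⧸ J) :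
    (mapXW hJI w).comp (toW w) = (toXW hJI w).comp (incl R n) := by
  rw [toW, mapXW, ← RingHom.comp_assoc, awayMap_comp_algebraMap]
  rfl

theorem exists_lift_XW (hJI : J ≤ I.comap (incl R n)) (w : MvPolynomial (Fin n) R ⧸ J)
    {K : Type*} [CommRing K] (ψ : CoordW w →+* K) (ρ : MvPolynomial (Fin (n + 1)) R →+* K)
    (hρ : ρ.comp (incl R n) = ψ.comp (toW w)) (hI : ∀ f ∈ I, ρ f = 0) :
    ∃ Ψ : Localization.Away (projMap hJI w) →+* K, Ψ.comp (mapXW hJI w) = ψ ∧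
      Ψ.comp (toXW hJI w) = ρ := by
  obtain ⟨Ψ, h1, h2⟩ := exists_lift_awayMap (projMap hJI) w ψ (Ideal.Quotient.lift I ρ hI)
    (Ideal.Quotient.ringHom_ext hρ)
  refine ⟨Ψ, h1, ?_⟩
  rw [toXW, ← RingHom.comp_assoc, h2]
  rfl

/-- Denominators on a distinguished open set of a closed subscheme. -/
theorem exists_denominator_away_quotient {A L : Type*} [CommRing A] [CommRing L] (t : A →+* L)
    (ht : ∀ c, ∃ f D, IsUnit (t D) ∧ t D * c = t f) (𝔎 : Ideal L) (v : L ⧸ 𝔎)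
    (c : Localization.Away v) :
    ∃ f D, IsUnit (algebraMap _ (Localization.Away v) (Ideal.Quotient.mk 𝔎 (t D))) ∧
      algebraMap _ (Localization.Away v) (Ideal.Quotient.mk 𝔎 (t D)) * c =
        algebraMap _ (Localization.Away v) (Ideal.Quotient.mk 𝔎 (t f)) := by
  obtain ⟨k, b, hb⟩ := IsLocalization.Away.surj v c
  obtain ⟨b, rfl⟩ := Ideal.Quotient.mk_surjective b
  obtain ⟨v, rfl⟩ := Ideal.Quotient.mk_surjective v
  obtain ⟨f, D, hD, hf⟩ := ht b
  obtain ⟨f', D', hD', hf'⟩ := ht (v ^ k)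
  -- `D b = f`, `D' v^k = f'` and `c v^k = b`, hence `D f' c = D' f`
  refine ⟨D' * f, D * f', ?_, ?_⟩
  · rw [map_mul t, ← hf']
    simp only [map_mul, map_pow]
    exact ((hD.map (Ideal.Quotient.mk 𝔎)).map _).mul (((hD'.map (Ideal.Quotient.mk 𝔎)).map _).mul
      ((IsLocalization.Away.algebraMap_isUnit _).pow k))
  · rw [map_mul t, map_mul t, ← hf', ← hf]
    simp only [map_mul, map_pow, ← hb]
    ring

/-- Extending ring homomorphisms to the open subscheme over `D(v)`, where `v` is a function on the
scheme-theoretic image. -/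
theorem exists_lift_kerLift {L Z K : Type*} [CommRing L] [CommRing Z] [Field K] (μ : L →+* Z)
    (r : Z) (κ : L →+* Localization.Away r) (hκ : κ = (algebraMap Z (Localization.Away r)).comp μ)
    (v : L ⧸ RingHom.ker κ) (ψ : Localization.Away v →+* K) (ΨZ : Z →+* K)
    (h : ΨZ.comp μ =
      (ψ.comp (algebraMap _ (Localization.Away v))).comp (Ideal.Quotient.mk (RingHom.ker κ)))
    (hr : ΨZ r ≠ 0) :
    ∃ Ψ : Localization.Away (RingHom.kerLift κ v) →+* K,
      Ψ.comp (Localization.awayMap (RingHom.kerLift κ) v) = ψ ∧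
      ∀ c, Ψ (algebraMap _ _ (algebraMap Z (Localization.Away r) c)) = ΨZ c := by
  let ΨU : Localization.Away r →+* K := IsLocalization.Away.lift r hr.isUnit
  have h1 : ΨU.comp (algebraMap Z (Localization.Away r)) = ΨZ := IsLocalization.Away.lift_comp _ _
  have h2 : ΨU.comp κ = (ψ.comp (algebraMap _ (Localization.Away v))).comp
      (Ideal.Quotient.mk (RingHom.ker κ)) := by
    rw [← h, ← h1, RingHom.comp_assoc, hκ]
  have h3 : ΨU.comp (RingHom.kerLift κ) = ψ.comp (algebraMap _ (Localization.Away v)) := by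
    refine Ideal.Quotient.ringHom_ext ?_
    rw [← h2]
    rfl
  obtain ⟨Ψ, h4, h5⟩ := exists_lift_awayMap (RingHom.kerLift κ) v ψ ΨU h3
  refine ⟨Ψ, h4, fun c => ?_⟩
  rw [← h1]
  exact DFunLike.congr_fun h5 (algebraMap Z (Localization.Away r) c)

/-- Every function on the open subscheme over `D(v)` becomes a polynomial after multiplication by a
unit of the base and by a power of `r`. -/
theorem exists_denominator_kerLift {B L Z : Type*} [CommRing B] [CommRing L] [CommRing Z]
    (μ : L →+* Z) (t : B →+* Z) (ht : ∀ c, ∃ (u : L) (f : B), IsUnit u ∧ μ u * c = t f)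
    (r : Z) (κ : L →+* Localization.Away r) (hκ : κ = (algebraMap Z (Localization.Away r)).comp μ)
    (v : L ⧸ RingHom.ker κ) (m : Localization.Away (RingHom.kerLift κ v)) :
    ∃ (u : Localization.Away v) (k : ℕ) (f : B), IsUnit u ∧
      Localization.awayMap (RingHom.kerLift κ) v u *
        algebraMap _ (Localization.Away (RingHom.kerLift κ v))
          (algebraMap Z (Localization.Away r) r) ^ k * m =
      algebraMap _ (Localization.Away (RingHom.kerLift κ v))
        (algebraMap Z (Localization.Away r) (t f)) := by
  obtain ⟨i, b, hb⟩ := IsLocalization.Away.surj (RingHom.kerLift κ v) m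
  obtain ⟨k, c, hc⟩ := IsLocalization.Away.surj r b
  obtain ⟨u, f, hu, hf⟩ := ht c
  have h1 : ∀ a, Localization.awayMap (RingHom.kerLift κ) v
      (algebraMap _ (Localization.Away v) a) = algebraMap _ _ (RingHom.kerLift κ a) := fun a =>
    DFunLike.congr_fun (awayMap_comp_algebraMap (RingHom.kerLift κ) v) a
  have h2 : RingHom.kerLift κ (Ideal.Quotient.mk (RingHom.ker κ) u) =
      algebraMap Z (Localization.Away r) (μ u) := by
    rw [RingHom.kerLift_mk, hκ]
    rfl
  refine ⟨algebraMap _ (Localization.Away v) (Ideal.Quotient.mk (RingHom.ker κ) u) *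
    algebraMap _ (Localization.Away v) v ^ i, k, f, ?_, ?_⟩
  · exact ((hu.map (Ideal.Quotient.mk (RingHom.ker κ))).map _).mul
      ((IsLocalization.Away.algebraMap_isUnit v).pow _)
  · rw [map_mul, map_pow, h1, h1, h2, ← hf, map_mul, map_mul, ← hc, map_mul, map_pow, ← hb]
    ring

/-- A fibre polynomial for the family of sets `F a`, `a ∈ S`: at each `a ∈ S`, the denominator `D`
does not vanish and `G` specializes to `D(a)` times a monic polynomial of degree `d` whose roots in
the algebraic closure form the set `F a`. -/
def IsFiberPolynomial (S : Set (Fin n → R)) (F : (Fin n → R) → Set (AlgebraicClosure R)) (d : ℕ)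
    (D : MvPolynomial (Fin n) R) (G : (MvPolynomial (Fin n) R)[X]) : Prop :=
  ∀ a ∈ S, MvPolynomial.eval a D ≠ 0 ∧ ∃ P : R[X], P.Monic ∧ P.natDegree = d ∧
    G.map (MvPolynomial.eval a) = C (MvPolynomial.eval a D) * P ∧ ∀ z, aeval z P = 0 ↔ z ∈ F a

theorem mem_adjoin_of_comp_incl {L M : Type*} [CommRing L] [CommRing M] [Algebra L M]
    (j : MvPolynomial (Fin (n + 1)) R →+* M) (t : MvPolynomial (Fin n) R →+* L)
    (hj : ∀ f, j (incl R n f) = algebraMap L M (t f)) (f : MvPolynomial (Fin (n + 1)) R) :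
    j f ∈ Algebra.adjoin L {j (MvPolynomial.X (Fin.last n))} := by
  have hincl : ∀ f, j (incl R n f) ∈ Algebra.adjoin L {j (MvPolynomial.X (Fin.last n))} :=
    fun f => hj f ▸ Subalgebra.algebraMap_mem _ _
  induction f using MvPolynomial.induction_on with
  | C r => simpa [incl] using hincl (MvPolynomial.C r)
  | add p q hp hq =>
    rw [map_add]
    exact add_mem hp hq
  | mul_X p i hp =>
    rw [map_mul]
    refine mul_mem hp ?_
    refine Fin.lastCases ?_ (fun i => ?_) i
    · exact Algebra.subset_adjoin rfl
    · simpa [incl] using hincl (MvPolynomial.X i)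

/-- The fibre polynomial of a free scheme over a base with coordinate ring `L`: the coordinate ring
`M` is obtained from polynomial functions by inverting `h'` and units of the base, the last
coordinate is integral, and the points of `M` over a point of the base are the common zeros of `𝔞`
at which `h'` does not vanish. -/
theorem exists_isFiberPolynomial {L M : Type*} [CommRing L] [CommRing M] [Algebra L M]
    [Module.Free L M] (t : MvPolynomial (Fin n) R →+* L)
    (ht : ∀ c, ∃ f D, IsUnit (t D) ∧ t D * c = t f)
    (j : MvPolynomial (Fin (n + 1)) R →+* M) (hj : ∀ f, j (incl R n f) = algebraMap L M (t f))
    (h' : MvPolynomial (Fin (n + 1)) R) (hunit : IsUnit (j h'))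
    (hint : IsIntegral L (j (MvPolynomial.X (Fin.last n))))
    (hgen : ∀ m, ∃ (u : L) (k : ℕ) (f : MvPolynomial (Fin (n + 1)) R),
      IsUnit u ∧ algebraMap L M u * j h' ^ k * m = j f)
    {𝔞 : Ideal (MvPolynomial (Fin (n + 1)) R)} (hker : ∀ f ∈ 𝔞, j f = 0)
    (hlift : ∀ (ψ : L →+* AlgebraicClosure R)
      (ρ : MvPolynomial (Fin (n + 1)) R →+* AlgebraicClosure R),
      ρ.comp (incl R n) = ψ.comp t → (∀ f ∈ 𝔞, ρ f = 0) → ρ h' ≠ 0 →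
        ∃ Ψ : M →+* AlgebraicClosure R, Ψ.comp (algebraMap L M) = ψ ∧ ∀ f, Ψ (j f) = ρ f)
    {S : Set (Fin n → R)} (hne : S.Nonempty)
    (hS : ∀ a ∈ S, ∃ ψ : L →+* R, ∀ f, ψ (t f) = MvPolynomial.eval a f) :
    ∃ d D G, IsFiberPolynomial S
      (fun a => {z | (∀ f ∈ 𝔞, MvPolynomial.aeval (pt a z) f = 0) ∧
        MvPolynomial.aeval (pt a z) h' ≠ 0}) d D G := by
  have hadj := mem_adjoin_of_comp_incl j t hj
  obtain ⟨a₀, ha₀⟩ := hne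
  obtain ⟨ψ₀, -⟩ := hS a₀ ha₀
  have hfin : Module.Finite L M := by
    refine finite_of_free_of_integral ψ₀ hint (hadj h') hunit fun m => ?_
    obtain ⟨u, k, f, hu, hf⟩ := hgen m
    refine ⟨k, ?_⟩
    obtain ⟨u', hu'⟩ := hu.exists_left_inv
    have h2 : j h' ^ k * m = algebraMap L M u' * j f := by
      rw [← hf, mul_assoc, ← mul_assoc, ← map_mul, hu', map_one, one_mul]
    rw [h2]
    exact mul_mem (Subalgebra.algebraMap_mem _ _) (hadj f)
  obtain ⟨d, D, G, h⟩ := exists_fiber_polynomial (K := AlgebraicClosure R) t ht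
    (j (MvPolynomial.X (Fin.last n)))
  refine ⟨d, D, G, fun a ha => ?_⟩
  obtain ⟨ψ, hψ⟩ := hS a ha
  obtain ⟨hD, P, hP, hPd, hG, hroot⟩ := h a ψ (RingHom.ext hψ)
  refine ⟨hD, P, hP, hPd, hG, fun z => (hroot z).trans ⟨?_, fun hz => ?_⟩⟩
  · rintro ⟨Ψ, hΨ, rfl⟩
    have h3 := ringHom_eq_aeval_pt (K := AlgebraicClosure R) a (Ψ.comp j) fun f => by
      have h5 := DFunLike.congr_fun hΨ (t f)
      rw [← hψ, RingHom.comp_apply, hj]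
      exact h5
    have h4 : ∀ f, MvPolynomial.aeval (pt a (Ψ (j (MvPolynomial.X (Fin.last n))))) f =
        Ψ (j f) := fun f => (DFunLike.congr_fun h3 f).symm
    refine ⟨fun f hf => ?_, ?_⟩
    · rw [h4, hker f hf, map_zero]
    · rw [h4]
      exact (hunit.map Ψ).ne_zero
  · obtain ⟨hz1, hz2⟩ := hz
    obtain ⟨Ψ, h3, h4⟩ := hlift ((algebraMap R (AlgebraicClosure R)).comp ψ)
      (MvPolynomial.aeval (pt a z) : _ →ₐ[R] AlgebraicClosure R).toRingHom
      (RingHom.ext fun f => by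
        change MvPolynomial.aeval (pt a z) (incl R n f) = algebraMap R _ (ψ (t f))
        rw [aeval_pt_incl, hψ]) hz1 hz2
    refine ⟨Ψ, h3, (h4 _).trans ?_⟩
    change MvPolynomial.aeval (pt a z) _ = z
    simp [pt]

/-- Polynomials generate the coordinate ring of `X_W` up to units of `W`. -/
theorem exists_denominator_XW (hJI : J ≤ I.comap (incl R n)) (w : MvPolynomial (Fin n) R ⧸ J)
    (c : Localization.Away (projMap hJI w)) :
    ∃ (u : CoordW w) (f : MvPolynomial (Fin (n + 1)) R),
      IsUnit u ∧ mapXW hJI w u * c = toXW hJI w f := by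
  obtain ⟨l, f, hf⟩ := IsLocalization.Away.surj (projMap hJI w) c
  obtain ⟨f, rfl⟩ := Ideal.Quotient.mk_surjective f
  refine ⟨algebraMap _ _ w ^ l, f, (IsLocalization.Away.algebraMap_isUnit w).pow l, ?_⟩
  have h1 : mapXW hJI w (algebraMap _ _ w) = algebraMap _ _ (projMap hJI w) :=
    DFunLike.congr_fun (awayMap_comp_algebraMap (projMap hJI) w) w
  rw [map_pow, h1, mul_comm]
  exact hf

theorem toXW_eq_zero (hJI : J ≤ I.comap (incl R n)) (w : MvPolynomial (Fin n) R ⧸ J)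
    {f : MvPolynomial (Fin (n + 1)) R} (hf : f ∈ I) : toXW hJI w f = 0 := by
  rw [toXW, RingHom.comp_apply, Ideal.Quotient.eq_zero_iff_mem.2 hf, map_zero]

/-- The fibre polynomial of `X_W`, from the characteristic polynomial of the last coordinate acting
on its coordinate ring. -/
theorem exists_isFiberPolynomial_XW (hJI : J ≤ I.comap (incl R n)) (w : MvPolynomial (Fin n) R ⧸ J)
    (hfinite : (mapXW hJI w).Finite) (hfree : IsFreeRingHom (mapXW hJI w)) {S : Set (Fin n → R)}
    (hne : S.Nonempty)
    (hS : ∀ a ∈ S, ∃ ψ : CoordW w →+* R, ∀ f, ψ (toW w f) = MvPolynomial.eval a f) :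
    ∃ d D G, IsFiberPolynomial S (fun a => {z | (∀ f ∈ I, MvPolynomial.aeval (pt a z) f = 0) ∧
      MvPolynomial.aeval (pt a z) (1 : MvPolynomial (Fin (n + 1)) R) ≠ 0}) d D G := by
  let _ := (mapXW hJI w).toAlgebra
  have h2 : Module.Free (CoordW w) (Localization.Away (projMap hJI w)) := hfree
  refine exists_isFiberPolynomial (toW w) (toW_surj w) (toXW hJI w)
    (fun f => (DFunLike.congr_fun (mapXW_comp_toW hJI w) f).symm) 1 (by simp)
    (hfinite.to_isIntegral _) (fun m => ?_) (fun f hf => toXW_eq_zero hJI w hf)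
    (fun ψ ρ hρ hI _ => ?_) hne hS
  · obtain ⟨u, f, hu, hf⟩ := exists_denominator_XW hJI w m
    exact ⟨u, 0, f, hu, by rw [pow_zero, mul_one]; exact hf⟩
  · obtain ⟨Ψ, h3, h4⟩ := exists_lift_XW hJI w ψ ρ hρ hI
    exact ⟨Ψ, h3, fun f => DFunLike.congr_fun h4 f⟩

/-- The fibre polynomial of `U_v`, with the coordinate rings `L` of `W` and `Z` of `X_W ∩ X'` kept
abstract. -/
theorem exists_isFiberPolynomial_kerLift {L Z : Type*} [CommRing L] [CommRing Z]
    (tL : MvPolynomial (Fin n) R →+* L)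
    (htL : ∀ c, ∃ f D, IsUnit (tL D) ∧ tL D * c = tL f) (μ : L →+* Z)
    (tZ : MvPolynomial (Fin (n + 1)) R →+* Z) (hμ : ∀ f, μ (tL f) = tZ (incl R n f))
    (htZ : ∀ c, ∃ (u : L) (f : MvPolynomial (Fin (n + 1)) R), IsUnit u ∧ μ u * c = tZ f)
    {𝔞 : Ideal (MvPolynomial (Fin (n + 1)) R)} (hker : ∀ f ∈ 𝔞, tZ f = 0)
    (hlift : ∀ (ψ : L →+* AlgebraicClosure R)
      (ρ : MvPolynomial (Fin (n + 1)) R →+* AlgebraicClosure R),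
      ρ.comp (incl R n) = ψ.comp tL → (∀ f ∈ 𝔞, ρ f = 0) →
        ∃ Ψ : Z →+* AlgebraicClosure R, Ψ.comp μ = ψ ∧ ∀ f, Ψ (tZ f) = ρ f)
    (hint : μ.IsIntegralElem (tZ (MvPolynomial.X (Fin.last n))))
    (h' : MvPolynomial (Fin (n + 1)) R) (κ : L →+* Localization.Away (tZ h'))
    (hκ : κ = (algebraMap Z (Localization.Away (tZ h'))).comp μ) (v : L ⧸ RingHom.ker κ)
    (hfree : IsFreeRingHom (Localization.awayMap (RingHom.kerLift κ) v))
    {S : Set (Fin n → R)} (hne : S.Nonempty)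
    (hS : ∀ a ∈ S, ∃ ψ : Localization.Away v →+* R, ∀ f,
      ψ (algebraMap _ _ (Ideal.Quotient.mk (RingHom.ker κ) (tL f))) = MvPolynomial.eval a f) :
    ∃ d D G, IsFiberPolynomial S
      (fun a => {z | (∀ f ∈ 𝔞, MvPolynomial.aeval (pt a z) f = 0) ∧
        MvPolynomial.aeval (pt a z) h' ≠ 0}) d D G := by
  let _ := (Localization.awayMap (RingHom.kerLift κ) v).toAlgebra
  have hfree' : Module.Free (Localization.Away v) (Localization.Away (RingHom.kerLift κ v)) := hfree
  let gL : L →+* Localization.Away v := (algebraMap _ _).comp (Ideal.Quotient.mk (RingHom.ker κ))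
  let gZ : Z →+* Localization.Away (RingHom.kerLift κ v) :=
    (algebraMap _ _).comp (algebraMap Z (Localization.Away (tZ h')))
  have hcomm : ∀ l, gZ (μ l) = algebraMap (Localization.Away v) _ (gL l) := by
    intro l
    have h1 := DFunLike.congr_fun (awayMap_comp_algebraMap (RingHom.kerLift κ) v)
      (Ideal.Quotient.mk _ l)
    have h2 : algebraMap Z (Localization.Away (tZ h')) (μ l) =
        RingHom.kerLift κ (Ideal.Quotient.mk _ l) := by
      rw [RingHom.kerLift_mk, hκ]
      rfl
    exact (congrArg (algebraMap _ (Localization.Away (RingHom.kerLift κ v))) h2).trans h1.symm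
  refine exists_isFiberPolynomial (gL.comp tL) (exists_denominator_away_quotient tL htL _ v)
    (gZ.comp tZ) ?_ h' ?_ ?_ ?_ ?_ ?_ hne hS
  · intro f
    exact (congrArg gZ (hμ f)).symm.trans (hcomm (tL f))
  · exact (IsLocalization.Away.algebraMap_isUnit (S := Localization.Away (tZ h')) (tZ h')).map
      (algebraMap _ (Localization.Away (RingHom.kerLift κ v)))
  · obtain ⟨P, hP, hP0⟩ := hint
    refine ⟨P.map gL, hP.map gL, ?_⟩
    rw [eval₂_map]
    have : (algebraMap (Localization.Away v) (Localization.Away (RingHom.kerLift κ v))).comp gL =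
        gZ.comp μ := RingHom.ext fun l => (hcomm l).symm
    rw [this, RingHom.comp_apply, ← hom_eval₂, hP0, map_zero]
  · exact exists_denominator_kerLift μ tZ htZ (tZ h') κ hκ v
  · intro f hf
    rw [RingHom.comp_apply, hker f hf, map_zero]
  · intro ψ ρ hρ hI hh'
    obtain ⟨ΨZ, h3, h4⟩ := hlift (ψ.comp gL) ρ hρ hI
    obtain ⟨Ψ, h6, h7⟩ := exists_lift_kerLift μ (tZ h') κ hκ v ψ ΨZ h3 (by rwa [h4])
    exact ⟨Ψ, h6, fun f => (h7 _).trans (h4 f)⟩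

/-- The fibre polynomial of `U_v`. The last coordinate is integral over `V_v` because it is so on
`X_W`, which makes the free module of functions on `U_v` finite. -/
theorem exists_isFiberPolynomial_Uv (hJI : J ≤ I.comap (incl R n))
    (I' : Ideal (MvPolynomial (Fin (n + 1)) R)) (w : MvPolynomial (Fin n) R ⧸ J)
    (h' : MvPolynomial (Fin (n + 1)) R) (hfinite : (mapXW hJI w).Finite) (v : CoordV hJI I' w h')
    (hfree : IsFreeRingHom (mapUv hJI I' w h' v)) {S : Set (Fin n → R)} (hne : S.Nonempty)
    (hS : S ⊆ rationalPointsVv hJI I' w h' v) :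
    ∃ d D G, IsFiberPolynomial S
      (fun a => {z | (∀ f ∈ I ⊔ I', MvPolynomial.aeval (pt a z) f = 0) ∧
        MvPolynomial.aeval (pt a z) h' ≠ 0}) d D G := by
  have hlift := exists_lift_XW (K := AlgebraicClosure R) (le_comap_sup hJI I') w
  -- integrality of the last coordinate is inherited from `X_W`
  have hint : (mapXW (le_comap_sup hJI I') w).IsIntegralElem
      (toXW (le_comap_sup hJI I') w (MvPolynomial.X (Fin.last n))) := by
    obtain ⟨Ψ, h1, h2⟩ := exists_lift_XW hJI w (mapXW (le_comap_sup hJI I') w)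
      (toXW (le_comap_sup hJI I') w) (mapXW_comp_toW (le_comap_sup hJI I') w).symm
      fun f hf => toXW_eq_zero _ w (Ideal.mem_sup_left hf)
    obtain ⟨P, hP, hP0⟩ := hfinite.to_isIntegral (toXW hJI w (MvPolynomial.X (Fin.last n)))
    refine ⟨P, hP, ?_⟩
    rw [← h1, ← h2, RingHom.comp_apply, ← hom_eval₂, hP0, map_zero]
  exact exists_isFiberPolynomial_kerLift (toW w) (toW_surj w) (mapXW (le_comap_sup hJI I') w)
    (toXW (le_comap_sup hJI I') w)
    (fun f => DFunLike.congr_fun (mapXW_comp_toW (le_comap_sup hJI I') w) f)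
    (exists_denominator_XW (le_comap_sup hJI I') w)
    (fun f hf => toXW_eq_zero (le_comap_sup hJI I') w hf)
    (fun ψ ρ hρ hI => (hlift ψ ρ hρ hI).imp fun Ψ h => ⟨h.1, fun f => DFunLike.congr_fun h.2 f⟩)
    hint h' (mapUW hJI I' w h') rfl v hfree hne hS

/-- Rational points of `V_v` are rational points of `W`. -/
theorem exists_ringHom_CoordW (hJI : J ≤ I.comap (incl R n))
    (I' : Ideal (MvPolynomial (Fin (n + 1)) R)) (w : MvPolynomial (Fin n) R ⧸ J)
    (h' : MvPolynomial (Fin (n + 1)) R) (v : CoordV hJI I' w h') {S : Set (Fin n → R)}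
    (hS : S ⊆ rationalPointsVv hJI I' w h' v) :
    ∀ a ∈ S, ∃ ψ : CoordW w →+* R, ∀ f, ψ (toW w f) = MvPolynomial.eval a f := by
  intro a ha
  obtain ⟨ψ, hψ⟩ := hS ha
  exact ⟨(ψ.comp (algebraMap (CoordV hJI I' w h') (Localization.Away v))).comp
    (Ideal.Quotient.mk _), hψ⟩

end Fibres

/-! ### The squared modulus on the algebraic closure -/

section Modulus

variable (R : Type*) [Field R]

theorem exists_imagUnit : ∃ i : AlgebraicClosure R, i ^ 2 = -1 :=
  IsAlgClosed.exists_pow_nat_eq (-1 : AlgebraicClosure R) (n := 2) (by norm_num)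

/-- A square root of `-1` in the algebraic closure. -/
noncomputable def imagUnit : AlgebraicClosure R := (exists_imagUnit R).choose

theorem imagUnit_sq : imagUnit R ^ 2 = -1 := (exists_imagUnit R).choose_spec

variable {R}

/-- The element `x + i y` of the algebraic closure. -/
noncomputable def cpx (x y : R) : AlgebraicClosure R :=
  algebraMap R _ x + algebraMap R _ y * imagUnit R

theorem cpx_add (x y x' y' : R) : cpx x y + cpx x' y' = cpx (x + x') (y + y') := by
  simp only [cpx, map_add]
  ring

theorem cpx_sub (x y x' y' : R) : cpx x y - cpx x' y' = cpx (x - x') (y - y') := by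
  simp only [cpx, map_sub]
  ring

theorem cpx_mul (x y x' y' : R) :
    cpx x y * cpx x' y' = cpx (x * x' - y * y') (x * y' + y * x') := by
  simp only [cpx, map_add, map_mul, map_sub]
  linear_combination
    (algebraMap R (AlgebraicClosure R) y * algebraMap R (AlgebraicClosure R) y') * imagUnit_sq R

theorem cpx_zero_right (x : R) : cpx x 0 = algebraMap R _ x := by simp [cpx]

variable [LinearOrder R] [IsStrictOrderedRing R]

theorem cpx_eq_zero {x y : R} (h : cpx x y = 0) : x = 0 ∧ y = 0 := by
  have h1 : cpx x y * cpx x (-y) = algebraMap R _ (x ^ 2 + y ^ 2) := by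
    rw [cpx_mul, ← cpx_zero_right]
    congr 1 <;> ring
  rw [h, zero_mul, eq_comm, map_eq_zero_iff _ (algebraMap R (AlgebraicClosure R)).injective] at h1
  constructor <;> nlinarith [sq_nonneg x, sq_nonneg y]

variable [IsRealClosed R]

theorem exists_cpx (z : AlgebraicClosure R) : ∃ x y : R, z = cpx x y :=
  exists_re_im (imagUnit_sq R) z

/-- The squared modulus `x² + y²` of `x + i y`. -/
noncomputable def nsq (z : AlgebraicClosure R) : R :=
  (exists_cpx z).choose ^ 2 + (exists_cpx z).choose_spec.choose ^ 2

theorem nsq_cpx (x y : R) : nsq (cpx x y) = x ^ 2 + y ^ 2 := by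
  have h := sub_eq_zero.2 (exists_cpx (cpx x y)).choose_spec.choose_spec
  rw [cpx_sub] at h
  obtain ⟨h1, h2⟩ := cpx_eq_zero h
  exact congrArg₂ (fun s t => s ^ 2 + t ^ 2) (sub_eq_zero.1 h1).symm (sub_eq_zero.1 h2).symm

theorem nsq_algebraMap (x : R) : nsq (algebraMap R _ x) = x ^ 2 := by
  rw [← cpx_zero_right, nsq_cpx]
  ring

theorem nsq_nonneg (z : AlgebraicClosure R) : 0 ≤ nsq z := by
  rw [nsq]
  positivity

theorem nsq_eq_zero {z : AlgebraicClosure R} : nsq z = 0 ↔ z = 0 := by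
  constructor
  · intro h
    obtain ⟨x, y, rfl⟩ := exists_cpx z
    rw [nsq_cpx] at h
    have hx : x = 0 := by nlinarith [sq_nonneg x, sq_nonneg y]
    have hy : y = 0 := by nlinarith [sq_nonneg x, sq_nonneg y]
    simp [cpx, hx, hy]
  · rintro rfl
    rw [← map_zero (algebraMap R (AlgebraicClosure R)), nsq_algebraMap]
    ring

theorem nsq_pos {z : AlgebraicClosure R} (h : z ≠ 0) : 0 < nsq z :=
  lt_of_le_of_ne (nsq_nonneg z) (fun h' => h (nsq_eq_zero.1 h'.symm))

theorem nsq_mul (z w : AlgebraicClosure R) : nsq (z * w) = nsq z * nsq w := by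
  obtain ⟨x, y, rfl⟩ := exists_cpx z
  obtain ⟨x', y', rfl⟩ := exists_cpx w
  rw [cpx_mul, nsq_cpx, nsq_cpx, nsq_cpx]
  ring

/-- A triangle inequality for the squared modulus, which avoids square roots. -/
theorem nsq_sub_le (z w u : AlgebraicClosure R) :
    nsq (z - w) ≤ 2 * nsq (z - u) + 2 * nsq (w - u) := by
  obtain ⟨x, y, rfl⟩ := exists_cpx z
  obtain ⟨x', y', rfl⟩ := exists_cpx w
  obtain ⟨x'', y'', rfl⟩ := exists_cpx u
  simp only [cpx_sub, nsq_cpx]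
  nlinarith [sq_nonneg (x + x' - 2 * x''), sq_nonneg (y + y' - 2 * y'')]

theorem nsq_sub_comm (z w : AlgebraicClosure R) : nsq (z - w) = nsq (w - z) := by
  obtain ⟨x, y, rfl⟩ := exists_cpx z
  obtain ⟨x', y', rfl⟩ := exists_cpx w
  simp only [cpx_sub, nsq_cpx]
  ring

/-- The squared modulus of a monic polynomial at a point is bounded below in terms of the distance
to its roots. -/
theorem pow_natDegree_le_nsq {P : Polynomial R} (hP : P.Monic) {z : AlgebraicClosure R} {ε : R}
    (hε : 0 ≤ ε) (h : ∀ r, Polynomial.aeval r P = 0 → ε ≤ nsq (z - r)) :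
    ε ^ P.natDegree ≤ nsq (Polynomial.aeval z P) := by
  have hmap : (P.map (algebraMap R (AlgebraicClosure R))).Monic := hP.map _
  have hsplit := IsAlgClosed.splits (P.map (algebraMap R (AlgebraicClosure R)))
  have hcard : (P.map (algebraMap R (AlgebraicClosure R))).roots.card = P.natDegree := by
    rw [← hsplit.natDegree_eq_card_roots, hP.natDegree_map]
  have heval : Polynomial.aeval z P =
      ((P.map (algebraMap R (AlgebraicClosure R))).roots.map fun r => z - r).prod := by
    rw [Polynomial.aeval_def, ← Polynomial.eval_map]
    exact hsplit.eval_eq_prod_roots_of_monic hmap z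
  have key : ∀ s : Multiset (AlgebraicClosure R), (∀ r ∈ s, ε ≤ nsq (z - r)) →
      ε ^ s.card ≤ nsq ((s.map fun r => z - r).prod) := by
    intro s
    induction s using Multiset.induction_on with
    | empty =>
      intro _
      rw [Multiset.card_zero, pow_zero, Multiset.map_zero, Multiset.prod_zero,
        ← map_one (algebraMap R (AlgebraicClosure R)), nsq_algebraMap, one_pow]
    | cons r s ih =>
      intro hs
      rw [Multiset.card_cons, Multiset.map_cons, Multiset.prod_cons, nsq_mul, pow_succ, mul_comm]
      exact mul_le_mul (hs r (by simp)) (ih fun r' hr' => hs r' (by simp [hr'])) (by positivity)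
        (nsq_nonneg _)
  rw [heval, ← hcard]
  refine key _ fun r hr => h r ?_
  rw [Polynomial.aeval_def, ← Polynomial.eval_map]
  exact Polynomial.isRoot_of_mem_roots hr

end Modulus

/-! ### Polynomials in real coordinates -/

section RealForm

variable {R : Type*} [Field R] {n : ℕ}

/-- Real and imaginary parts of a polynomial function in a complex last variable are polynomial. -/
theorem exists_re_im_polynomial (f : MvPolynomial (Fin (n + 1)) R) :
    ∃ F G : MvPolynomial (Fin n ⊕ Fin 2) R, ∀ (a : Fin n → R) (x y : R),
      MvPolynomial.aeval (pt a (cpx x y)) f =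
        cpx (MvPolynomial.eval (Sum.elim a ![x, y]) F)
          (MvPolynomial.eval (Sum.elim a ![x, y]) G) := by
  induction f using MvPolynomial.induction_on with
  | C r => exact ⟨MvPolynomial.C r, 0, fun a x y => by simp [cpx]⟩
  | add p q hp hq =>
    obtain ⟨F, G, h⟩ := hp
    obtain ⟨F', G', h'⟩ := hq
    exact ⟨F + F', G + G', fun a x y => by rw [map_add, h, h', cpx_add, map_add, map_add]⟩
  | mul_X p i hp =>
    obtain ⟨F, G, h⟩ := hp
    refine Fin.lastCases ?_ (fun i => ?_) i
    · refine ⟨F * .X (.inr 0) - G * .X (.inr 1), F * .X (.inr 1) + G * .X (.inr 0),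
        fun a x y => ?_⟩
      rw [map_mul, h, MvPolynomial.aeval_X, pt, Fin.snoc_last, cpx_mul]
      simp
    · refine ⟨F * .X (.inl i), G * .X (.inl i), fun a x y => ?_⟩
      rw [map_mul, h, MvPolynomial.aeval_X, pt, Fin.snoc_castSucc, ← cpx_zero_right, cpx_mul]
      simp

variable [LinearOrder R] [IsStrictOrderedRing R] [IsRealClosed R]

theorem exists_nsq_polynomial (f : MvPolynomial (Fin (n + 1)) R) :
    ∃ F : MvPolynomial (Fin n ⊕ Fin 2) R, ∀ (a : Fin n → R) (x y : R),
      nsq (MvPolynomial.aeval (pt a (cpx x y)) f) = MvPolynomial.eval (Sum.elim a ![x, y]) F := by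
  obtain ⟨F, G, h⟩ := exists_re_im_polynomial f
  exact ⟨F ^ 2 + G ^ 2, fun a x y => by rw [h, nsq_cpx]; simp⟩

variable [TopologicalSpace R] [OrderTopology R]

open Filter Topology

theorem continuous_nsq_aeval (f : MvPolynomial (Fin (n + 1)) R) (z : AlgebraicClosure R) :
    Continuous fun b : Fin n → R => nsq (MvPolynomial.aeval (pt b z) f) := by
  obtain ⟨x, y, rfl⟩ := exists_cpx z
  obtain ⟨F, hF⟩ := exists_nsq_polynomial f
  simp only [hF]
  refine (MvPolynomial.continuous_eval F).comp (continuous_pi fun i => ?_)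
  rcases i with i | i
  · exact continuous_apply i
  · exact continuous_const

/-- A polynomial not vanishing at `(a, z)` does not vanish at nearby points. -/
theorem eventually_aeval_ne_zero (f : MvPolynomial (Fin (n + 1)) R) {a : Fin n → R}
    {z : AlgebraicClosure R} (h : MvPolynomial.aeval (pt a z) f ≠ 0) :
    ∃ ε > 0, ∀ᶠ b in 𝓝 a, ∀ z', nsq (z' - z) < ε → MvPolynomial.aeval (pt b z') f ≠ 0 := by
  obtain ⟨x, y, rfl⟩ := exists_cpx z
  obtain ⟨F, hF⟩ := exists_nsq_polynomial f
  have hcont : Continuous fun p : (Fin n → R) × R × R =>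
      MvPolynomial.eval (Sum.elim p.1 ![p.2.1, p.2.2]) F := by
    refine (MvPolynomial.continuous_eval F).comp (continuous_pi fun i => ?_)
    rcases i with i | i
    · exact (continuous_apply i).comp continuous_fst
    · fin_cases i
      · exact continuous_fst.comp continuous_snd
      · exact continuous_snd.comp continuous_snd
  have hne : ∀ᶠ p in 𝓝 (a, x, y), MvPolynomial.eval (Sum.elim p.1 ![p.2.1, p.2.2]) F ≠ 0 := by
    refine hcont.continuousAt.eventually_ne ?_
    rw [← hF]
    exact fun h0 => h (nsq_eq_zero.1 h0)
  rw [nhds_prod_eq, nhds_prod_eq] at hne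
  obtain ⟨pa, hpa, pb, hpb, hp⟩ := eventually_prod_iff.1 hne
  obtain ⟨px, hpx, py, hpy, hp'⟩ := eventually_prod_iff.1 hpb
  obtain ⟨δ, hδ, hδx⟩ := (nhds_basis_abs_sub_lt x).eventually_iff.1 hpx
  obtain ⟨δ', hδ', hδy⟩ := (nhds_basis_abs_sub_lt y).eventually_iff.1 hpy
  refine ⟨min (δ ^ 2) (δ' ^ 2), by positivity, hpa.mono fun b hb z' hz' h0 => ?_⟩
  obtain ⟨x', y', rfl⟩ := exists_cpx z'
  rw [cpx_sub, nsq_cpx, lt_min_iff] at hz'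
  have h1 : |x' - x| < δ := abs_lt_of_sq_lt_sq (by nlinarith [sq_nonneg (y' - y)]) hδ.le
  have h2 : |y' - y| < δ' := abs_lt_of_sq_lt_sq (by nlinarith [sq_nonneg (x' - x)]) hδ'.le
  refine hp hb (hp' (hδx h1) (hδy h2)) ?_
  rw [← hF, h0]
  exact nsq_eq_zero.2 rfl

end RealForm

/-! ### Continuity of the fibres -/

section LocalConstancy

open Filter Topology Polynomial

variable {R : Type*} [Field R] {n : ℕ}

theorem aeval_pt_eval₂_incl (G : (MvPolynomial (Fin n) R)[X]) (a : Fin n → R)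
    (z : AlgebraicClosure R) :
    MvPolynomial.aeval (pt a z) (G.eval₂ (incl R n) (MvPolynomial.X (Fin.last n))) =
      aeval z (G.map (MvPolynomial.eval a)) := by
  induction G using Polynomial.induction_on' with
  | add p q hp hq => simp only [eval₂_add, map_add, hp, hq, Polynomial.map_add]
  | monomial k c =>
    rw [eval₂_monomial, map_mul, aeval_pt_incl, map_pow, MvPolynomial.aeval_X, map_monomial,
      aeval_monomial, pt, Fin.snoc_last]

variable [LinearOrder R] [IsStrictOrderedRing R] [IsRealClosed R]
  [TopologicalSpace R] [OrderTopology R]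

/-- Points of the fibres described by a fibre polynomial persist under small perturbations. -/
theorem IsFiberPolynomial.eventually_exists_near {S : Set (Fin n → R)}
    {F : (Fin n → R) → Set (AlgebraicClosure R)} {d : ℕ} {D : MvPolynomial (Fin n) R}
    {G : (MvPolynomial (Fin n) R)[X]} (hF : IsFiberPolynomial S F d D G) (a : S)
    {z : AlgebraicClosure R} (hz : z ∈ F a) {ε : R} (hε : 0 < ε) :
    ∀ᶠ b : S in 𝓝 a, ∃ z' ∈ F b, nsq (z' - z) < ε := by
  set g := G.eval₂ (incl R n) (MvPolynomial.X (Fin.last n)) with hg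
  have hval : ∀ b ∈ S, ∃ P : R[X], P.Monic ∧ P.natDegree = d ∧ (∀ z, aeval z P = 0 ↔ z ∈ F b) ∧
      nsq (MvPolynomial.aeval (pt b z) g) = MvPolynomial.eval b D ^ 2 * nsq (aeval z P) := by
    intro b hb
    obtain ⟨-, P, hP, hd, hG, hroot⟩ := hF b hb
    refine ⟨P, hP, hd, hroot, ?_⟩
    rw [hg, aeval_pt_eval₂_incl, hG, map_mul, aeval_C, nsq_mul, nsq_algebraMap]
  have hlt : nsq (MvPolynomial.aeval (pt (a : Fin n → R) z) g) <
      MvPolynomial.eval (a : Fin n → R) D ^ 2 * ε ^ d := by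
    obtain ⟨P, -, -, hroot, h⟩ := hval a a.2
    rw [h, (hroot z).2 hz, nsq_eq_zero.2 rfl, mul_zero]
    have := (hF a a.2).1
    positivity
  have hev : ∀ᶠ b in 𝓝 (a : Fin n → R), nsq (MvPolynomial.aeval (pt b z) g) <
      MvPolynomial.eval b D ^ 2 * ε ^ d :=
    (continuous_nsq_aeval g z).continuousAt.eventually_lt
      (((MvPolynomial.continuous_eval D).pow 2).mul continuous_const).continuousAt hlt
  filter_upwards [continuous_subtype_val.continuousAt.eventually hev] with b hb
  obtain ⟨P, hP, hd, hroot, h⟩ := hval b b.2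
  by_contra hcon
  push Not at hcon
  have h1 := pow_natDegree_le_nsq hP hε.le (z := z) fun r hr => by
    rw [nsq_sub_comm]
    exact hcon r ((hroot r).1 hr)
  rw [h, hd.symm] at hb
  exact hb.not_ge (mul_le_mul_of_nonneg_left h1 (sq_nonneg _))

/-- Points outside the fibres described by a fibre polynomial stay outside under small
perturbations. -/
theorem IsFiberPolynomial.eventually_not_mem {S : Set (Fin n → R)}
    {F : (Fin n → R) → Set (AlgebraicClosure R)} {d : ℕ} {D : MvPolynomial (Fin n) R}
    {G : (MvPolynomial (Fin n) R)[X]} (hF : IsFiberPolynomial S F d D G) (a : S)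
    {z : AlgebraicClosure R} (hz : z ∉ F a) :
    ∃ ε > 0, ∀ᶠ b : S in 𝓝 a, ∀ z', nsq (z' - z) < ε → z' ∉ F b := by
  set g := G.eval₂ (incl R n) (MvPolynomial.X (Fin.last n)) with hg
  have hzero : ∀ (b : S) z, MvPolynomial.aeval (pt (b : Fin n → R) z) g = 0 ↔ z ∈ F b := by
    intro b z
    obtain ⟨hD, P, -, -, hG, hroot⟩ := hF b b.2
    rw [hg, aeval_pt_eval₂_incl, hG, map_mul, aeval_C, mul_eq_zero,
      map_eq_zero_iff _ (algebraMap R (AlgebraicClosure R)).injective, or_iff_right hD, hroot]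
  obtain ⟨ε, hε, h⟩ := eventually_aeval_ne_zero g (fun h0 => hz ((hzero a z).1 h0))
  refine ⟨ε, hε, ?_⟩
  filter_upwards [continuous_subtype_val.continuousAt.eventually h] with b hb z' hz' hmem
  exact hb z' hz' ((hzero b z').2 hmem)

end LocalConstancy

/-! ### Local bijections between fibres of constant cardinality -/

section LocalBijection

open Filter Topology Polynomial

variable {R : Type*} [Field R] {n : ℕ} [LinearOrder R] [IsStrictOrderedRing R] [IsRealClosed R]

/-- The points of a finite set are separated by some positive distance. -/
theorem exists_separation {A : Set (AlgebraicClosure R)} (hA : A.Finite) :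
    ∃ ε > 0, ∀ z ∈ A, ∀ w ∈ A, nsq (z - w) < 4 * ε → z = w := by
  let B : Set R := insert 1 ((fun p : AlgebraicClosure R × AlgebraicClosure R =>
    nsq (p.1 - p.2)) '' {p ∈ A ×ˢ A | p.1 ≠ p.2})
  have hB : B.Finite := (((hA.prod hA).subset (Set.sep_subset _ _)).image _).insert 1
  obtain ⟨ε, hεB, hε⟩ := Set.exists_min_image B id hB ⟨1, Set.mem_insert _ _⟩
  have hpos : 0 < ε := by
    rcases hεB with rfl | ⟨p, hp, rfl⟩
    · exact one_pos
    · exact nsq_pos (sub_ne_zero.2 hp.2)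
  refine ⟨ε / 4, by positivity, fun z hz w hw h => ?_⟩
  by_contra hne
  have := hε (nsq (z - w)) (.inr ⟨(z, w), ⟨⟨hz, hw⟩, hne⟩, rfl⟩)
  simp only [id] at this
  linarith

variable [TopologicalSpace R] [OrderTopology R]

variable {S : Set (Fin n → R)} {T FX FU : (Fin n → R) → Set (AlgebraicClosure R)}
  {h : MvPolynomial (Fin (n + 1)) R}

/-- Each point of a fibre of `T` persists in the nearby fibres, on or off `FU` as before: a point of
`FU` is followed inside `FU`, and a point off `FU` inside `FX`, where it cannot meet `FU`. -/
theorem eventually_exists_near_mem_iff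
    (hX : ∃ d D G, IsFiberPolynomial S FX d D G) (hU : ∃ d D G, IsFiberPolynomial S FU d D G)
    (hUX : ∀ a ∈ S, FU a ⊆ FX a)
    (hT : ∀ a ∈ S, ∀ z, z ∈ T a ↔ z ∈ FX a ∧ MvPolynomial.aeval (pt a z) h ≠ 0)
    (a : S) {z : AlgebraicClosure R} (hz : z ∈ T a) {ε : R} (hε : 0 < ε) :
    ∀ᶠ b : S in 𝓝 a, ∃ z' ∈ T b, nsq (z' - z) < ε ∧ (z' ∈ FU b ↔ z ∈ FU a) := by
  obtain ⟨_, _, _, hX⟩ := hX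
  obtain ⟨_, _, _, hU⟩ := hU
  obtain ⟨hzX, hzh⟩ := (hT a a.2 z).1 hz
  obtain ⟨ε₁, hε₁, h₁⟩ := eventually_aeval_ne_zero h hzh
  replace h₁ := continuous_subtype_val.continuousAt.eventually h₁
  by_cases hzU : z ∈ FU a
  · filter_upwards [h₁, hU.eventually_exists_near a hzU (lt_min hε hε₁)] with b hb ⟨z', hz', hlt⟩
    rw [lt_min_iff] at hlt
    exact ⟨z', (hT b b.2 z').2 ⟨hUX b b.2 hz', hb z' hlt.2⟩, hlt.1, by simp [hz', hzU]⟩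
  · obtain ⟨ε₂, hε₂, h₂⟩ := hU.eventually_not_mem a hzU
    filter_upwards [h₁, h₂, hX.eventually_exists_near a hzX (lt_min hε (lt_min hε₁ hε₂))] with
      b hb hb' ⟨z', hz', hlt⟩
    rw [lt_min_iff, lt_min_iff] at hlt
    exact ⟨z', (hT b b.2 z').2 ⟨hz', hb z' hlt.2.1⟩, hlt.1, by simp [hb' z' hlt.2.2, hzU]⟩

/-- When the fibres of `T` are finite of constant cardinality, nearby fibres are matched by a small
displacement, which preserves membership in the fibres of `FU`. -/
theorem exists_local_bijection
    (hX : ∃ d D G, IsFiberPolynomial S FX d D G) (hU : ∃ d D G, IsFiberPolynomial S FU d D G)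
    (hUX : ∀ a ∈ S, FU a ⊆ FX a)
    (hT : ∀ a ∈ S, ∀ z, z ∈ T a ↔ z ∈ FX a ∧ MvPolynomial.aeval (pt a z) h ≠ 0)
    {m : ℕ} (hm : ∀ a ∈ S, (T a).encard = m) (a : S) :
    ∃ ε > 0, (∀ z ∈ T a, ∀ w ∈ T a, nsq (z - w) < 4 * ε → z = w) ∧
      ∀ᶠ b : S in 𝓝 a, ∃ β : AlgebraicClosure R → AlgebraicClosure R,
        Set.BijOn β (T a) (T b) ∧ ∀ z ∈ T a, nsq (β z - z) < ε ∧ (β z ∈ FU b ↔ z ∈ FU a) := by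
  have hfin : ∀ a ∈ S, (T a).Finite := fun a ha => Set.finite_of_encard_eq_coe (hm a ha)
  obtain ⟨ε, hε, hsep⟩ := exists_separation (hfin a a.2)
  refine ⟨ε, hε, hsep, ?_⟩
  have hev : ∀ᶠ b : S in 𝓝 a, ∀ z ∈ T a, ∃ z' ∈ T b, nsq (z' - z) < ε ∧ (z' ∈ FU b ↔ z ∈ FU a) :=
    (eventually_all_finite (hfin a a.2)).2 fun z hz =>
      eventually_exists_near_mem_iff hX hU hUX hT a hz hε
  filter_upwards [hev] with b hb
  choose! β hβ using hb
  have hinj : Set.InjOn β (T a) := by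
    intro z hz w hw hzw
    refine hsep z hz w hw ?_
    have h1 := (hβ z hz).2.1
    have h2 := (hβ w hw).2.1
    rw [nsq_sub_comm] at h1 h2
    rw [← hzw] at h2
    linarith [nsq_sub_le z w (β z)]
  refine ⟨β, ⟨fun z hz => (hβ z hz).1, hinj, ?_⟩, fun z hz => (hβ z hz).2⟩
  have himage : β '' T a = T b :=
    ((hfin a a.2).image β).eq_of_subset_of_encard_le
      (Set.image_subset_iff.2 fun z hz => (hβ z hz).1)
      (by rw [hinj.encard_image, hm a a.2, hm b b.2])
  rw [Set.SurjOn, himage]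

theorem eventually_encard_diff_eq
    (hX : ∃ d D G, IsFiberPolynomial S FX d D G) (hU : ∃ d D G, IsFiberPolynomial S FU d D G)
    (hUX : ∀ a ∈ S, FU a ⊆ FX a)
    (hT : ∀ a ∈ S, ∀ z, z ∈ T a ↔ z ∈ FX a ∧ MvPolynomial.aeval (pt a z) h ≠ 0)
    {m : ℕ} (hm : ∀ a ∈ S, (T a).encard = m) (a : S) :
    ∀ᶠ b : S in 𝓝 a, (T b \ FU b).encard = (T a \ FU a).encard := by
  obtain ⟨ε, -, -, hev⟩ := exists_local_bijection hX hU hUX hT hm a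
  filter_upwards [hev] with b ⟨β, hβ, hβU⟩
  have : T b \ FU b = β '' (T a \ FU a) := by
    ext w
    constructor
    · rintro ⟨hw, hwU⟩
      obtain ⟨z, hz, rfl⟩ := hβ.surjOn hw
      exact ⟨z, ⟨hz, fun hzU => hwU ((hβU z hz).2.2 hzU)⟩, rfl⟩
    · rintro ⟨z, ⟨hz, hzU⟩, rfl⟩
      exact ⟨hβ.mapsTo hz, fun hw => hzU ((hβU z hz).2.1 hw)⟩
  rw [this, (hβ.injOn.mono Set.sdiff_subset).encard_image]

/-- Membership of a continuous section of `T` in `FU` is locally constant: by continuity the local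
bijection of the fibres follows the section. -/
theorem eventually_section_mem_iff
    (hX : ∃ d D G, IsFiberPolynomial S FX d D G) (hU : ∃ d D G, IsFiberPolynomial S FU d D G)
    (hUX : ∀ a ∈ S, FU a ⊆ FX a)
    (hT : ∀ a ∈ S, ∀ z, z ∈ T a ↔ z ∈ FX a ∧ MvPolynomial.aeval (pt a z) h ≠ 0)
    {m : ℕ} (hm : ∀ a ∈ S, (T a).encard = m) {s : S → R} (hs : Continuous s)
    (hsT : ∀ a : S, algebraMap R _ (s a) ∈ T a) (a : S) :
    ∀ᶠ b : S in 𝓝 a, (algebraMap R _ (s b) ∈ FU b ↔ algebraMap R _ (s a) ∈ FU a) := by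
  obtain ⟨ε, hε, hsep, hev⟩ := exists_local_bijection hX hU hUX hT hm a
  have hclose : ∀ᶠ b : S in 𝓝 a, (s b - s a) ^ 2 < ε := by
    have hc : Continuous fun b => (s b - s a) ^ 2 := (hs.sub continuous_const).pow 2
    refine hc.continuousAt.eventually_lt continuousAt_const ?_
    simpa using hε
  filter_upwards [hev, hclose] with b ⟨β, hβ, hβU⟩ hb
  obtain ⟨z, hz, hzb⟩ := hβ.surjOn (hsT b)
  have h1 := (hβU z hz).1
  have h2 : nsq (algebraMap R (AlgebraicClosure R) (s a) - β z) < ε := by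
    rwa [hzb, ← map_sub, nsq_algebraMap, ← neg_sub, neg_sq]
  rw [nsq_sub_comm] at h1
  have h3 : z = algebraMap R _ (s a) := hsep z hz _ (hsT a) (by
    linarith [nsq_sub_le z (algebraMap R (AlgebraicClosure R) (s a)) (β z)])
  rw [← hzb, (hβU z hz).2, h3]

end LocalBijection

/-! ### Semi-algebraic connectedness -/

section Connectedness

open Filter Topology

variable {R : Type*} [Field R] [LinearOrder R] [IsStrictOrderedRing R] [TopologicalSpace R]
  {σ : Type*}

/-- A semi-algebraic property which is locally constant on a semi-algebraically connected set is
constant. -/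
theorem IsSemialgebraicallyConnected.mem_of_mem {S : Set (σ → R)}
    (hSc : IsSemialgebraicallyConnected S) (hS : IsSemialgebraic S) {A : Set (σ → R)}
    (hA : IsSemialgebraic A)
    (hloc : ∀ a : S, ∀ᶠ b : S in 𝓝 a, ((b : σ → R) ∈ A ↔ (a : σ → R) ∈ A)) {a b : σ → R}
    (ha : a ∈ S) (hb : b ∈ S) (haA : a ∈ A) : b ∈ A := by
  have hopen : IsOpen ((↑) ⁻¹' A : Set S) := isOpen_iff_mem_nhds.2 fun c hc => by
    filter_upwards [hloc c] with d hd using hd.2 hc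
  have hopen' : IsOpen ((↑) ⁻¹' Aᶜ : Set S) := isOpen_iff_mem_nhds.2 fun c hc => by
    filter_upwards [hloc c] with d hd using fun h => hc (hd.1 h)
  have h1 : ((↑) ⁻¹' (S ∩ A) : Set S) = (↑) ⁻¹' A := by
    ext c
    exact ⟨fun h => h.2, fun h => ⟨c.2, h⟩⟩
  have h2 : ((↑) ⁻¹' (S \ A) : Set S) = (↑) ⁻¹' Aᶜ := by
    ext c
    exact ⟨fun h => h.2, fun h => ⟨c.2, h⟩⟩
  rcases hSc (S ∩ A) (S \ A) (hS.inter hA) (hS.diff hA)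
    (by rw [h1]; exact isOpen_compl_iff.1 hopen') (by rw [h2]; exact hopen.isClosed_compl)
    (Set.inter_union_sdiff S A)
    (Set.disjoint_left.2 fun c hc hc' => hc'.2 hc.2) with h | h
  · exact (h.subset ⟨ha, haA⟩).elim
  · by_contra hbA
    exact (h.subset ⟨hb, hbA⟩).elim

end Connectedness

/-! ### Semi-algebraic conditions on geometric fibres -/

section SemialgebraicFibres

variable {R : Type*} [Field R] [LinearOrder R] [IsStrictOrderedRing R] [IsRealClosed R] {n : ℕ}

/-- The geometric points of a basic constructible set, in real coordinates, form a semi-algebraic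
set. -/
theorem isSemialgebraic_geomFiber_locus (I : Ideal (MvPolynomial (Fin (n + 1)) R))
    (h : MvPolynomial (Fin (n + 1)) R) :
    IsSemialgebraic {p : Fin n ⊕ Fin 2 → R |
      cpx (p (.inr 0)) (p (.inr 1)) ∈ geomFiber (locus I h) (p ∘ Sum.inl)} := by
  obtain ⟨s, hs⟩ := (IsNoetherian.noetherian I : I.FG)
  choose F hF using exists_nsq_polynomial (R := R) (n := n)
  have hp : ∀ p : Fin n ⊕ Fin 2 → R, Sum.elim (p ∘ Sum.inl) ![p (.inr 0), p (.inr 1)] = p := by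
    intro p
    ext (i | i)
    · rfl
    · fin_cases i <;> rfl
  have hF' : ∀ f (p : Fin n ⊕ Fin 2 → R),
      MvPolynomial.aeval (pt (p ∘ Sum.inl) (cpx (p (.inr 0)) (p (.inr 1)))) f = 0 ↔
        MvPolynomial.eval p (F f) = 0 := by
    intro f p
    rw [← nsq_eq_zero, hF, hp]
  have hset : {p : Fin n ⊕ Fin 2 → R |
      cpx (p (.inr 0)) (p (.inr 1)) ∈ geomFiber (locus I h) (p ∘ Sum.inl)} =
      (⋂ f : s, {p | MvPolynomial.eval p (F f) = 0}) ∩ {p | MvPolynomial.eval p (F h) = 0}ᶜ := by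
    ext p
    change _ ∈ geomFiber (locus I h) (p ∘ Sum.inl) ↔ _
    rw [mem_geomFiber_locus]
    refine and_congr ?_ (not_congr (hF' h p))
    rw [Set.mem_iInter]
    constructor
    · exact fun hI f => (hF' f p).1 (hI f (hs ▸ Ideal.subset_span f.2))
    · intro hI f hf
      have : I ≤ RingHom.ker (MvPolynomial.aeval (pt (p ∘ Sum.inl)
          (cpx (p (.inr 0)) (p (.inr 1)))) : _ →ₐ[R] AlgebraicClosure R) := by
        rw [← hs, Ideal.span_le]
        exact fun f hf => (hF' f p).2 (hI ⟨f, hf⟩)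
      exact this hf
  rw [hset]
  exact (IsSemialgebraic.iInter fun f => isSemialgebraic_setOf_eval_eq_zero _).inter
    (isSemialgebraic_setOf_eval_eq_zero _).compl

theorem natCast_le_encard_iff {α : Type*} {A : Set α} {N : ℕ} :
    (N : ℕ∞) ≤ A.encard ↔ ∃ f : Fin N → α, Function.Injective f ∧ ∀ i, f i ∈ A := by
  constructor
  · intro h
    obtain ⟨B, hBA, hB⟩ := Set.exists_subset_encard_eq h
    have hfin := Set.finite_of_encard_eq_coe hB
    have := hfin.fintype
    have hcard : Fintype.card B = N := by
      rw [Set.encard_eq_coe_toFinset_card, Set.toFinset_card] at hB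
      exact_mod_cast hB
    let e := (Fintype.equivFinOfCardEq hcard).symm
    exact ⟨fun i => e i, Subtype.val_injective.comp e.injective, fun i => hBA (e i).2⟩
  · rintro ⟨f, hf, hfA⟩
    calc (N : ℕ∞) = (Set.range f).encard := by
          rw [← Set.image_univ, hf.encard_image, Set.encard_univ]
          simp
      _ ≤ A.encard := Set.encard_le_encard (Set.range_subset_iff.2 hfA)

/-- The cardinality of the geometric fibres of a difference of basic constructible sets is a
semi-algebraic condition. -/
theorem isSemialgebraic_le_encard_diff (I I' : Ideal (MvPolynomial (Fin (n + 1)) R))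
    (h h' : MvPolynomial (Fin (n + 1)) R) (N : ℕ) :
    IsSemialgebraic {a : Fin n → R |
      (N : ℕ∞) ≤ (geomFiber (locus I h) a \ geomFiber (locus I' h') a).encard} := by
  have hmem := (isSemialgebraic_geomFiber_locus I h).diff (isSemialgebraic_geomFiber_locus I' h')
  let g : Fin N → Fin n ⊕ Fin 2 → Fin n ⊕ (Fin N × Fin 2) := fun k => Sum.map id fun e => (k, e)
  -- the configurations of `N` distinct points in the fibre
  have hdist : ∀ k l : Fin N, IsSemialgebraic {p : Fin n ⊕ (Fin N × Fin 2) → R |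
      k ≠ l → ¬ (p (.inr (k, 0)) = p (.inr (l, 0)) ∧ p (.inr (k, 1)) = p (.inr (l, 1)))} := by
    intro k l
    by_cases hkl : k = l
    · convert (isSemialgebraic_setOf_eval_eq_zero
        (0 : MvPolynomial (Fin n ⊕ (Fin N × Fin 2)) R)) using 1
      ext p
      exact ⟨fun _ => map_zero _, fun _ h => absurd hkl h⟩
    · have key : ∀ e : Fin 2, IsSemialgebraic {p : Fin n ⊕ (Fin N × Fin 2) → R |
          p (.inr (k, e)) = p (.inr (l, e))} := by
        intro e
        convert isSemialgebraic_setOf_eval_eq_zero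
          (.X (.inr (k, e)) - .X (.inr (l, e)) : MvPolynomial (Fin n ⊕ (Fin N × Fin 2)) R) using 3
        rw [map_sub, MvPolynomial.eval_X, MvPolynomial.eval_X, sub_eq_zero]
      convert ((key 0).inter (key 1)).compl using 1
      ext p
      exact ⟨fun H => H hkl, fun H _ => H⟩
  have h1 : IsSemialgebraic ((⋂ k, {p : Fin n ⊕ (Fin N × Fin 2) → R | p ∘ g k ∈
      {p : Fin n ⊕ Fin 2 → R |
        cpx (p (.inr 0)) (p (.inr 1)) ∈ geomFiber (locus I h) (p ∘ Sum.inl)} \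
      {p : Fin n ⊕ Fin 2 → R |
        cpx (p (.inr 0)) (p (.inr 1)) ∈ geomFiber (locus I' h') (p ∘ Sum.inl)}}) ∩
      ⋂ k, ⋂ l, {p : Fin n ⊕ (Fin N × Fin 2) → R |
      k ≠ l → ¬ (p (.inr (k, 0)) = p (.inr (l, 0)) ∧ p (.inr (k, 1)) = p (.inr (l, 1)))}) :=
    (IsSemialgebraic.iInter fun k => hmem.preimage_comp (g k)).inter
      (IsSemialgebraic.iInter fun k => IsSemialgebraic.iInter fun l => hdist k l)
  convert h1.exists_sum using 1
  ext a
  refine natCast_le_encard_iff.trans ⟨?_, ?_⟩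
  · rintro ⟨f, hf, hfA⟩
    choose x y hxy using fun k => exists_cpx (f k)
    refine ⟨fun q => ![x q.1, y q.1] q.2, Set.mem_iInter.2 fun k => ?_,
      Set.mem_iInter.2 fun k => Set.mem_iInter.2 fun l hkl h0 => hkl (hf ?_)⟩
    · change cpx (x k) (y k) ∈ geomFiber (locus I h) a \ geomFiber (locus I' h') a
      rw [← hxy]
      exact hfA k
    · have h2 : x k = x l := h0.1
      have h3 : y k = y l := h0.2
      rw [hxy, hxy, h2, h3]
  · rintro ⟨t, ht, hne⟩
    refine ⟨fun k => cpx (t (k, 0)) (t (k, 1)), fun k l hkl => ?_, fun k => Set.mem_iInter.1 ht k⟩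
    by_contra hkl'
    have h2 := cpx_eq_zero ((cpx_sub _ _ _ _).symm.trans (sub_eq_zero.2 hkl))
    exact Set.mem_iInter.1 (Set.mem_iInter.1 hne k) l hkl' ⟨sub_eq_zero.1 h2.1, sub_eq_zero.1 h2.2⟩

end SemialgebraicFibres

/-! ### Sections over a semi-algebraically connected set -/

section Sections

open Filter Topology

variable {R : Type*} [Field R] {n : ℕ}

theorem point_algebraMap {σ : Type*} (t : σ → R) :
    (point (fun i => algebraMap R (AlgebraicClosure R) (t i)) :
      PrimeSpectrum (MvPolynomial σ R)) = point t := by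
  ext f
  change MvPolynomial.aeval (algebraMap R (AlgebraicClosure R) ∘ t) f = 0 ↔
    MvPolynomial.aeval t f = 0
  rw [MvPolynomial.aeval_algebraMap_apply,
    map_eq_zero_iff _ (algebraMap R (AlgebraicClosure R)).injective]

/-- The rational points of `T` are the rational points of its geometric fibres. -/
theorem point_mem_iff (T : Set (PrimeSpectrum (MvPolynomial (Fin (n + 1)) R)))
    (t : Fin (n + 1) → R) :
    point t ∈ T ↔ algebraMap R _ (t (Fin.last n)) ∈ geomFiber T (Fin.init (α := fun _ => R) t) := by
  rw [← point_algebraMap]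
  change _ ↔ point _ ∈ T
  convert Iff.rfl using 3
  ext i
  refine Fin.lastCases ?_ (fun i => ?_) i <;> simp [Fin.init]

section Order

variable [LinearOrder R] [IsStrictOrderedRing R] {S : Set (Fin n → R)}

theorem IsSemialgebraicMap.prod {τ τ' : Type*} {σ : S → (τ → R)} {σ' : S → (τ' → R)}
    (hσ : IsSemialgebraicMap σ) (hσ' : IsSemialgebraicMap σ') :
    IsSemialgebraicMap fun a => Sum.elim (σ a) (σ' a) := by
  unfold IsSemialgebraicMap at hσ hσ' ⊢
  convert (hσ.preimage_comp (Sum.map id Sum.inl : Fin n ⊕ τ → Fin n ⊕ (τ ⊕ τ'))).inter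
    (hσ'.preimage_comp (Sum.map id Sum.inr : Fin n ⊕ τ' → Fin n ⊕ (τ ⊕ τ'))) using 1
  ext p
  constructor
  · rintro ⟨a, rfl⟩
    refine ⟨⟨a, ?_⟩, ⟨a, ?_⟩⟩ <;> ext (i | i) <;> rfl
  · rintro ⟨⟨a, ha⟩, ⟨b, hb⟩⟩
    have hab : a = b := by
      refine Subtype.ext ?_
      ext i
      exact (congrFun ha (Sum.inl i)).symm.trans (congrFun hb (Sum.inl i))
    subst hab
    refine ⟨a, ?_⟩
    ext (i | i | i)
    · exact congrFun ha (Sum.inl i)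
    · exact congrFun ha (Sum.inr i)
    · exact congrFun hb (Sum.inr i)

variable [IsRealClosed R]

theorem IsSemialgebraicMap.isSemialgebraic_preimage {τ : Type*} [Finite τ] {σ : S → (τ → R)}
    (hσ : IsSemialgebraicMap σ) {Q : Set (τ → R)} (hQ : IsSemialgebraic Q) :
    IsSemialgebraic {a | ∃ h : a ∈ S, σ ⟨a, h⟩ ∈ Q} := by
  convert (hσ.inter (hQ.preimage_comp (Sum.inr : τ → Fin n ⊕ τ))).exists_sum using 1
  ext a
  constructor
  · rintro ⟨h, hQ⟩
    exact ⟨σ ⟨a, h⟩, ⟨⟨a, h⟩, rfl⟩, hQ⟩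
  · rintro ⟨t, ⟨b, hb⟩, hQ⟩
    have h1 : a = b := by simpa using congrArg (fun f => f ∘ Sum.inl) hb
    have h2 : t = σ b := by simpa using congrArg (fun f => f ∘ Sum.inr) hb
    subst h1
    exact ⟨b.2, h2 ▸ hQ⟩

theorem isSemialgebraic_point_mem_locus (I : Ideal (MvPolynomial (Fin (n + 1)) R))
    (h : MvPolynomial (Fin (n + 1)) R) :
    IsSemialgebraic {t : Fin (n + 1) → R | point t ∈ locus I h} := by
  have h1 := (isSemialgebraic_geomFiber_locus I h).preimage (σ := Fin (n + 1))
    (Sum.elim (fun i => .X i.castSucc) ![.X (Fin.last n), 0])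
  convert h1 using 1
  ext t
  refine (point_mem_iff (locus I h) t).trans ?_
  rw [← cpx_zero_right]
  change _ ↔ cpx (MvPolynomial.eval t (.X (Fin.last n))) (MvPolynomial.eval t 0) ∈
    geomFiber (locus I h) fun i => MvPolynomial.eval t (.X i.castSucc)
  simp only [MvPolynomial.eval_X, map_zero]
  rfl

end Order

variable [LinearOrder R] [TopologicalSpace R] {S : Set (Fin n → R)}

/-- A continuous semi-algebraic section over `S` of the projection forgetting the last
coordinate. -/
structure IsSection (σ : S → (Fin (n + 1) → R)) : Prop where
  semialgebraic : IsSemialgebraicMap σ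
  continuous : Continuous σ
  proj : ∀ a : S, Fin.init (α := fun _ => R) (σ a) = a

theorem StrictlyDelineates.isSection {k : ℕ}
    {T : Set (PrimeSpectrum (MvPolynomial (Fin (n + 1)) R))} {ξ : Fin k → S → (Fin (n + 1) → R)}
    (h : StrictlyDelineates T S ξ) (i : Fin k) : IsSection (ξ i) :=
  ⟨h.semialgebraic i, h.continuous i, h.proj i⟩

theorem IsSection.point_mem_iff {σ : S → (Fin (n + 1) → R)} (h : IsSection σ)
    (T : Set (PrimeSpectrum (MvPolynomial (Fin (n + 1)) R))) (a : S) :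
    point (σ a) ∈ T ↔ algebraMap R _ (σ a (Fin.last n)) ∈ geomFiber T a := by
  rw [GeomCAD.point_mem_iff, h.proj]

theorem IsSection.ext_last {σ τ : S → (Fin (n + 1) → R)} (hσ : IsSection σ) (hτ : IsSection τ)
    {a : S} (h : σ a (Fin.last n) = τ a (Fin.last n)) : σ a = τ a := by
  have h1 := (hσ.proj a).trans (hτ.proj a).symm
  rw [← Fin.snoc_init_self (α := fun _ => R) (σ a), ← Fin.snoc_init_self (α := fun _ => R) (τ a),
    h1, h]

theorem IsSection.disjoint_iff {σ τ : S → (Fin (n + 1) → R)} (hσ : IsSection σ)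
    (hτ : IsSection τ) : Disjoint (Set.range σ) (Set.range τ) ↔ ∀ a, σ a ≠ τ a := by
  rw [Set.disjoint_left]
  constructor
  · exact fun h a ha => h ⟨a, rfl⟩ ⟨a, ha.symm⟩
  · rintro h _ ⟨a, rfl⟩ ⟨b, hb⟩
    have : a = b := Subtype.ext (by rw [← hσ.proj a, ← hτ.proj b, hb])
    exact h a (by rw [← hb, this])

theorem IsSection.continuous_last {σ : S → (Fin (n + 1) → R)} (hσ : IsSection σ) :
    Continuous fun a => σ a (Fin.last n) := (continuous_apply _).comp hσ.continuous

variable [IsStrictOrderedRing R] [IsRealClosed R]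

/-- The coincidence set of two sections is semi-algebraic. -/
theorem IsSection.isSemialgebraic_eq {σ τ : S → (Fin (n + 1) → R)} (hσ : IsSection σ)
    (hτ : IsSection τ) : IsSemialgebraic {a | ∃ h : a ∈ S, σ ⟨a, h⟩ = τ ⟨a, h⟩} := by
  have hQ := isSemialgebraic_setOf_eval_eq_zero (R := R)
    (.X (.inl (Fin.last n)) - .X (.inr (Fin.last n)) :
      MvPolynomial (Fin (n + 1) ⊕ Fin (n + 1)) R)
  convert (hσ.semialgebraic.prod hτ.semialgebraic).isSemialgebraic_preimage hQ using 1
  ext a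
  refine exists_congr fun h => ?_
  change _ ↔ MvPolynomial.eval (Sum.elim (σ ⟨a, h⟩) (τ ⟨a, h⟩)) _ = 0
  rw [map_sub, MvPolynomial.eval_X, MvPolynomial.eval_X, sub_eq_zero]
  exact ⟨fun h => congrFun h _, fun h => hσ.ext_last hτ h⟩

theorem IsSection.isSemialgebraic_lt {σ τ : S → (Fin (n + 1) → R)} (hσ : IsSection σ)
    (hτ : IsSection τ) :
    IsSemialgebraic {a | ∃ h : a ∈ S, σ ⟨a, h⟩ (Fin.last n) < τ ⟨a, h⟩ (Fin.last n)} := by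
  have hQ := isSemialgebraic_setOf_eval_pos (R := R)
    (.X (.inr (Fin.last n)) - .X (.inl (Fin.last n)) :
      MvPolynomial (Fin (n + 1) ⊕ Fin (n + 1)) R)
  convert (hσ.semialgebraic.prod hτ.semialgebraic).isSemialgebraic_preimage hQ using 1
  ext a
  refine exists_congr fun h => ?_
  change _ ↔ 0 < MvPolynomial.eval (Sum.elim (σ ⟨a, h⟩) (τ ⟨a, h⟩)) _
  rw [map_sub, MvPolynomial.eval_X, MvPolynomial.eval_X, sub_pos]
  rfl

variable [OrderTopology R]

/-- A section whose values all lie on finitely many pairwise disjoint sections is one of them. -/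
theorem IsSection.exists_eq_of_covered (hSc : IsSemialgebraicallyConnected S)
    (hS : IsSemialgebraic S) {ι : Type*} [Finite ι] {σ : S → (Fin (n + 1) → R)}
    {τ : ι → S → (Fin (n + 1) → R)} (hσ : IsSection σ) (hτ : ∀ i, IsSection (τ i))
    (hdis : ∀ i j, i ≠ j → ∀ a, τ i a ≠ τ j a) (hcov : ∀ a, ∃ i, σ a = τ i a) {a₀ : S} {i : ι}
    (h₀ : σ a₀ = τ i a₀) : σ = τ i := by
  have hloc : ∀ a : S, ∀ᶠ b : S in 𝓝 a, (σ b = τ i b ↔ σ a = τ i a) := by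
    intro a
    have hne : ∀ j, σ a ≠ τ j a → ∀ᶠ b : S in 𝓝 a, σ b ≠ τ j b := fun j hj => by
      refine (hσ.continuous.continuousAt.prodMk (hτ j).continuous.continuousAt).eventually
        (p := fun p : (Fin (n + 1) → R) × (Fin (n + 1) → R) => p.1 ≠ p.2) ?_
      exact (isClosed_diagonal.isOpen_compl).mem_nhds hj
    by_cases hi : σ a = τ i a
    · have h1 : ∀ᶠ b : S in 𝓝 a, ∀ j, j ≠ i → σ b ≠ τ j b :=
        eventually_all.2 fun j => by
          by_cases hji : j = i
          · exact Eventually.of_forall fun b h => absurd hji h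
          · filter_upwards [hne j (by rw [hi]; exact hdis i j (Ne.symm hji) a)] with b hb _ using hb
      filter_upwards [h1] with b hb
      obtain ⟨j, hj⟩ := hcov b
      have hji : j = i := by
        by_contra hji
        exact hb j hji hj
      exact ⟨fun _ => hi, fun _ => hji ▸ hj⟩
    · filter_upwards [hne i hi] with b hb
      exact ⟨fun h => absurd h hb, fun h => absurd h hi⟩
  funext b
  have := hSc.mem_of_mem hS (hσ.isSemialgebraic_eq (hτ i)) (a := a₀) (b := b) (fun a => by
    filter_upwards [hloc a] with b hb
    exact ⟨fun ⟨_, h⟩ => ⟨a.2, hb.1 h⟩, fun ⟨_, h⟩ => ⟨b.2, hb.2 h⟩⟩) a₀.2 b.2 ⟨a₀.2, h₀⟩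
  exact this.2

/-- The vertical order of two disjoint sections is constant. -/
theorem IsSection.lt_of_lt (hSc : IsSemialgebraicallyConnected S)
    (hS : IsSemialgebraic S) {σ τ : S → (Fin (n + 1) → R)} (hσ : IsSection σ) (hτ : IsSection τ)
    (hdis : ∀ a, σ a ≠ τ a) {a₀ : S} (h₀ : σ a₀ (Fin.last n) < τ a₀ (Fin.last n)) (a : S) :
    σ a (Fin.last n) < τ a (Fin.last n) := by
  have hloc : ∀ a : S, ∀ᶠ b : S in 𝓝 a,
      (σ b (Fin.last n) < τ b (Fin.last n) ↔ σ a (Fin.last n) < τ a (Fin.last n)) := by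
    intro a
    rcases lt_trichotomy (σ a (Fin.last n)) (τ a (Fin.last n)) with h | h | h
    · filter_upwards [hσ.continuous_last.continuousAt.eventually_lt
        hτ.continuous_last.continuousAt h] with b hb
      exact ⟨fun _ => h, fun _ => hb⟩
    · exact absurd (hσ.ext_last hτ h) (hdis a)
    · filter_upwards [hτ.continuous_last.continuousAt.eventually_lt
        hσ.continuous_last.continuousAt h] with b hb
      exact ⟨fun h' => absurd h' hb.not_gt, fun h' => absurd h' h.not_gt⟩
  have := hSc.mem_of_mem hS (hσ.isSemialgebraic_lt hτ) (a := a₀) (b := a) (fun a => by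
    filter_upwards [hloc a] with b hb
    exact ⟨fun ⟨_, h⟩ => ⟨a.2, hb.1 h⟩, fun ⟨_, h⟩ => ⟨b.2, hb.2 h⟩⟩) a₀.2 a.2 ⟨a₀.2, h₀⟩
  exact this.2

/-- A finite set of sections, pairwise identical or disjoint, can be enumerated in ascending
order. -/
theorem exists_ascending_enumeration (hSc : IsSemialgebraicallyConnected S)
    (hS : IsSemialgebraic S) (hne : S.Nonempty) {F : Set (S → (Fin (n + 1) → R))} (hF : F.Finite)
    (hsec : ∀ σ ∈ F, IsSection σ) (hdis : ∀ σ ∈ F, ∀ τ ∈ F, σ ≠ τ → ∀ a, σ a ≠ τ a) :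
    ∃ (k : ℕ) (ξ : Fin k → S → (Fin (n + 1) → R)), Set.range ξ = F ∧
      ∀ a : S, StrictMono fun i => ξ i a (Fin.last n) := by
  obtain ⟨a₀, ha₀⟩ := hne
  let val : (S → (Fin (n + 1) → R)) → R := fun σ => σ ⟨a₀, ha₀⟩ (Fin.last n)
  have hinj : Set.InjOn val F := fun σ hσ τ hτ h => by
    by_contra hne
    exact hdis σ hσ τ hτ hne _ ((hsec σ hσ).ext_last (hsec τ hτ) h)
  let V : Finset R := (hF.image val).toFinset
  have hV : ∀ i, ∃ σ ∈ F, val σ = V.orderEmbOfFin rfl i := fun i => by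
    obtain ⟨σ, hσ, h⟩ := (hF.image val).mem_toFinset.1 (V.orderEmbOfFin_mem rfl i)
    exact ⟨σ, hσ, h⟩
  choose ξ hξF hξ using hV
  refine ⟨V.card, ξ, ?_, fun a i j hij => ?_⟩
  · refine Set.Subset.antisymm (Set.range_subset_iff.2 hξF) fun σ hσ => ?_
    have : val σ ∈ Set.range (V.orderEmbOfFin rfl) := by
      rw [Finset.range_orderEmbOfFin]
      exact (hF.image val).mem_toFinset.2 ⟨σ, hσ, rfl⟩
    obtain ⟨i, hi⟩ := this
    exact ⟨i, hinj (hξF i) hσ ((hξ i).trans hi)⟩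
  · have hlt : val (ξ i) < val (ξ j) := by
      rw [hξ, hξ]
      exact (V.orderEmbOfFin rfl).strictMono hij
    have hne : ξ i ≠ ξ j := fun h => hlt.ne (congrArg val h)
    exact (hsec _ (hξF i)).lt_of_lt hSc hS (hsec _ (hξF j))
      (hdis _ (hξF i) _ (hξF j) hne) hlt a

/-- A section of one delineated set and a section of another are identical or disjoint as soon as
the first lies on the second set whenever they meet. -/
theorem StrictlyDelineates.eq_or_disjoint (hSc : IsSemialgebraicallyConnected S)
    (hS : IsSemialgebraic S) {k l : ℕ} {T T' : Set (PrimeSpectrum (MvPolynomial (Fin (n + 1)) R))}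
    {ξ : Fin k → S → (Fin (n + 1) → R)} {τ : Fin l → S → (Fin (n + 1) → R)}
    (hξ : StrictlyDelineates T S ξ) (hτ : StrictlyDelineates T' S τ) (i : Fin k) (j : Fin l)
    (h : ∀ a, ξ i a = τ j a → ∀ b, point (ξ i b) ∈ T') :
    ξ i = τ j ∨ Disjoint (Set.range (ξ i)) (Set.range (τ j)) := by
  rw [(hξ.isSection i).disjoint_iff (hτ.isSection j), or_iff_not_imp_right]
  intro hmeet
  push Not at hmeet
  obtain ⟨a, ha⟩ := hmeet
  refine (hξ.isSection i).exists_eq_of_covered hSc hS hτ.isSection (fun j j' hjj a heq => ?_)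
    (fun b => ?_) ha
  · exact hjj ((hτ.ascending a).injective (congrFun heq (Fin.last n)))
  · have hb : Fin.init (α := fun _ => R) (ξ i b) ∈ S := by rw [hξ.proj]; exact b.2
    obtain ⟨j', hj', -⟩ := hτ.cover (ξ i b) (h a ha b) hb
    refine ⟨j', hj'.trans ?_⟩
    congr 1
    exact Subtype.ext (hξ.proj i b)

end Sections

/-! ### Delineations in normal form -/

section NormalForm

variable {R : Type*} [Field R] {n : ℕ}

theorem geomFiber_zeroLocus_singleton (g : MvPolynomial (Fin (n + 1)) R) (a : Fin n → R) :
    geomFiber (PrimeSpectrum.zeroLocus {g}) a =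
      (geomFiber (PrimeSpectrum.basicOpen g : Set (PrimeSpectrum (MvPolynomial _ R))) a)ᶜ := by
  ext z
  change (∀ f ∈ ({g} : Set _), MvPolynomial.aeval _ f = 0) ↔ ¬ (MvPolynomial.aeval _ g ≠ 0)
  simp

theorem geomFiber_union (T T' : Set (PrimeSpectrum (MvPolynomial (Fin (n + 1)) R)))
    (a : Fin n → R) : geomFiber (T ∪ T') a = geomFiber T a ∪ geomFiber T' a := rfl

/-- A set whose geometric fibre over `a` is cofinite agrees over `a` with a distinguished open
set: a polynomial vanishing on that fibre vanishes on the whole line over `a`. -/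
theorem geomFiber_locus_of_finite_compl {I : Ideal (MvPolynomial (Fin (n + 1)) R)}
    {h : MvPolynomial (Fin (n + 1)) R} {a : Fin n → R} (hfin : (geomFiber (locus I h) a)ᶜ.Finite) :
    geomFiber (locus I h) a =
      geomFiber (PrimeSpectrum.basicOpen h : Set (PrimeSpectrum (MvPolynomial _ R))) a := by
  refine Set.Subset.antisymm (fun z hz => hz.2) fun z hz => ⟨fun f hf => ?_, hz⟩
  let P : Polynomial (AlgebraicClosure R) :=
    MvPolynomial.aeval (Fin.snoc (α := fun _ => Polynomial (AlgebraicClosure R))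
      (fun i => Polynomial.C (algebraMap R _ (a i))) Polynomial.X) f
  have hP : ∀ z, MvPolynomial.aeval (pt a z) f = P.eval z := by
    intro z
    have h1 := MvPolynomial.comp_aeval_apply (R := R)
      (Fin.snoc (α := fun _ => Polynomial (AlgebraicClosure R))
        (fun i => Polynomial.C (algebraMap R _ (a i))) Polynomial.X)
      ((Polynomial.aeval z : Polynomial (AlgebraicClosure R) →ₐ[_] _).restrictScalars R) f
    have h2 : P.eval z = ((Polynomial.aeval z :
        Polynomial (AlgebraicClosure R) →ₐ[_] _).restrictScalars R) P :=
      by simp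
    rw [h2, h1]
    congr 2
    ext i
    refine Fin.lastCases ?_ (fun i => ?_) i <;> simp [pt]
  have hP0 : P = 0 := by
    refine Polynomial.eq_zero_of_infinite_isRoot P (hfin.infinite_compl.mono ?_)
    rw [compl_compl]
    exact fun z hz => (hP z).symm.trans ((mem_geomFiber_locus.1 hz).1 f hf)
  exact (hP z).trans (by rw [hP0, Polynomial.eval_zero])

theorem IsFiberPolynomial.finite {S : Set (Fin n → R)}
    {F : (Fin n → R) → Set (AlgebraicClosure R)} {d : ℕ} {D : MvPolynomial (Fin n) R}
    {G : Polynomial (MvPolynomial (Fin n) R)} (hF : IsFiberPolynomial S F d D G) {a : Fin n → R}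
    (ha : a ∈ S) : (F a).Finite := by
  obtain ⟨-, P, hP, -, -, hPF⟩ := hF a ha
  refine (P.rootSet_finite (AlgebraicClosure R)).subset fun z hz => ?_
  exact (Polynomial.mem_rootSet_of_ne hP.ne_zero).2 ((hPF z).2 hz)

theorem geomFiber_locus_sup_subset (I I' : Ideal (MvPolynomial (Fin (n + 1)) R))
    (h' : MvPolynomial (Fin (n + 1)) R) (a : Fin n → R) :
    geomFiber (locus (I ⊔ I') h') a ⊆ geomFiber (locus I 1) a := fun z hz =>
  mem_geomFiber_locus.2 ⟨fun f hf => (mem_geomFiber_locus.1 hz).1 f (Ideal.mem_sup_left hf),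
    by rw [map_one]; exact one_ne_zero⟩

theorem mem_geomFiber_locus_iff_one {I : Ideal (MvPolynomial (Fin (n + 1)) R)}
    {h : MvPolynomial (Fin (n + 1)) R} {a : Fin n → R} {z : AlgebraicClosure R} :
    z ∈ geomFiber (locus I h) a ↔
      z ∈ geomFiber (locus I 1) a ∧ MvPolynomial.aeval (pt a z) h ≠ 0 := by
  simp [mem_geomFiber_locus]

theorem mem_geomFiber_locus_sup_iff {I I' : Ideal (MvPolynomial (Fin (n + 1)) R)}
    {h h' : MvPolynomial (Fin (n + 1)) R} {a : Fin n → R} {z : AlgebraicClosure R}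
    (hz : z ∈ geomFiber (locus I h) a) :
    z ∈ geomFiber (locus (I ⊔ I') h') a ↔ z ∈ geomFiber (locus I' h') a := by
  rw [mem_geomFiber_locus, mem_geomFiber_locus]
  refine and_congr_left fun _ => ⟨fun H f hf => H f (Ideal.mem_sup_right hf), fun H f hf => ?_⟩
  have : I ⊔ I' ≤ RingHom.ker (MvPolynomial.aeval (pt a z) : _ →ₐ[R] AlgebraicClosure R) :=
    sup_le (fun f hf => (mem_geomFiber_locus.1 hz).1 f hf) H
  exact this hf

theorem not_finite_compl_of_finite {A : Set (AlgebraicClosure R)} (hA : A.Finite) :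
    ¬ Aᶜ.Finite := fun h => hA.infinite_compl h

variable [LinearOrder R] [TopologicalSpace R] {S : Set (Fin n → R)}
  {T T' : Set (PrimeSpectrum (MvPolynomial (Fin (n + 1)) R))}

theorem StrictlyDelineates.finite {k : ℕ} {ξ : Fin k → S → (Fin (n + 1) → R)}
    (h : StrictlyDelineates T S ξ) {a : Fin n → R} (ha : a ∈ S) : (geomFiber T a).Finite := by
  obtain ⟨m, hm⟩ := h.card_fiber
  exact Set.finite_of_encard_eq_coe (hm a ha)

/-- Whichever alternative of the definition holds, the sections strictly delineate some set, which
agrees over `S` with `T` or with its complement. -/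
theorem Delineates.exists_strictlyDelineates {k : ℕ} {ξ : Fin k → S → (Fin (n + 1) → R)}
    (h : Delineates T S ξ) : ∃ T₁, StrictlyDelineates T₁ S ξ ∧
      ((∀ a ∈ S, geomFiber T₁ a = geomFiber T a) ∨
        ∀ a ∈ S, geomFiber T₁ a = (geomFiber T a)ᶜ) := by
  obtain h | ⟨g, hg, h⟩ := h
  · exact ⟨T, h, .inl fun _ _ => rfl⟩
  · refine ⟨_, h, .inr fun a ha => ?_⟩
    rw [hg a ha, geomFiber_zeroLocus_singleton]

/-- `V(I)` and `V(I + I') ∩ D(h')` have fibre polynomials over `S`. -/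
structure HasFiberPolynomials (S : Set (Fin n → R)) (I I' : Ideal (MvPolynomial (Fin (n + 1)) R))
    (h' : MvPolynomial (Fin (n + 1)) R) : Prop where
  left : ∃ d D G, IsFiberPolynomial S (fun a => geomFiber (locus I 1) a) d D G
  inf : ∃ d D G, IsFiberPolynomial S (fun a => geomFiber (locus (I ⊔ I') h') a) d D G

/-- The fibres of `V(I) ∩ D(h)` are finite, so the convention for cofinite fibres does not apply. -/
theorem Delineates.exists_eq_fiber {I I' : Ideal (MvPolynomial (Fin (n + 1)) R)}
    {h h' : MvPolynomial (Fin (n + 1)) R} (hP : HasFiberPolynomials S I I' h') {k : ℕ}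
    {ξ : Fin k → S → (Fin (n + 1) → R)} (hξ : Delineates (locus I h) S ξ) :
    ∃ T₁, StrictlyDelineates T₁ S ξ ∧ ∀ a ∈ S, geomFiber T₁ a = geomFiber (locus I h) a := by
  obtain ⟨T₁, h1, h1'⟩ := hξ.exists_strictlyDelineates
  refine ⟨T₁, h1, fun a ha => h1'.elim (fun H => H a ha) fun H => ?_⟩
  obtain ⟨_, _, _, hX⟩ := hP.left
  refine (not_finite_compl_of_finite ((hX.finite ha).subset fun z hz =>
    (mem_geomFiber_locus_iff_one.1 hz).1 : (geomFiber (locus I h) a).Finite) ?_).elim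
  rw [← H a ha]
  exact h1.finite ha

/-- Any two delineations of `T` strictly delineate sets with the same fibres over `S`. -/
theorem Delineates.exists_strictlyDelineates_pair {k l : ℕ} {ξ : Fin k → S → (Fin (n + 1) → R)}
    {τ : Fin l → S → (Fin (n + 1) → R)} (hξ : Delineates T S ξ) (hτ : Delineates T S τ) :
    ∃ T₁ T₂, StrictlyDelineates T₁ S ξ ∧ StrictlyDelineates T₂ S τ ∧
      ∀ a ∈ S, geomFiber T₁ a = geomFiber T₂ a := by
  obtain ⟨T₁, h1, h1'⟩ := hξ.exists_strictlyDelineates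
  obtain ⟨T₂, h2, h2'⟩ := hτ.exists_strictlyDelineates
  refine ⟨T₁, T₂, h1, h2, fun a ha => ?_⟩
  rcases h1' with h1' | h1' <;> rcases h2' with h2' | h2'
  · rw [h1' a ha, h2' a ha]
  · refine (not_finite_compl_of_finite (h1.finite ha) ?_).elim
    rw [h1' a ha, ← h2' a ha]
    exact h2.finite ha
  · refine (not_finite_compl_of_finite (h2.finite ha) ?_).elim
    rw [h2' a ha, ← h1' a ha]
    exact h1.finite ha
  · rw [h1' a ha, h2' a ha]

theorem StrictlyDelineates.point_mem_of_fiber_eq {k : ℕ} {ξ : Fin k → S → (Fin (n + 1) → R)}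
    {T T₁ : Set (PrimeSpectrum (MvPolynomial (Fin (n + 1)) R))} (hξ : StrictlyDelineates T₁ S ξ)
    (hT : ∀ a ∈ S, geomFiber T₁ a = geomFiber T a) (i : Fin k) (a : S) : point (ξ i a) ∈ T := by
  rw [(hξ.isSection i).point_mem_iff, ← hT a a.2, ← (hξ.isSection i).point_mem_iff]
  exact hξ.mem i a

/-- The rational points of a set with the fibres of a strictly delineated one lie on its
sections. -/
theorem StrictlyDelineates.exists_eq_of_fiber_eq {k : ℕ} {ξ : Fin k → S → (Fin (n + 1) → R)}
    {T₁ : Set (PrimeSpectrum (MvPolynomial (Fin (n + 1)) R))} (hξ : StrictlyDelineates T₁ S ξ)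
    {t : Fin (n + 1) → R} (ht : Fin.init (α := fun _ => R) t ∈ S)
    (htT : algebraMap R _ (t (Fin.last n)) ∈ geomFiber T₁ (Fin.init (α := fun _ => R) t)) :
    ∃ i, t = ξ i ⟨Fin.init (α := fun _ => R) t, ht⟩ :=
  (hξ.cover t ((point_mem_iff T₁ t).2 htT) ht).exists

theorem geomDelineable_empty (T : Set (PrimeSpectrum (MvPolynomial (Fin (n + 1)) R))) :
    GeomDelineable T (∅ : Set (Fin n → R)) :=
  ⟨0, fun i => i.elim0, .inl
    { card_fiber := ⟨0, fun _ h => h.elim⟩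
      semialgebraic := fun i => i.elim0
      continuous := fun i => i.elim0
      mem := fun i => i.elim0
      proj := fun i => i.elim0
      ascending := fun a => a.2.elim
      cover := fun _ _ h => h.elim }⟩

variable [IsStrictOrderedRing R] [IsRealClosed R] [OrderTopology R]

/-- Two sections of the same set are identical or disjoint. -/
theorem sections_eq_or_disjoint (hSc : IsSemialgebraicallyConnected S) (hS : IsSemialgebraic S)
    {σ τ : S → (Fin (n + 1) → R)} (hσ : σ ∈ sections T S) (hτ : τ ∈ sections T S) :
    σ = τ ∨ Disjoint (Set.range σ) (Set.range τ) := by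
  obtain ⟨k, ξ, hξ, i, rfl⟩ := hσ
  obtain ⟨l, τ, hτ, j, rfl⟩ := hτ
  obtain ⟨T₁, T₂, h1, h2, h12⟩ := hξ.exists_strictlyDelineates_pair hτ
  refine h1.eq_or_disjoint hSc hS h2 i j fun _ _ b => ?_
  have := h1.mem i b
  rw [(h1.isSection i).point_mem_iff, h12 b b.2] at this
  exact ((h1.isSection i).point_mem_iff T₂ b).2 this

/-- A finite set of pairwise disjoint sections through all rational points of `T` over `S`
delineates `T`. -/
theorem exists_strictlyDelineates (hSc : IsSemialgebraicallyConnected S) (hS : IsSemialgebraic S)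
    (hne : S.Nonempty) (hcard : ∃ m : ℕ, ∀ a ∈ S, (geomFiber T a).encard = m)
    {F : Set (S → (Fin (n + 1) → R))} (hF : F.Finite) (hsec : ∀ σ ∈ F, IsSection σ)
    (hdis : ∀ σ ∈ F, ∀ τ ∈ F, σ = τ ∨ Disjoint (Set.range σ) (Set.range τ))
    (hmem : ∀ σ ∈ F, ∀ a, point (σ a) ∈ T)
    (hcov : ∀ t : Fin (n + 1) → R, point t ∈ T → ∀ ht : Fin.init (α := fun _ => R) t ∈ S,
      ∃ σ ∈ F, t = σ ⟨Fin.init (α := fun _ => R) t, ht⟩) :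
    ∃ (k : ℕ) (ξ : Fin k → S → (Fin (n + 1) → R)), StrictlyDelineates T S ξ := by
  obtain ⟨k, ξ, hξF, hξ⟩ := exists_ascending_enumeration hSc hS hne hF hsec
    fun σ hσ τ hτ hne => ((hsec σ hσ).disjoint_iff (hsec τ hτ)).1
      ((hdis σ hσ τ hτ).resolve_left hne)
  have hξ' : ∀ i, ξ i ∈ F := fun i => hξF ▸ Set.mem_range_self i
  refine ⟨k, ξ, hcard, fun i => (hsec _ (hξ' i)).semialgebraic,
    fun i => (hsec _ (hξ' i)).continuous, fun i => hmem _ (hξ' i), fun i => (hsec _ (hξ' i)).proj,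
    hξ, fun t ht htS => ?_⟩
  obtain ⟨σ, hσ, h⟩ := hcov t ht htS
  rw [← hξF] at hσ
  obtain ⟨i, rfl⟩ := hσ
  exact ⟨i, h, fun j hj => (hξ _).injective (congrFun (hj.symm.trans h) (Fin.last n))⟩

end NormalForm

/-! ### Merging the sections of two sets -/

section Merging

open Filter Topology

variable {R : Type*} [Field R] {n : ℕ} [LinearOrder R] [IsStrictOrderedRing R] [IsRealClosed R]
  [TopologicalSpace R] [OrderTopology R] {S : Set (Fin n → R)}
  {I I' : Ideal (MvPolynomial (Fin (n + 1)) R)} {h h' : MvPolynomial (Fin (n + 1)) R}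

/-- A section of `V(I) ∩ D(h)` which meets `V(I') ∩ D(h')` lies on it. -/
theorem IsSection.point_mem_of_point_mem (hSc : IsSemialgebraicallyConnected S)
    (hS : IsSemialgebraic S) (hP : HasFiberPolynomials S I I' h')
    (hm : ∃ m : ℕ, ∀ a ∈ S, (geomFiber (locus I h) a).encard = m) {σ : S → (Fin (n + 1) → R)}
    (hσ : IsSection σ) (hσT : ∀ a, point (σ a) ∈ locus I h) {a : S}
    (ha : point (σ a) ∈ locus I' h') (b : S) : point (σ b) ∈ locus I' h' := by
  obtain ⟨m, hm⟩ := hm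
  have hσT' : ∀ a : S, algebraMap R _ (σ a (Fin.last n)) ∈ geomFiber (locus I h) a :=
    fun a => (hσ.point_mem_iff _ a).1 (hσT a)
  have hiff : ∀ a : S, point (σ a) ∈ locus I' h' ↔
      algebraMap R _ (σ a (Fin.last n)) ∈ geomFiber (locus (I ⊔ I') h') a := fun a => by
    rw [hσ.point_mem_iff, mem_geomFiber_locus_sup_iff (hσT' a)]
  have := hSc.mem_of_mem hS
    (hσ.semialgebraic.isSemialgebraic_preimage (isSemialgebraic_point_mem_locus I' h'))
    (fun a => by
      filter_upwards [eventually_section_mem_iff hP.left hP.inf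
        (fun a _ => geomFiber_locus_sup_subset I I' h' a)
        (fun a _ z => mem_geomFiber_locus_iff_one) hm hσ.continuous_last hσT' a] with b hb
      rw [← hiff, ← hiff] at hb
      exact ⟨fun ⟨_, h⟩ => ⟨a.2, hb.1 h⟩, fun ⟨_, h⟩ => ⟨b.2, hb.2 h⟩⟩) a.2 b.2 ⟨a.2, ha⟩
  exact this.2

/-- The cardinality of the fibres of `(V(I) ∩ D(h)) \ (V(I') ∩ D(h'))` is constant. -/
theorem exists_encard_diff_eq (hSc : IsSemialgebraicallyConnected S)
    (hS : IsSemialgebraic S) (hP : HasFiberPolynomials S I I' h')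
    (hm : ∃ m : ℕ, ∀ a ∈ S, (geomFiber (locus I h) a).encard = m) (hne : S.Nonempty) :
    ∃ c : ℕ, ∀ a ∈ S, (geomFiber (locus I h) a \ geomFiber (locus I' h') a).encard = c := by
  obtain ⟨m, hm⟩ := hm
  have hdiff : ∀ a, geomFiber (locus I h) a \ geomFiber (locus (I ⊔ I') h') a =
      geomFiber (locus I h) a \ geomFiber (locus I' h') a := fun a => by
    ext z
    exact and_congr_right fun hz => not_congr (mem_geomFiber_locus_sup_iff hz)
  have hle : ∀ a ∈ S, ∀ b ∈ S, (geomFiber (locus I h) a \ geomFiber (locus I' h') a).encard ≤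
      (geomFiber (locus I h) b \ geomFiber (locus I' h') b).encard := by
    intro a ha b hb
    refine ENat.forall_natCast_le_iff_le.1 fun N hN => ?_
    refine hSc.mem_of_mem hS (isSemialgebraic_le_encard_diff I I' h h' N) (fun a => ?_) ha hb hN
    filter_upwards [eventually_encard_diff_eq hP.left hP.inf
      (fun a _ => geomFiber_locus_sup_subset I I' h' a)
      (fun a _ z => mem_geomFiber_locus_iff_one) hm a] with b hb
    rw [hdiff, hdiff] at hb
    rw [hb]
  obtain ⟨a₀, ha₀⟩ := hne
  have hfin : (geomFiber (locus I h) a₀ \ geomFiber (locus I' h') a₀).Finite :=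
    (Set.finite_of_encard_eq_coe (hm a₀ ha₀)).sdiff
  refine ⟨_, fun a ha => Eq.trans ?_ hfin.encard_eq_coe_toFinset_card⟩
  exact (hle a ha a₀ ha₀).antisymm (hle a₀ ha₀ a ha)

/-- A section of `V(I) ∩ D(h)` and a section of `V(I') ∩ D(h')` are identical or disjoint. -/
theorem eq_or_disjoint_of_delineates (hSc : IsSemialgebraicallyConnected S)
    (hS : IsSemialgebraic S) (hP : HasFiberPolynomials S I I' h') {k l : ℕ}
    {ξ : Fin k → S → (Fin (n + 1) → R)} {τ : Fin l → S → (Fin (n + 1) → R)}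
    (hξ : Delineates (locus I h) S ξ) (hτ : Delineates (locus I' h') S τ) (i : Fin k) (j : Fin l) :
    ξ i = τ j ∨ Disjoint (Set.range (ξ i)) (Set.range (τ j)) := by
  obtain ⟨T₁, h1, hT₁⟩ := hξ.exists_eq_fiber hP
  obtain ⟨T₂, h2, hT₂⟩ := hτ.exists_strictlyDelineates
  have hm : ∃ m : ℕ, ∀ a ∈ S, (geomFiber (locus I h) a).encard = m :=
    h1.card_fiber.imp fun m hm a ha => by rw [← hT₁ a ha, hm a ha]
  have hsec := h1.isSection i
  refine h1.eq_or_disjoint hSc hS h2 i j fun a ha b => ?_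
  have haT : point (ξ i a) ∈ T₂ := ha ▸ h2.mem j a
  have hmem := h1.point_mem_of_fiber_eq hT₁ i
  rcases hT₂ with hT₂ | hT₂
  · rw [hsec.point_mem_iff, hT₂ _ (Subtype.mem _), ← hsec.point_mem_iff] at haT ⊢
    exact hsec.point_mem_of_point_mem hSc hS hP hm hmem haT b
  · rw [hsec.point_mem_iff, hT₂ _ (Subtype.mem _), Set.mem_compl_iff, ← hsec.point_mem_iff]
      at haT ⊢
    exact fun hb => haT (hsec.point_mem_of_point_mem hSc hS hP hm hmem hb a)

/-- If both sets have finite fibres, the sections of both together delineate the union. -/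
theorem geomDelineable_union_of_finite (hSc : IsSemialgebraicallyConnected S)
    (hS : IsSemialgebraic S) (hne : S.Nonempty) (hP : HasFiberPolynomials S I I' h') {k l : ℕ}
    {ξ : Fin k → S → (Fin (n + 1) → R)} {τ : Fin l → S → (Fin (n + 1) → R)}
    {T₁ T₂ : Set (PrimeSpectrum (MvPolynomial (Fin (n + 1)) R))}
    (hξ : StrictlyDelineates T₁ S ξ) (hT₁ : ∀ a ∈ S, geomFiber T₁ a = geomFiber (locus I h) a)
    (hτ : StrictlyDelineates T₂ S τ) (hT₂ : ∀ a ∈ S, geomFiber T₂ a = geomFiber (locus I' h') a)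
    (hdis : ∀ σ ∈ Set.range ξ ∪ Set.range τ, ∀ ρ ∈ Set.range ξ ∪ Set.range τ,
      σ = ρ ∨ Disjoint (Set.range σ) (Set.range ρ)) :
    GeomDelineable (locus I h ∪ locus I' h') S := by
  obtain ⟨c, hc⟩ := exists_encard_diff_eq (h := h) hSc hS hP
    (hξ.card_fiber.imp fun m hm a ha => by rw [← hT₁ a ha, hm a ha]) hne
  obtain ⟨m, hm⟩ := hτ.card_fiber
  have hcard : ∀ a ∈ S, (geomFiber (locus I h ∪ locus I' h') a).encard = (c + m : ℕ) := by
    intro a ha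
    rw [geomFiber_union, ← Set.sdiff_union_self, Set.encard_union_eq Set.disjoint_sdiff_left,
      hc a ha, ← hT₂ a ha, hm a ha, Nat.cast_add]
  obtain ⟨r, ζ, hζ⟩ := exists_strictlyDelineates hSc hS hne ⟨_, hcard⟩
    ((Set.finite_range ξ).union (Set.finite_range τ)) (by
      rintro _ (⟨i, rfl⟩ | ⟨j, rfl⟩)
      exacts [hξ.isSection i, hτ.isSection j]) hdis (by
      rintro _ (⟨i, rfl⟩ | ⟨j, rfl⟩) a
      exacts [.inl (hξ.point_mem_of_fiber_eq hT₁ i a), .inr (hτ.point_mem_of_fiber_eq hT₂ j a)])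
    fun t ht htS => by
      rcases ht with ht | ht <;> rw [point_mem_iff] at ht
      · rw [← hT₁ _ htS] at ht
        obtain ⟨i, hi⟩ := hξ.exists_eq_of_fiber_eq htS ht
        exact ⟨ξ i, .inl ⟨i, rfl⟩, hi⟩
      · rw [← hT₂ _ htS] at ht
        obtain ⟨i, hi⟩ := hτ.exists_eq_of_fiber_eq htS ht
        exact ⟨τ i, .inr ⟨i, rfl⟩, hi⟩
  exact ⟨r, ζ, .inl hζ⟩

/-- If the second set has cofinite fibres, the complement of the union is delineated by those of
its sections which are not sections of the first set. -/
theorem geomDelineable_union_of_cofinite (hSc : IsSemialgebraicallyConnected S)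
    (hS : IsSemialgebraic S) (hne : S.Nonempty) (hP : HasFiberPolynomials S I I' h') {k l : ℕ}
    {ξ : Fin k → S → (Fin (n + 1) → R)} {τ : Fin l → S → (Fin (n + 1) → R)}
    {T₁ T₂ : Set (PrimeSpectrum (MvPolynomial (Fin (n + 1)) R))}
    (hξ : StrictlyDelineates T₁ S ξ) (hT₁ : ∀ a ∈ S, geomFiber T₁ a = geomFiber (locus I h) a)
    (hτ : StrictlyDelineates T₂ S τ)
    (hT₂ : ∀ a ∈ S, geomFiber T₂ a = (geomFiber (locus I' h') a)ᶜ)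
    (hdis : ∀ σ ∈ Set.range ξ ∪ Set.range τ, ∀ ρ ∈ Set.range ξ ∪ Set.range τ,
      σ = ρ ∨ Disjoint (Set.range σ) (Set.range ρ))
    (hU : IsBasicConstructible (locus I h ∪ locus I' h')) :
    GeomDelineable (locus I h ∪ locus I' h') S := by
  obtain ⟨c, hc⟩ := exists_encard_diff_eq (h := h) hSc hS hP
    (hξ.card_fiber.imp fun m hm a ha => by rw [← hT₁ a ha, hm a ha]) hne
  obtain ⟨m, hm⟩ := hτ.card_fiber
  obtain ⟨I'', g, hg⟩ := hU
  have hcompl : ∀ a ∈ S, (geomFiber (locus I h ∪ locus I' h') a)ᶜ =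
      geomFiber T₂ a \ geomFiber T₁ a := by
    intro a ha
    rw [geomFiber_union, Set.compl_union, hT₂ a ha, hT₁ a ha, Set.inter_comm]
    rfl
  have hfib : ∀ a ∈ S, geomFiber (locus I h ∪ locus I' h') a =
      geomFiber (PrimeSpectrum.basicOpen g : Set (PrimeSpectrum (MvPolynomial _ R))) a := by
    intro a ha
    have hfin := (hτ.finite ha).sdiff (t := geomFiber T₁ a)
    rw [← hcompl a ha, hg] at hfin
    rw [hg, geomFiber_locus_of_finite_compl hfin]
  have hzero : ∀ a ∈ S, geomFiber (PrimeSpectrum.zeroLocus {g}) a =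
      geomFiber T₂ a \ geomFiber T₁ a := by
    intro a ha
    rw [geomFiber_zeroLocus_singleton, ← hfib a ha, hcompl a ha]
  have hcard : ∀ a ∈ S, (geomFiber (PrimeSpectrum.zeroLocus {g}) a).encard = (m - c : ℕ) := by
    intro a ha
    -- the fibre of `T₁` is cut out of that of `T₂` in a set of constant cardinality `c`
    have hinter : geomFiber T₂ a ∩ geomFiber T₁ a =
        geomFiber (locus I h) a \ geomFiber (locus I' h') a := by
      rw [hT₂ a ha, hT₁ a ha, Set.inter_comm]
      rfl
    have hsum := Set.encard_sdiff_add_encard_inter (geomFiber T₂ a) (geomFiber T₁ a)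
    have hfin := (hτ.finite ha).sdiff (t := geomFiber T₁ a)
    rw [hinter, hc a ha, hm a ha, ← hzero a ha] at hsum
    rw [← hzero a ha] at hfin
    rw [hfin.encard_eq_coe_toFinset_card] at hsum ⊢
    norm_cast at hsum ⊢
    omega
  have hT₁mem : ∀ i a, point (ξ i a) ∈ locus I h := hξ.point_mem_of_fiber_eq hT₁
  obtain ⟨r, ζ, hζ⟩ := exists_strictlyDelineates (T := PrimeSpectrum.zeroLocus {g}) hSc hS hne
    ⟨_, hcard⟩ ((Set.finite_range τ).sdiff (t := Set.range ξ)) (by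
      rintro _ ⟨⟨j, rfl⟩, -⟩
      exact hτ.isSection j)
    (fun σ hσ ρ hρ => hdis σ (.inr hσ.1) ρ (.inr hρ.1)) (by
      rintro _ ⟨⟨j, rfl⟩, hj⟩ a
      rw [(hτ.isSection j).point_mem_iff, hzero a a.2]
      refine ⟨((hτ.isSection j).point_mem_iff _ a).1 (hτ.mem j a), fun hmem => hj ?_⟩
      -- a section of `T₂` meeting `T₁` meets, hence is, a section of `T₁`
      rw [← (hτ.isSection j).point_mem_iff] at hmem
      have ha : Fin.init (α := fun _ => R) (τ j a) ∈ S := by rw [hτ.proj]; exact a.2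
      obtain ⟨i, hi, -⟩ := hξ.cover (τ j a) hmem ha
      refine ⟨i, (hdis _ (.inl ⟨i, rfl⟩) _ (.inr ⟨j, rfl⟩)).resolve_right fun hd => ?_⟩
      exact Set.disjoint_left.1 hd ⟨_, rfl⟩ ⟨a, hi⟩)
    fun t ht htS => by
      rw [point_mem_iff, hzero _ htS] at ht
      obtain ⟨j, hj⟩ := hτ.exists_eq_of_fiber_eq htS ht.1
      refine ⟨τ j, ⟨⟨j, rfl⟩, ?_⟩, hj⟩
      rintro ⟨i, hi⟩
      refine ht.2 ?_
      rw [← point_mem_iff, hj, ← hi]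
      exact hξ.mem i _
  exact ⟨r, ζ, .inr ⟨g, hfib, hζ⟩⟩

end Merging

end GeomCAD

theorem mainTheorem10 {R : Type*} [Field R] [LinearOrder R] [IsStrictOrderedRing R]
    [IsRealClosed R] [TopologicalSpace R] [OrderTopology R] (n : ℕ)
    (J : Ideal (MvPolynomial (Fin n) R)) (I I' : Ideal (MvPolynomial (Fin (n + 1)) R))
    (hJI : J ≤ I.comap (GeomCAD.incl R n))
    (hdom : GeomCAD.IsProjectionOfRelDimOne hJI)
    (hY : IsDomain (MvPolynomial (Fin n) R ⧸ J))
    (hgen : GeomCAD.IsGenericallyFinite (GeomCAD.projMap hJI))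
    (w : MvPolynomial (Fin n) R ⧸ J)
    (hfinite : (GeomCAD.mapXW hJI w).Finite)
    (hfree : GeomCAD.IsFreeRingHom (GeomCAD.mapXW hJI w))
    (h h' : MvPolynomial (Fin (n + 1)) R)
    (hV : IsDomain (GeomCAD.CoordV hJI I' w h'))
    (v : GeomCAD.CoordV hJI I' w h')
    (hfree_v : GeomCAD.IsFreeRingHom (GeomCAD.mapUv hJI I' w h' v))
    (S : Set (Fin n → R)) (hS : GeomCAD.IsSemialgebraic S)
    (hSc : GeomCAD.IsSemialgebraicallyConnected S)
    (hSV : S ⊆ GeomCAD.rationalPointsVv hJI I' w h' v)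
    (hX : GeomCAD.GeomDelineable (GeomCAD.locus I h) S)
    (hX' : GeomCAD.GeomDelineable (GeomCAD.locus I' h') S) :
    GeomCAD.JointlyGeomDelineable ![GeomCAD.locus I h, GeomCAD.locus I' h'] S ∧
      (GeomCAD.IsBasicConstructible (GeomCAD.locus I h ∪ GeomCAD.locus I' h') →
        GeomCAD.GeomDelineable (GeomCAD.locus I h ∪ GeomCAD.locus I' h') S) := by
  rcases S.eq_empty_or_nonempty with rfl | hne
  · exact ⟨⟨fun _ => GeomCAD.geomDelineable_empty _,
        fun _ _ σ _ τ _ => .inl (Subsingleton.elim σ τ)⟩,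
      fun _ => GeomCAD.geomDelineable_empty _⟩
  have hP : GeomCAD.HasFiberPolynomials S I I' h' :=
    ⟨GeomCAD.exists_isFiberPolynomial_XW hJI w hfinite hfree hne
      (GeomCAD.exists_ringHom_CoordW hJI I' w h' v hSV),
      GeomCAD.exists_isFiberPolynomial_Uv hJI I' w h' hfinite v hfree_v hne hSV⟩
  have hself {T σ τ} := GeomCAD.sections_eq_or_disjoint (T := T) (σ := σ) (τ := τ) hSc hS
  have hcross : ∀ σ ∈ GeomCAD.sections (GeomCAD.locus I h) S,
      ∀ τ ∈ GeomCAD.sections (GeomCAD.locus I' h') S,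
        σ = τ ∨ Disjoint (Set.range σ) (Set.range τ) := by
    rintro _ ⟨k, ξ, hξ, i, rfl⟩ _ ⟨l, τ, hτ, j, rfl⟩
    exact GeomCAD.eq_or_disjoint_of_delineates hSc hS hP hξ hτ i j
  have hcross' : ∀ τ ∈ GeomCAD.sections (GeomCAD.locus I' h') S,
      ∀ σ ∈ GeomCAD.sections (GeomCAD.locus I h) S,
        τ = σ ∨ Disjoint (Set.range τ) (Set.range σ) :=
    fun τ hτ σ hσ => (hcross σ hσ τ hτ).imp Eq.symm fun hd => hd.symm
  refine ⟨⟨Fin.forall_fin_two.2 ⟨hX, hX'⟩, Fin.forall_fin_two.2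
    ⟨Fin.forall_fin_two.2 ⟨fun _ hσ _ hτ => hself hσ hτ, hcross⟩,
      Fin.forall_fin_two.2 ⟨hcross', fun _ hσ _ hτ => hself hσ hτ⟩⟩⟩, fun hU => ?_⟩
  obtain ⟨k, ξ, hξ⟩ := hX
  obtain ⟨l, τ, hτ⟩ := hX'
  have hdis : ∀ σ ∈ Set.range ξ ∪ Set.range τ, ∀ ρ ∈ Set.range ξ ∪ Set.range τ,
      σ = ρ ∨ Disjoint (Set.range σ) (Set.range ρ) := by
    rintro σ (hσ | hσ) ρ (hρ | hρ)
    exacts [hself ⟨k, ξ, hξ, hσ⟩ ⟨k, ξ, hξ, hρ⟩, hcross σ ⟨k, ξ, hξ, hσ⟩ ρ ⟨l, τ, hτ, hρ⟩,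
      hcross' σ ⟨l, τ, hτ, hσ⟩ ρ ⟨k, ξ, hξ, hρ⟩, hself ⟨l, τ, hτ, hσ⟩ ⟨l, τ, hτ, hρ⟩]
  obtain ⟨T₁, h1, hT₁⟩ := hξ.exists_eq_fiber hP
  obtain ⟨T₂, h2, hT₂ | hT₂⟩ := hτ.exists_strictlyDelineates
  · exact GeomCAD.geomDelineable_union_of_finite hSc hS hne hP h1 hT₁ h2 hT₂ hdis
  · exact GeomCAD.geomDelineable_union_of_cofinite hSc hS hne hP h1 hT₁ h2 hT₂ hdis hU
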